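/- Let $K$ be an algebraically closed field of characteristic zero and let $n\ge 0$. Let $$\mathfrak{sp}(2n)=\left\{\begin{bmatrix}A&B\\ C&-\widehat A\end{bmatrix} : B=\widehat B,\ C=\widehat C\right\},$$ where $A,B,C$ are $n\times n$ matrices over $K$ and $\widehat{\ }$ is the transpose with respect to the antidiagonal. Let $\mathfrak h$, $\mathfrak u_+$, $\mathfrak u_-$ be its subalgebras of diagonal, strictly upper triangular and strictly lower triangular matrices, let $\mathfrak g_\beta$ be the root space of a root $\beta$, and let $\alpha_1,\dots,\alpha_n$ be the simple roots, $\alpha_i=\varepsilon_i-\varepsilon_{i+1}$ for $i<n$ and $\alpha_n=2\varepsilon_n$, where $\varepsilon_i$ is the $i$-th diagonal entry. Let $\underline a=(a_1,\dots,a_m)$ and $\underline b=(b_1,\dots,b_t)$ be (possibly empty) strings of positive integers with $\sum a_i\le n$ and $\sum b_i\le n$. Put $\varphi(\underline a)=\{\alpha_{a_1},\alpha_{a_1+a_2},\dots,\alpha_{a_1+\dots+a_m}\}$. The symplectic seaweed $\mathfrak p_n^{C}(\underline a\,|\,\underline b)$ is $\mathfrak p\cap\mathfrak p'$, where $\mathfrak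 p$ is the parabolic subalgebra generated by $\mathfrak h\oplus\mathfrak u_+$ and the $\mathfrak g_{-\alpha_i}$ with $\alpha_i\notin\varphi(\underline a)$, and $\mathfrak p'$ is the one generated by $\mathfrak h\oplus\mathfrak u_-$ and the $\mathfrak g_{\alpha_i}$ with $\alpha_i\notin\varphi(\underline b)$. The index of a finite-dimensional Lie algebra $\mathfrak g$ is $\min_{f\in\mathfrak g^*}\dim\ker B_f$, where $B_f(x,y)=f([x,y])$. The symplectic meander $M_n^C(\underline a\,|\,\underline b)$ is the loopless multigraph on the vertices $1,\dots,n$ with a top edge between distinct $j,k$ whenever, for some $i$, both lie in $\{s+1,\dots,s+a_i\}$ with $s=a_1+\dots+a_{i-1}$ and $j+k=2s+a_i+1$, and with bottom edges defined in the same way by $\underline b$; a top edge and a bottom edge with the same ends are different edges, and together form a cycle. Let $t$ (respectively $b$) be the involution of $\{1,\dots,n\}$ that exchanges the ends of each top (respectively bottom) edge and fixes all other vertices, and let $\sigma=t\circ b$. The tail $T$ is the symmetric difference of $\{r+1,\dots,n\}$ and $\{r'+1,\dots,n\}$, where $r=\sum a_i$ and $r'=\sum b_i$. Then: (i) the index of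 $\mathfrak p_n^{C}(\underline a\,|\,\underline b)$ equals the number of cycles of $M_n^C(\underline a\,|\,\underline b)$ plus the number of its connected components that contain exactly $0$ or exactly $2$ vertices of $T$; (ii) the index of $\mathfrak p_n^{C}(\underline a\,|\,\underline b)$ equals the number of cycles in the disjoint cycle decomposition of $\sigma$ (fixed points included) that contain exactly $0$ or exactly $2$ elements of $T$. -/

import Mathlib

attribute [local instance 100] LieRing.ofAssociativeRing

noncomputable section

namespace SymplecticSeaweed

/-! ### The index of a Lie algebra -/

/-- The Kirillov form `B_f(x, y) = f([x, y])` of a linear functional `f` on a Lie algebra. -/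
def kirillovForm (K L : Type*) [Field K] [LieRing L] [LieAlgebra K L] (f : Module.Dual K L) :
    L →ₗ[K] L →ₗ[K] K :=
  LinearMap.mk₂ K (fun x y => f ⁅x, y⁆)
    (fun x x' y => by simp) (fun c x y => by simp) (fun x y y' => by simp) (fun c x y => by simp)

/-- The index of a finite-dimensional Lie algebra: the minimum of `dim ker B_f` over all linear
functionals `f` (an infimum over a nonempty set of natural numbers, hence attained). -/
def index (K L : Type*) [Field K] [LieRing L] [LieAlgebra K L] : ℕ :=
  ⨅ f : Module.Dual K L, Module.finrank K (LinearMap.ker (kirillovForm K L f))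

/-! ### The symplectic Lie algebra and its standard seaweed subalgebras -/

/-- `2n × 2n` matrices, divided into `n × n` blocks. -/
abbrev Mat (K : Type*) (n : ℕ) : Type _ := Matrix (Fin n ⊕ Fin n) (Fin n ⊕ Fin n) K

/-- The transpose with respect to the antidiagonal. -/
def antiTranspose {K : Type*} {n : ℕ} (A : Matrix (Fin n) (Fin n) K) : Matrix (Fin n) (Fin n) K :=
  Matrix.of fun i j => A j.rev i.rev

section antiTranspose

variable {K : Type*} [Field K] {n : ℕ}

theorem antiTranspose_add (A B : Matrix (Fin n) (Fin n) K) :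
    antiTranspose (A + B) = antiTranspose A + antiTranspose B := rfl

theorem antiTranspose_neg (A : Matrix (Fin n) (Fin n) K) :
    antiTranspose (-A) = -antiTranspose A := rfl

theorem antiTranspose_sub (A B : Matrix (Fin n) (Fin n) K) :
    antiTranspose (A - B) = antiTranspose A - antiTranspose B := rfl

theorem antiTranspose_smul (c : K) (A : Matrix (Fin n) (Fin n) K) :
    antiTranspose (c • A) = c • antiTranspose A := rfl

theorem antiTranspose_zero : antiTranspose (0 : Matrix (Fin n) (Fin n) K) = 0 := rfl

theorem antiTranspose_antiTranspose {K : Type*} (A : Matrix (Fin n) (Fin n) K) :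
    antiTranspose (antiTranspose A) = A := by
  ext i j; simp [antiTranspose]

theorem antiTranspose_mul (A B : Matrix (Fin n) (Fin n) K) :
    antiTranspose (A * B) = antiTranspose B * antiTranspose A := by
  ext i j
  simp only [antiTranspose, Matrix.of_apply, Matrix.mul_apply]
  rw [← Equiv.sum_comp Fin.revPerm]
  exact Finset.sum_congr rfl fun k _ => by simp [mul_comm]

end antiTranspose

/-- `sp(2n)`: the block matrices `[A, B; C, -Â]` with `B = B̂` and `C = Ĉ`, where the hat denotes
the transpose with respect to the antidiagonal. -/
def sp (K : Type*) [Field K] (n : ℕ) : LieSubalgebra K (Mat K n) where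
  carrier := {M | ∃ A B C : Matrix (Fin n) (Fin n) K, B = antiTranspose B ∧ C = antiTranspose C ∧
    M = Matrix.fromBlocks A B C (-antiTranspose A)}
  add_mem' := by
    rintro _ _ ⟨A, B, C, hB, hC, rfl⟩ ⟨A', B', C', hB', hC', rfl⟩
    refine ⟨A + A', B + B', C + C', ?_, ?_, ?_⟩
    · rw [antiTranspose_add, ← hB, ← hB']
    · rw [antiTranspose_add, ← hC, ← hC']
    · rw [Matrix.fromBlocks_add, antiTranspose_add, neg_add]
  zero_mem' := ⟨0, 0, 0, rfl, rfl, by simp [antiTranspose_zero]⟩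
  smul_mem' := by
    rintro c _ ⟨A, B, C, hB, hC, rfl⟩
    refine ⟨c • A, c • B, c • C, ?_, ?_, ?_⟩
    · rw [antiTranspose_smul, ← hB]
    · rw [antiTranspose_smul, ← hC]
    · rw [Matrix.fromBlocks_smul, antiTranspose_smul, smul_neg]
  lie_mem' := by
    rintro _ _ ⟨A, B, C, hB, hC, rfl⟩ ⟨A', B', C', hB', hC', rfl⟩
    refine ⟨A * A' + B * C' - (A' * A + B' * C),
      A * B' + B * -antiTranspose A' - (A' * B + B' * -antiTranspose A),
      C * A' + -antiTranspose A * C' - (C' * A + -antiTranspose A' * C), ?_, ?_, ?_⟩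
    · simp only [antiTranspose_add, antiTranspose_sub, antiTranspose_mul, antiTranspose_neg,
        antiTranspose_antiTranspose, ← hB, ← hB']
      noncomm_ring
    · simp only [antiTranspose_add, antiTranspose_sub, antiTranspose_mul, antiTranspose_neg,
        antiTranspose_antiTranspose, ← hC, ← hC']
      noncomm_ring
    · rw [Ring.lie_def, Matrix.fromBlocks_multiply, Matrix.fromBlocks_multiply,
        sub_eq_add_neg, Matrix.fromBlocks_neg, Matrix.fromBlocks_add]
      simp only [antiTranspose_add, antiTranspose_sub, antiTranspose_mul,
        ← hB, ← hB', ← hC, ← hC']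
      congr 1 <;> noncomm_ring

/-- The position of an index among the rows (or columns) of a `2n × 2n` matrix, counted from `0`. -/
def pos {n : ℕ} : Fin n ⊕ Fin n → ℕ
  | Sum.inl i => i
  | Sum.inr i => n + i

/-- `h`: the diagonal matrices in `sp(2n)`. -/
def cartan (K : Type*) [Field K] (n : ℕ) : Set (Mat K n) :=
  {H | H ∈ sp K n ∧ H.IsDiag}

/-- `h ⊕ u₊`: the upper triangular matrices in `sp(2n)`. -/
def borelUpper (K : Type*) [Field K] (n : ℕ) : Set (Mat K n) :=
  {M | M ∈ sp K n ∧ ∀ p q, pos q < pos p → M p q = 0}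

/-- `h ⊕ u₋`: the lower triangular matrices in `sp(2n)`. -/
def borelLower (K : Type*) [Field K] (n : ℕ) : Set (Mat K n) :=
  {M | M ∈ sp K n ∧ ∀ p q, pos p < pos q → M p q = 0}

/-- The simple roots of `sp(2n)` as functions on diagonal matrices, indexed from `0`: with `εᵢ` the
`i`-th diagonal entry, they are `εᵢ - εᵢ₊₁` (for all `i` but the last) and, for the last one (the
exceptional root), `2 εᵢ`. -/
def simpleRoot {K : Type*} [Field K] {n : ℕ} (i : Fin n) (H : Mat K n) : K :=
  if h : (i : ℕ) + 1 < n then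
    H (Sum.inl i) (Sum.inl i) - H (Sum.inl ⟨i + 1, h⟩) (Sum.inl ⟨i + 1, h⟩)
  else 2 * H (Sum.inl i) (Sum.inl i)

/-- The root space `{X ∈ sp(2n) | [H, X] = β(H) X for all H ∈ h}` of a function `β` on `h`. -/
def rootSpace {K : Type*} [Field K] {n : ℕ} (β : Mat K n → K) : Set (Mat K n) :=
  {X | X ∈ sp K n ∧ ∀ H ∈ cartan K n, ⁅H, X⁆ = β H • X}

/-- The parabolic subalgebra of `sp(2n)` that contains `h ⊕ u₊` and misses, among the root spaces of
the negatives of the simple roots, exactly those of the roots in `Ψ`: it is generated by `h ⊕ u₊`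
and the root spaces of `-αᵢ` for `αᵢ ∉ Ψ`. -/
def parabolicUpper (K : Type*) [Field K] (n : ℕ) (Ψ : Set (Fin n)) : LieSubalgebra K (Mat K n) :=
  LieSubalgebra.lieSpan K (Mat K n)
    (borelUpper K n ∪ ⋃ i ∈ Ψᶜ, rootSpace fun H => -simpleRoot i H)

/-- The parabolic subalgebra of `sp(2n)` that contains `h ⊕ u₋` and misses, among the root spaces of
the simple roots, exactly those of the roots in `Ψ`: it is generated by `h ⊕ u₋` and the root spaces
of `αᵢ` for `αᵢ ∉ Ψ`. -/
def parabolicLower (K : Type*) [Field K] (n : ℕ) (Ψ : Set (Fin n)) : LieSubalgebra K (Mat K n) :=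
  LieSubalgebra.lieSpan K (Mat K n)
    (borelLower K n ∪ ⋃ i ∈ Ψᶜ, rootSpace fun H => simpleRoot i H)

/-- `a` is a (possibly empty) string of positive integers with sum at most `n`. -/
def IsCompositionLE (n : ℕ) (a : List ℕ) : Prop :=
  (∀ x ∈ a, 0 < x) ∧ a.sum ≤ n

/-- The set `{α_{a₁}, α_{a₁+a₂}, …, α_{a₁+⋯+aₘ}}` of simple roots attached to `a = (a₁, …, aₘ)`.
The root with label `i + 1` is indexed by `i : Fin n`. -/
def rootsOf (n : ℕ) (a : List ℕ) : Set (Fin n) :=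
  {i | ∃ k, 1 ≤ k ∧ k ≤ a.length ∧ (i : ℕ) + 1 = (a.take k).sum}

/-- The symplectic seaweed `p_n^C(a | b)`. -/
def seaweed (K : Type*) [Field K] (n : ℕ) (a b : List ℕ) : LieSubalgebra K (Mat K n) :=
  parabolicUpper K n (rootsOf n a) ⊓ parabolicLower K n (rootsOf n b)

/-! ### Symplectic meanders -/

/-- The label in `{1, …, n}` of a vertex. -/
def label {n : ℕ} (v : Fin n) : ℕ := v + 1

/-- The vertex `v` lies in the `i`-th block of `a` (with `i` counted from `0`). -/
def InBlock {n : ℕ} (a : List ℕ) (i : Fin a.length) (v : Fin n) : Prop :=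
  (a.take i).sum < label v ∧ label v < (a.take i).sum + a[i] + 1

/-- `a` places an edge between the vertices `j` and `k`: they are distinct, lie in the same block and
are exchanged by the reflection of that block. -/
def Arc {n : ℕ} (a : List ℕ) (j k : Fin n) : Prop :=
  j ≠ k ∧ ∃ i : Fin a.length, InBlock a i j ∧ InBlock a i k ∧
    label j + label k = 2 * (a.take i).sum + a[i] + 1

theorem Arc.symm {n : ℕ} {a : List ℕ} {j k : Fin n} (h : Arc a j k) : Arc a k j := by
  obtain ⟨hne, i, hj, hk, he⟩ := h
  exact ⟨hne.symm, i, hk, hj, by omega⟩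

theorem inBlock_le {n : ℕ} {a : List ℕ} {i i' : Fin a.length} {v : Fin n}
    (h : InBlock a i v) (h' : InBlock a i' v) : i ≤ i' := by
  by_contra hlt
  have hlt : (i' : ℕ) + 1 ≤ i := not_le.mp hlt
  have h1 : (a.take (i' + 1)).sum ≤ (a.take i).sum :=
    (List.take_sublist_take_left hlt).sum_le_sum (by simp)
  rw [List.sum_take_succ a i' i'.isLt] at h1
  have h2 := h.1
  have h3 := h'.2
  simp only [Fin.getElem_fin] at h3
  omega

theorem Arc.unique {n : ℕ} {a : List ℕ} {j k k' : Fin n} (h : Arc a j k) (h' : Arc a j k') :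
    k = k' := by
  obtain ⟨-, i, hj, -, he⟩ := h
  obtain ⟨-, i', hj', -, he'⟩ := h'
  obtain rfl : i = i' := le_antisymm (inBlock_le hj hj') (inBlock_le hj' hj)
  simp only [label] at he he'
  exact Fin.ext (by omega)

open Classical in
/-- The vertex joined to `j` by an edge of `a`, or `j` itself if there is none. -/
def partner {n : ℕ} (a : List ℕ) (j : Fin n) : Fin n :=
  if h : ∃ k, Arc a j k then h.choose else j

theorem partner_of_arc {n : ℕ} {a : List ℕ} {j k : Fin n} (h : Arc a j k) : partner a j = k := by
  have hex : ∃ k, Arc a j k := ⟨k, h⟩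
  rw [partner, dif_pos hex]
  exact hex.choose_spec.unique h

theorem partner_involutive {n : ℕ} (a : List ℕ) :
    Function.Involutive (partner a : Fin n → Fin n) := by
  intro j
  by_cases hex : ∃ k, Arc a j k
  · obtain ⟨k, hk⟩ := hex
    rw [partner_of_arc hk, partner_of_arc hk.symm]
  · have hj : partner a j = j := by rw [partner, dif_neg hex]
    rw [hj, hj]

/-- The bijection of the vertices defined by `a`: the top bijection `t` for the first string of a
meander and the bottom bijection `b` for the second one. -/
def arcPerm (n : ℕ) (a : List ℕ) : Equiv.Perm (Fin n) :=
  (partner_involutive a).toPerm (partner a)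

/-- The permutation `σ(j) = t(b(j))`. -/
def sigma (n : ℕ) (a b : List ℕ) : Equiv.Perm (Fin n) := arcPerm n a * arcPerm n b

/-- The symplectic meander `M_n^C(a | b)`, a loopless 2-edge-coloured multigraph. An edge is a colour
(`true` for top, `false` for bottom) with the pair of its ends, so that a top edge and a bottom edge
with the same ends are different edges. -/
def meander (n : ℕ) (a b : List ℕ) : Graph (Fin n) (Bool × Sym2 (Fin n)) where
  vertexSet := Set.univ
  IsLink e x y := e.2 = s(x, y) ∧ Arc (if e.1 then a else b) x y
  isLink_symm e _ := ⟨fun x y h => ⟨h.1.trans Sym2.eq_swap, h.2.symm⟩⟩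
  eq_or_eq_of_isLink_of_isLink e x y v w h h' := by
    have h1 : s(x, y) = s(v, w) := h.1.symm.trans h'.1
    rcases Sym2.eq_iff.mp h1 with h2 | h2
    · exact Or.inl h2.1
    · exact Or.inr h2.1
  left_mem_of_isLink _ x _ _ := Set.mem_univ x

/-- The connected components of a multigraph, as sets of vertices. -/
def components {α β : Type*} (G : Graph α β) : Set (Set α) :=
  {S | ∃ x ∈ G.vertexSet, S = {y | Relation.ReflTransGen G.Adj x y}}

/-- The cycles of a loopless multigraph, as sets of edges: the nonempty finite sets of edges that
form a connected subgraph in which every vertex has degree two. Two parallel edges form a cycle. -/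
def cycles {α β : Type*} (G : Graph α β) : Set (Set β) :=
  {C | C ⊆ G.edgeSet ∧ C.Nonempty ∧ C.Finite ∧
    (∀ x, (∃ e ∈ C, G.Inc e x) → {e ∈ C | G.Inc e x}.ncard = 2) ∧
    ∀ x y, (∃ e ∈ C, G.Inc e x) → (∃ e ∈ C, G.Inc e y) →
      Relation.ReflTransGen (G.restrict C).Adj x y}

/-- The set of vertices whose label exceeds the sum of `a`. -/
def tailOf (n : ℕ) (a : List ℕ) : Set (Fin n) := {v | a.sum < label v}

/-- The tail `T_n(a | b)`. -/
def tail (n : ℕ) (a b : List ℕ) : Set (Fin n) := symmDiff (tailOf n a) (tailOf n b)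

/-- The cycles in the disjoint cycle decomposition of a permutation, fixed points included, as
sets. -/
def permCycles {α : Type*} (σ : Equiv.Perm α) : Set (Set α) :=
  {S | ∃ x, S = {y | σ.SameCycle x y}}

end SymplecticSeaweed

end

set_option linter.unusedSectionVars false

noncomputable section

namespace SymplecticSeaweed

section

/-! ### Generic points on a line -/

section Generic

variable {K : Type*} [Field K]

/-! The index and the cycle count obey the same Euclidean recursion in the two strings; this gives
(ii). Part (i) then follows from the structure of a product of two involutions.

Reversing the last `n` coordinates (`flip`) turns the seaweed into an algebra of block matrices `[P,
Q; S, -Pᵀ]` with `Q`, `S` symmetric and with entries confined to a pattern (`mem_seaweed_iff`). An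
entry of `P` on or above the diagonal is allowed within a block of `b`, one on or below it within a
block of `a`; `Q` lives beyond `b.sum` and `S` beyond `a.sum`.

Let `c` and `d` be the first parts. If `c = d`, the algebra splits off `gl(c)`, of index `c`
(`listIndex_cons_cons`). If `c < d`, the entries of `P` with row in the first `c` positions and
column in the other `d - c` positions of the larger block form an abelian subalgebra. A generic
functional restricts to it as a matrix of maximal rank, which can be moved to a normal form.
Symplectic reduction (`finrank_ker_eq_of_isotropic`, `index_eq_of_reduction`) then leaves the
seaweed of `(a | d - 2c, c, b)` or `(2c - d, a | c, b)` on fewer vertices (`Contraction.index_eq`).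
The case `c > d` is symmetric. If one string is empty, a generic functional gives a nondegenerate
symmetric form on the first block of the other, and its stabilizer, an orthogonal Lie algebra of
index `d / 2`, splits off (`OrthExtension.index_eq`). If both are empty, `sp(2n)` has index `n`.
These base indices come from a regular diagonal element and independent powers of a generic matrix
(`index_eq_card_of_diagonal`).

For `σ`, equal first parts give `c` fixed points off the tail, a contraction passes to a first
return map (`cycleCount_return`), and an empty string gives the reversal of a block inside the tail,
with `d / 2` pairs that count and possibly a middle point that does not.

For (i), the orbits of the group generated by `t` and `b` are the components of the meander. An
orbit without fixed points of `t` or `b` is a cycle of the meander and consists of two cycles of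
`σ`; any other orbit is a single cycle of `σ` (`isSplit_iff`). Tail vertices are fixed by `t` or by
`b`, so they avoid the orbits of the first kind (`cycleCount_eq_add`). -/

open Polynomial in
theorem finite_setOf_det_map_eval_eq_zero {ι : Type*} [Fintype ι] [DecidableEq ι]
    (M : Matrix ι ι K[X]) (t₀ : K) (h : (M.map (eval t₀)).det ≠ 0) :
    {t | (M.map (eval t)).det = 0}.Finite := by
  have key : ∀ t, (M.map (eval t)).det = M.det.eval t := fun t => by
    rw [← coe_evalRingHom, RingHom.map_det]; rfl
  have hne : M.det ≠ 0 := fun h0 => h (by rw [key, h0, eval_zero])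
  refine (Polynomial.finite_setOfPred_isRoot hne).subset fun t ht => ?_
  exact (key t).symm.trans ht

open Polynomial in
theorem finite_setOf_det_add_smul_eq_zero {ι : Type*} [Fintype ι] [DecidableEq ι]
    (M₀ M₁ : Matrix ι ι K) (t₀ : K) (h : (M₀ + t₀ • M₁).det ≠ 0) :
    {t : K | (M₀ + t • M₁).det = 0}.Finite := by
  have key : ∀ t, (Matrix.of fun i j => C (M₀ i j) + X * C (M₁ i j)).map (eval t) = M₀ + t • M₁ :=
    fun t => by
      ext i j
      simp only [Matrix.map_apply, Matrix.of_apply, eval_add, eval_C, eval_mul, eval_X,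
        Matrix.add_apply, Matrix.smul_apply, smul_eq_mul]
  have := finite_setOf_det_map_eval_eq_zero
    (Matrix.of fun i j => C (M₀ i j) + X * C (M₁ i j)) t₀ (by rwa [key])
  simpa only [key] using this

/-- Dual functionals turn linear independence into a determinant equal to 1, hence into a condition
that persists at all but finitely many points of a line. -/
theorem exists_dual_family {ι W : Type*} [Fintype ι] [DecidableEq ι] [AddCommGroup W] [Module K W]
    {u : ι → W} (hu : LinearIndependent K u) :
    ∃ l : ι → Module.Dual K W, (Matrix.of fun i j => l j (u i)) = 1 := by
  let b := Module.Basis.span hu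
  have hex : ∀ j, ∃ g : Module.Dual K W, g.comp (Submodule.subtype _) = b.coord j :=
    fun j => LinearMap.exists_extend (b.coord j)
  choose l hl using hex
  refine ⟨l, ?_⟩
  ext i j
  have h1 : l j (u i) = b.coord j (b i) := by
    rw [← hl j]; simp [b, Module.Basis.span_apply]
  simp [h1, Matrix.one_apply, Finsupp.single_apply]

theorem linearIndependent_of_det_ne_zero {ι W : Type*} [Fintype ι] [DecidableEq ι]
    [AddCommGroup W] [Module K W] {u : ι → W} (l : ι → Module.Dual K W)
    (h : (Matrix.of fun i j => l j (u i)).det ≠ 0) : LinearIndependent K u := by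
  have h1 := Matrix.linearIndependent_rows_of_det_ne_zero h
  exact LinearIndependent.of_comp (LinearMap.pi l) h1

/-- Along a line of linear maps, the dimension of the kernel exceeds the one at the base point
for finitely many parameters only. -/
theorem finite_setOf_finrank_ker_lt {V W : Type*} [AddCommGroup V] [Module K V]
    [FiniteDimensional K V] [AddCommGroup W] [Module K W] (φ₀ φ₁ : V →ₗ[K] W) :
    {t : K | Module.finrank K (LinearMap.ker φ₀) <
      Module.finrank K (LinearMap.ker (φ₀ + t • φ₁))}.Finite := by
  classical
  let b := Module.finBasis K (LinearMap.range φ₀)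
  have hpre : ∀ i, ∃ v, φ₀ v = b i := fun i => (b i).2
  choose v hv using hpre
  have hli : LinearIndependent K fun i => φ₀ (v i) := by
    simp only [hv]
    exact b.linearIndependent.map' _ (Submodule.ker_subtype _)
  obtain ⟨l, hl⟩ := exists_dual_family hli
  -- This minor is 1 at the parameter 0, so it is a nonzero polynomial in `t`; where it does not
  -- vanish, the rank is at least that of `φ₀`.
  have hfin := finite_setOf_det_add_smul_eq_zero (Matrix.of fun i j => l j (φ₀ (v i)))
    (Matrix.of fun i j => l j (φ₁ (v i))) 0 (by simp [hl])
  refine hfin.subset fun t ht => ?_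
  by_contra hdet
  rw [Set.mem_ofPred_eq] at ht
  refine absurd ht (not_lt.mpr ?_)
  have hli' : LinearIndependent K fun i => (φ₀ + t • φ₁) (v i) := by
    refine linearIndependent_of_det_ne_zero l ?_
    rw [Set.mem_ofPred_eq] at hdet
    convert hdet using 3
    ext i j; simp
  have hli'' : LinearIndependent K fun i => (φ₀ + t • φ₁).rangeRestrict (v i) :=
    LinearIndependent.of_comp (Submodule.subtype _) hli'
  have hcard := hli''.fintype_card_le_finrank
  rw [Fintype.card_fin] at hcard
  have e1 := LinearMap.finrank_range_add_finrank_ker φ₀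
  have e2 := LinearMap.finrank_range_add_finrank_ker (φ₀ + t • φ₁)
  omega

end Generic

/-! ### General properties of the index -/

section Index

variable {K : Type*} [Field K] {L L' L'' : Type*} [LieRing L] [LieAlgebra K L] [LieRing L']
  [LieAlgebra K L'] [LieRing L''] [LieAlgebra K L'']

@[simp]
theorem kirillovForm_apply (f : Module.Dual K L) (x y : L) : kirillovForm K L f x y = f ⁅x, y⁆ :=
  rfl

theorem mem_ker_kirillovForm {f : Module.Dual K L} {x : L} :
    x ∈ LinearMap.ker (kirillovForm K L f) ↔ ∀ y, f ⁅x, y⁆ = 0 := by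
  rw [LinearMap.mem_ker, LinearMap.ext_iff]; rfl

theorem index_le (f : Module.Dual K L) :
    index K L ≤ Module.finrank K (LinearMap.ker (kirillovForm K L f)) :=
  ciInf_le (OrderBot.bddBelow _) f

theorem exists_index_eq (K L : Type*) [Field K] [LieRing L] [LieAlgebra K L] :
    ∃ f : Module.Dual K L, Module.finrank K (LinearMap.ker (kirillovForm K L f)) = index K L :=
  ciInf_mem fun f : Module.Dual K L => Module.finrank K (LinearMap.ker (kirillovForm K L f))

theorem le_index {r : ℕ}
    (h : ∀ f : Module.Dual K L, r ≤ Module.finrank K (LinearMap.ker (kirillovForm K L f))) :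
    r ≤ index K L := by
  obtain ⟨f, hf⟩ := exists_index_eq K L
  exact hf ▸ h f

/-- A lower bound for `dim ker B_f` at generic `f` is a lower bound for the index. -/
theorem le_index_of_generic [Infinite K] [FiniteDimensional K L] {r : ℕ}
    (Good : Module.Dual K L → Prop) (f₁ : Module.Dual K L)
    (hline : ∀ f₀ : Module.Dual K L, {t : K | ¬ Good (f₀ + t • (f₁ - f₀))}.Finite)
    (h : ∀ f, Good f → r ≤ Module.finrank K (LinearMap.ker (kirillovForm K L f))) :
    r ≤ index K L := by
  obtain ⟨f₀, hf₀⟩ := exists_index_eq K L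
  have hfin := finite_setOf_finrank_ker_lt (kirillovForm K L f₀) (kirillovForm K L (f₁ - f₀))
  -- An infinite field contains a parameter that is good and does not enlarge the kernel, so the
  -- bound passes to `f₀`, which attains the index.
  obtain ⟨t, ht⟩ := ((hline f₀).union hfin).exists_notMem
  simp only [Set.mem_union, Set.mem_ofPred_eq, not_or, not_not, not_lt] at ht
  have hlin : kirillovForm K L (f₀ + t • (f₁ - f₀)) =
      kirillovForm K L f₀ + t • kirillovForm K L (f₁ - f₀) := by
    ext x y; simp
  rw [← hf₀]
  exact (h _ ht.1).trans (hlin ▸ ht.2)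

theorem finrank_ker_kirillovForm_comp_equiv (e : L ≃ₗ⁅K⁆ L') (f : Module.Dual K L') :
    Module.finrank K (LinearMap.ker (kirillovForm K L (f ∘ₗ (e : L →ₗ[K] L')))) =
      Module.finrank K (LinearMap.ker (kirillovForm K L' f)) := by
  have h : (LinearMap.ker (kirillovForm K L (f ∘ₗ (e : L →ₗ[K] L')))).map
      (e.toLinearEquiv : L →ₗ[K] L') = LinearMap.ker (kirillovForm K L' f) := by
    ext x
    simp only [Submodule.mem_map, mem_ker_kirillovForm]
    constructor
    · rintro ⟨y, hy, rfl⟩ z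
      have := hy (e.symm z)
      change f (e ⁅y, e.symm z⁆) = 0 at this
      rwa [LieEquiv.map_lie, LieEquiv.apply_symm_apply] at this
    · intro hx
      refine ⟨e.symm x, fun y => ?_, by simp⟩
      change f (e ⁅e.symm x, y⁆) = 0
      rw [LieEquiv.map_lie, LieEquiv.apply_symm_apply]
      exact hx (e y)
  rw [← h, LinearEquiv.finrank_map_eq]

theorem index_congr (e : L ≃ₗ⁅K⁆ L') : index K L = index K L' := by
  apply le_antisymm
  · refine le_index fun f => ?_
    rw [← finrank_ker_kirillovForm_comp_equiv e]
    exact index_le _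
  · refine le_index fun f => ?_
    rw [← finrank_ker_kirillovForm_comp_equiv e.symm]
    exact index_le _

theorem finrank_ker_kirillovForm_prod [FiniteDimensional K L] [FiniteDimensional K L']
    (f : Module.Dual K (L × L')) :
    Module.finrank K (LinearMap.ker (kirillovForm K (L × L') f)) =
      Module.finrank K (LinearMap.ker (kirillovForm K L (f ∘ₗ LinearMap.inl K L L'))) +
      Module.finrank K (LinearMap.ker (kirillovForm K L' (f ∘ₗ LinearMap.inr K L L'))) := by
  rw [← Module.finrank_prod]
  refine LinearEquiv.finrank_eq (LinearEquiv.ofBijective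
    (((LinearMap.fst K L L').restrict (q := LinearMap.ker (kirillovForm K L _)) ?_).prod
      ((LinearMap.snd K L L').restrict (q := LinearMap.ker (kirillovForm K L' _)) ?_)) ⟨?_, ?_⟩)
  · intro x hx
    rw [mem_ker_kirillovForm] at hx ⊢
    intro y
    simpa [LieAlgebra.Prod.bracket_apply] using hx (y, 0)
  · intro x hx
    rw [mem_ker_kirillovForm] at hx ⊢
    intro y
    simpa [LieAlgebra.Prod.bracket_apply] using hx (0, y)
  · rintro ⟨x, hx⟩ ⟨y, hy⟩ h
    simp only [LinearMap.prod_apply, Function.prod, Prod.mk.injEq, Subtype.ext_iff,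
      LinearMap.coe_restrict_apply, LinearMap.fst_apply, LinearMap.snd_apply] at h
    exact Subtype.ext (Prod.ext h.1 h.2)
  · rintro ⟨⟨x, hx⟩, ⟨y, hy⟩⟩
    rw [mem_ker_kirillovForm] at hx hy
    refine ⟨⟨(x, y), mem_ker_kirillovForm.mpr fun z => ?_⟩, rfl⟩
    have h1 := hx z.1
    have h2 := hy z.2
    simp only [LinearMap.comp_apply, LinearMap.inl_apply, LinearMap.inr_apply] at h1 h2
    have h3 : ⁅(x, y), z⁆ = (⁅x, z.1⁆, 0) + (0, ⁅y, z.2⁆) := by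
      simp [LieAlgebra.Prod.bracket_apply]
    rw [h3, map_add, h1, h2, add_zero]

theorem index_prod [FiniteDimensional K L] [FiniteDimensional K L'] :
    index K (L × L') = index K L + index K L' := by
  apply le_antisymm
  · obtain ⟨f, hf⟩ := exists_index_eq K L
    obtain ⟨g, hg⟩ := exists_index_eq K L'
    refine (index_le (f.coprod g)).trans ?_
    rw [finrank_ker_kirillovForm_prod, LinearMap.coprod_inl, LinearMap.coprod_inr, hf, hg]
  · refine le_index fun f => ?_
    rw [finrank_ker_kirillovForm_prod]
    exact add_le_add (index_le _) (index_le _)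

/-- Symplectic reduction by an isotropic subspace `V` that meets the kernel trivially and whose
orthogonal is the direct sum of `V` and a subalgebra. -/
theorem finrank_ker_eq_of_isotropic [FiniteDimensional K L] (f : Module.Dual K L)
    (e : L'' →ₗ⁅K⁆ L) (V : Submodule K L)
    (hker : ∀ v ∈ V, (∀ x, f ⁅v, x⁆ = 0) → v = 0)
    (heV : ∀ y, ∀ v ∈ V, f ⁅e y, v⁆ = 0)
    (hperp : ∀ x, (∀ v ∈ V, f ⁅x, v⁆ = 0) → ∃ y, x - e y ∈ V)
    (hinj : ∀ y, e y ∈ V → y = 0) :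
    Module.finrank K (LinearMap.ker (kirillovForm K L f)) =
      Module.finrank K (LinearMap.ker (kirillovForm K L'' (f ∘ₗ (e : L'' →ₗ[K] L)))) := by
  -- The kernel of `B_f` is orthogonal to `V`, so it lies in the image of `T`; the isomorphism of
  -- kernels is the first projection on its preimage `U`.
  let T : L'' × V →ₗ[K] L := (e : L'' →ₗ[K] L).coprod V.subtype
  have hT : ∀ p, T p = e p.1 + p.2 := fun p => rfl
  have hTinj : Function.Injective T := by
    rw [← LinearMap.ker_eq_bot, LinearMap.ker_eq_bot']
    rintro ⟨y, v⟩ h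
    rw [hT] at h
    have hy : y = 0 := hinj y (by rw [eq_neg_of_add_eq_zero_left h]; exact V.neg_mem v.2)
    subst hy
    simpa using h
  let k := LinearMap.ker (kirillovForm K L f)
  let U := k.comap T
  have hU : Module.finrank K U = Module.finrank K k := by
    have h1 : U.map T = k := by
      rw [Submodule.map_comap_eq, inf_eq_right]
      intro x hx
      obtain ⟨y, hy⟩ := hperp x fun v _ => mem_ker_kirillovForm.mp hx v
      exact ⟨(y, ⟨_, hy⟩), by simp [hT]⟩
    rw [← h1]
    exact (LinearEquiv.finrank_eq (Submodule.equivMapOfInjective T hTinj U))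
  rw [← hU]
  refine LinearEquiv.finrank_eq (LinearEquiv.ofBijective
    ((LinearMap.fst K L'' V).restrict (q := LinearMap.ker (kirillovForm K L'' _)) ?_) ⟨?_, ?_⟩)
  · rintro ⟨y, v⟩ hx
    rw [mem_ker_kirillovForm]
    intro z
    have h1 := mem_ker_kirillovForm.mp (Submodule.mem_comap.mp hx) (e z)
    rw [hT, add_lie, map_add, ← lie_skew, ← lie_skew (v : L), map_neg, map_neg, heV z v v.2,
      neg_zero, add_zero, ← map_neg, lie_skew] at h1
    simpa using h1
  · rintro ⟨⟨y, v⟩, hx⟩ ⟨⟨y', v'⟩, hx'⟩ h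
    have hyy : y = y' := congrArg Subtype.val h
    subst hyy
    have h1 : (v : L) - v' = 0 := by
      refine hker _ (V.sub_mem v.2 v'.2) fun z => ?_
      have h2 := mem_ker_kirillovForm.mp (Submodule.mem_comap.mp (Submodule.sub_mem _ hx hx')) z
      simpa [hT] using h2
    simp [Subtype.ext_iff, sub_eq_zero.mp h1]
  · rintro ⟨y, hy⟩
    rw [mem_ker_kirillovForm] at hy
    -- Surjectivity: `B_f(e y, ·)` vanishes on the orthogonal of `V`, hence by duality equals
    -- `B_f(v, ·)` for some `v ∈ V`; then `e y - v` lies in the kernel.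
    let W : Submodule K (Module.Dual K L) := V.map (kirillovForm K L f)
    have hφ : kirillovForm K L f (e y) ∈ W := by
      have h0 : W.dualCoannihilator.dualAnnihilator = W :=
        Subspace.dualCoannihilator_dualAnnihilator_eq
      rw [← h0, Submodule.mem_dualAnnihilator]
      intro x hx
      rw [Submodule.mem_dualCoannihilator] at hx
      obtain ⟨z, hz⟩ := hperp x fun v hv => by
        rw [← lie_skew, map_neg, neg_eq_zero]
        exact hx _ (Submodule.mem_map_of_mem hv)
      have h1 : x = e z + (x - e z) := by abel
      rw [h1, map_add, kirillovForm_apply, kirillovForm_apply, heV y _ hz, add_zero]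
      simpa using hy z
    obtain ⟨v, hv, hve⟩ := hφ
    refine ⟨⟨(y, ⟨-v, V.neg_mem hv⟩), ?_⟩, rfl⟩
    refine Submodule.mem_comap.mpr (mem_ker_kirillovForm.mpr fun z => ?_)
    have h1 := LinearMap.congr_fun hve z
    simp only [kirillovForm_apply] at h1
    rw [hT, add_lie, map_add, ← h1]
    simp only [neg_lie, map_neg, add_neg_cancel]

/-- Reduction of the index: functionals with prescribed restriction to a subspace `N` reduce to a
subalgebra, and a generic functional is conjugate to such a functional. -/
theorem index_eq_of_reduction [Infinite K] [FiniteDimensional K L] {ι : Type*} [Fintype ι]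
    [DecidableEq ι] (e : L'' →ₗ⁅K⁆ L) (N : Submodule K L) (ν : Module.Dual K L)
    (hinj : ∀ y, e y ∈ N → y = 0)
    (hnorm : ∀ f : Module.Dual K L, (∀ v ∈ N, f v = ν v) →
      Module.finrank K (LinearMap.ker (kirillovForm K L f)) =
        Module.finrank K (LinearMap.ker (kirillovForm K L'' (f ∘ₗ (e : L'' →ₗ[K] L)))))
    (w : ι → ι → L) (f₁ : Module.Dual K L) (hf₁ : (Matrix.of fun i j => f₁ (w i j)).det ≠ 0)
    (hgood : ∀ f : Module.Dual K L, (Matrix.of fun i j => f (w i j)).det ≠ 0 →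
      ∃ φ : L ≃ₗ⁅K⁆ L, ∀ v ∈ N, f (φ v) = ν v) :
    index K L = index K L'' := by
  apply le_antisymm
  -- Upper bound: `e` is injective with image meeting `N` trivially, so an optimal `g` on `L''` and
  -- the prescribed `ν` on `N` extend to one functional on `L`.
  · obtain ⟨g, hg⟩ := exists_index_eq K L''
    let T : L'' × N →ₗ[K] L := (e : L'' →ₗ[K] L).coprod N.subtype
    have hTinj : LinearMap.ker T = ⊥ := by
      rw [LinearMap.ker_eq_bot']
      rintro ⟨y, v⟩ h
      have h : e y + (v : L) = 0 := h
      have hy : y = 0 := hinj y (by rw [eq_neg_of_add_eq_zero_left h]; exact N.neg_mem v.2)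
      subst hy
      simpa using h
    obtain ⟨S, hS⟩ := LinearMap.exists_leftInverse_of_injective T hTinj
    let f : Module.Dual K L := (g.coprod (ν ∘ₗ N.subtype)) ∘ₗ S
    have hfT : f ∘ₗ T = g.coprod (ν ∘ₗ N.subtype) := by
      rw [LinearMap.comp_assoc, hS, LinearMap.comp_id]
    have h1 : ∀ v ∈ N, f v = ν v := fun v hv => by
      have := LinearMap.congr_fun hfT (0, ⟨v, hv⟩)
      simpa [T] using this
    have h2 : f ∘ₗ (e : L'' →ₗ[K] L) = g := by
      ext y
      have := LinearMap.congr_fun hfT (y, 0)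
      simpa [T] using this
    rw [← hg, ← h2, ← hnorm f h1]
    exact index_le f
  -- Lower bound: nonvanishing of the determinant is generic, since it holds at `f₁`, and it makes
  -- `f` conjugate to a functional with restriction `ν`.
  · refine le_index_of_generic (fun f => (Matrix.of fun i j => f (w i j)).det ≠ 0) f₁ ?_ ?_
    · intro f₀
      have := finite_setOf_det_add_smul_eq_zero (Matrix.of fun i j => f₀ (w i j))
        (Matrix.of fun i j => (f₁ - f₀) (w i j)) 1 (by
          convert hf₁ using 2
          ext i j; simp)
      convert this using 3 with t
      rw [not_not]
      congr! 2
    · intro f hf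
      obtain ⟨φ, hφ⟩ := hgood f hf
      rw [← finrank_ker_kirillovForm_comp_equiv φ, hnorm _ hφ]
      exact index_le _

end Index

end

section

/-! ### Matrix Lie algebras with a regular diagonal element -/

section Reductive

variable {K : Type*} [Field K]

/-- A linear relation between the powers is a polynomial of degree below `Fintype.card m` that
vanishes at all the distinct entries `z`. -/
theorem linearIndependent_pow_diagonal {m ι : Type*} [Fintype m] [DecidableEq m] [Fintype ι]
    {z : m → K} (hz : Function.Injective z) {E : ι → ℕ} (hE : Function.Injective E)
    (hlt : ∀ i, E i < Fintype.card m) :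
    LinearIndependent K fun i => (Matrix.diagonal z) ^ E i := by
  classical
  rw [Fintype.linearIndependent_iff]
  intro c hc i
  let p : Polynomial K := ∑ i, Polynomial.monomial (E i) (c i)
  have hp : p = 0 := by
    refine Polynomial.eq_zero_of_natDegree_lt_card_of_eval_eq_zero p hz (fun x => ?_) ?_
    · have := congrFun (congrFun hc x) x
      simpa [p, Polynomial.eval_finsetSum, Matrix.sum_apply, Matrix.diagonal_pow] using this
    · by_cases hm : Fintype.card m = 0
      · exact absurd (hlt i) (by omega)
      · refine lt_of_le_of_lt (b := Fintype.card m - 1) ?_ (by omega)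
        refine Polynomial.natDegree_sum_le_of_forall_le _ _ fun j _ => ?_
        exact (Polynomial.natDegree_monomial_le _).trans (by have := hlt j; omega)
  have hi := congrArg (fun q => Polynomial.coeff q (E i)) hp
  simpa [p, Polynomial.finsetSum_coeff, Polynomial.coeff_monomial, hE.eq_iff] using hi

open Polynomial in
/-- Linear independence of given powers of a matrix is a generic property along a line. -/
theorem finite_setOf_not_linearIndependent_pow {m ι : Type*} [Fintype m] [DecidableEq m]
    [Fintype ι] (E : ι → ℕ) (Y Z : Matrix m m K)
    (hZ : LinearIndependent K fun i => Z ^ E i) :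
    {t : K | ¬ LinearIndependent K fun i => (Y + t • (Z - Y)) ^ E i}.Finite := by
  classical
  obtain ⟨l, hl⟩ := exists_dual_family hZ
  -- The line through `Y` and `Z` as a matrix over `K[X]`, with `Z` at the parameter 1; there the
  -- determinant of `M` takes the value 1.
  let N : Matrix m m K[X] := Matrix.of fun p q => C (Y p q) + X * C ((Z - Y) p q)
  let M : Matrix ι ι K[X] := Matrix.of fun i j =>
    ∑ p, ∑ q, C (l j (Matrix.single p q 1)) * (N ^ E i) p q
  have hN : ∀ t, N.map (eval t) = Y + t • (Z - Y) := fun t => by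
    ext p q
    simp only [N, Matrix.map_apply, Matrix.of_apply, eval_add, eval_C, eval_mul, eval_X,
      Matrix.add_apply, Matrix.smul_apply, smul_eq_mul]
  have hNpow : ∀ t k p q, eval t ((N ^ k) p q) = ((Y + t • (Z - Y)) ^ k) p q := fun t k p q => by
    rw [← hN, ← coe_evalRingHom, ← Matrix.map_pow, Matrix.map_apply]
  have hM : ∀ t, M.map (eval t) = Matrix.of fun i j => l j ((Y + t • (Z - Y)) ^ E i) := fun t => by
    ext i j
    rw [Matrix.of_apply, Matrix.matrix_eq_sum_single ((Y + t • (Z - Y)) ^ E i)]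
    simp only [M, Matrix.map_apply, Matrix.of_apply, eval_finsetSum, eval_mul, eval_C, hNpow,
      map_sum]
    refine Finset.sum_congr rfl fun p _ => Finset.sum_congr rfl fun q _ => ?_
    have : Matrix.single p q (((Y + t • (Z - Y)) ^ E i) p q) =
        (((Y + t • (Z - Y)) ^ E i) p q) • Matrix.single p q (1 : K) := by
      rw [Matrix.smul_single, smul_eq_mul, mul_one]
    rw [this, map_smul, smul_eq_mul, mul_comm]
  refine (finite_setOf_det_map_eval_eq_zero M 1 ?_).subset fun t ht => ?_
  · rw [hM, one_smul, add_sub_cancel, hl, Matrix.det_one]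
    exact one_ne_zero
  · rw [Set.mem_ofPred_eq] at ht ⊢
    by_contra h
    rw [hM] at h
    exact ht (linearIndependent_of_det_ne_zero l h)

/-- Every linear functional on matrices is `X ↦ tr (W X)`. -/
theorem exists_trace_eq {m : Type*} [Fintype m] [DecidableEq m]
    (f : Module.Dual K (Matrix m m K)) : ∃ W : Matrix m m K, ∀ X, f X = (W * X).trace := by
  refine ⟨Matrix.of fun i j => f (Matrix.single j i 1), fun X => ?_⟩
  conv_lhs => rw [Matrix.matrix_eq_sum_single X]
  simp only [map_sum, Matrix.trace, Matrix.diag, Matrix.mul_apply, Matrix.of_apply]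
  rw [Finset.sum_comm]
  refine Finset.sum_congr rfl fun p _ => Finset.sum_congr rfl fun q _ => ?_
  rw [← mul_one (X q p), ← smul_eq_mul, ← Matrix.smul_single, map_smul, smul_eq_mul, mul_comm,
    smul_eq_mul, mul_one]

/-- Invariance of the trace form: for `f = tr (Y ·)` the functional `B_f(X, ·)` is `tr ([Y, X] ·)`,
so whatever commutes with `Y` lies in the kernel. -/
theorem trace_mul_lie {m : Type*} [Fintype m] [DecidableEq m] (Y X Z : Matrix m m K) :
    (Y * ⁅X, Z⁆).trace = (⁅Y, X⁆ * Z).trace := by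
  rw [Ring.lie_def, Ring.lie_def, mul_sub, sub_mul, Matrix.trace_sub, Matrix.trace_sub,
    ← mul_assoc, ← mul_assoc]
  congr 1
  rw [Matrix.trace_mul_comm, ← mul_assoc]

/-- If a Lie algebra of matrices that is self-dual for the trace form contains the `E i`-th powers
of its elements and a diagonal matrix with distinct entries, then its index is the number of these
exponents, provided that it equals the dimension of the diagonal part. -/
theorem index_eq_card_of_diagonal [Infinite K] {m ι : Type*} [Fintype m] [DecidableEq m]
    [Fintype ι]
    (L : LieSubalgebra K (Matrix m m K)) {E : ι → ℕ} (hE : Function.Injective E)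
    (hlt : ∀ i, E i < Fintype.card m) (hpow : ∀ Y ∈ L, ∀ i, Y ^ E i ∈ L)
    (hproj : ∀ W : Matrix m m K, ∃ Y ∈ L, ∀ X ∈ L, (W * X).trace = (Y * X).trace)
    (hnd : ∀ W ∈ L, (∀ X ∈ L, (W * X).trace = 0) → W = 0)
    {z : m → K} (hz : Function.Injective z) (hzL : Matrix.diagonal z ∈ L)
    (r : ι → m) (hr : ∀ d : m → K, Matrix.diagonal d ∈ L → (∀ i, d (r i) = 0) → d = 0) :
    index K L = Fintype.card ι := by
  classical
  have hex : ∀ f : Module.Dual K L, ∃ Y ∈ L, ∀ X : L, f X = (Y * X.1).trace := by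
    intro f
    obtain ⟨g, hg⟩ := LinearMap.exists_extend (p := L.toSubmodule) f
    obtain ⟨W, hW⟩ := exists_trace_eq g
    obtain ⟨Y, hY, hYW⟩ := hproj W
    refine ⟨Y, hY, fun X => ?_⟩
    rw [← hYW _ X.2, ← hW, ← hg]
    rfl
  let tr : Matrix m m K → Module.Dual K L := fun Y =>
    (Matrix.traceLinearMap m K K ∘ₗ LinearMap.mulLeft K Y) ∘ₗ L.toSubmodule.subtype
  have htr : ∀ Y (X : L), tr Y X = (Y * X.1).trace := fun Y X => rfl
  apply le_antisymm
  -- Upper bound at the regular diagonal matrix: the kernel commutes with `diagonal z`, so it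
  -- consists of diagonal matrices, which the entries `r i` determine.
  · refine (index_le (tr (Matrix.diagonal z))).trans ?_
    have hdiag : ∀ X : L, X ∈ LinearMap.ker (kirillovForm K L (tr (Matrix.diagonal z))) →
        X.1 = Matrix.diagonal fun i => X.1 i i := by
      intro X hX
      have h0 : ⁅Matrix.diagonal z, X.1⁆ = 0 := by
        refine hnd _ (L.lie_mem hzL X.2) fun Z hZ => ?_
        rw [← trace_mul_lie]
        exact mem_ker_kirillovForm.mp hX ⟨Z, hZ⟩
      ext i j
      by_cases hij : i = j
      · simp [hij]
      · have h1 := congrFun (congrFun h0 i) j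
        rw [Ring.lie_def, Matrix.sub_apply, Matrix.diagonal_mul, Matrix.mul_diagonal,
          Matrix.zero_apply, mul_comm, ← mul_sub, mul_eq_zero, sub_eq_zero, hz.eq_iff] at h1
        rw [Matrix.diagonal_apply_ne _ hij]
        exact h1.resolve_right hij
    let φ : LinearMap.ker (kirillovForm K L (tr (Matrix.diagonal z))) →ₗ[K] (ι → K) :=
      { toFun := fun X i => X.1.1 (r i) (r i)
        map_add' := fun _ _ => rfl
        map_smul' := fun _ _ => rfl }
    have hφ : Function.Injective φ := by
      rw [← LinearMap.ker_eq_bot, LinearMap.ker_eq_bot']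
      intro X hX
      have h1 := hdiag X.1 X.2
      have h2 := hr (fun i => X.1.1 i i) (h1 ▸ X.1.2) fun i => congrFun hX i
      rw [h2] at h1
      exact Subtype.ext (Subtype.ext (by simpa using h1))
    simpa using LinearMap.finrank_le_finrank_of_injective hφ
  -- Lower bound: the powers `Y ^ E i` commute with `Y`, hence lie in the kernel, and for generic
  -- `Y` they are independent.
  · refine le_index_of_generic
      (fun f => ∃ Y ∈ L, (∀ X : L, f X = (Y * X.1).trace) ∧ LinearIndependent K fun i => Y ^ E i)
      (tr (Matrix.diagonal z)) (fun f₀ => ?_) ?_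
    · obtain ⟨Y, hY, hf⟩ := hex f₀
      refine (finite_setOf_not_linearIndependent_pow E Y _
        (linearIndependent_pow_diagonal hz hE hlt)).subset fun t ht => ?_
      rw [Set.mem_ofPred_eq] at ht ⊢
      contrapose! ht
      refine ⟨_, L.add_mem hY (L.smul_mem t (L.sub_mem hzL hY)), fun X => ?_, ht⟩
      rw [LinearMap.add_apply, LinearMap.smul_apply, LinearMap.sub_apply, hf, htr]
      simp [add_mul, sub_mul]
    · rintro f ⟨Y, hY, hf, hli⟩
      have hmem : ∀ i, (⟨Y ^ E i, hpow Y hY i⟩ : L) ∈ LinearMap.ker (kirillovForm K L f) := by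
        intro i
        rw [mem_ker_kirillovForm]
        intro X
        rw [hf]
        change (Y * ⁅Y ^ E i, X.1⁆).trace = 0
        rw [trace_mul_lie, Ring.lie_def, ← pow_succ, ← pow_succ', sub_self, zero_mul,
          Matrix.trace_zero]
      have hli' : LinearIndependent K fun i =>
          (⟨⟨Y ^ E i, hpow Y hY i⟩, hmem i⟩ : LinearMap.ker (kirillovForm K L f)) :=
        LinearIndependent.of_comp
          (L.toSubmodule.subtype ∘ₗ (LinearMap.ker (kirillovForm K L f)).subtype) hli
      exact hli'.fintype_card_le_finrank

theorem index_top_matrix [CharZero K] (m : ℕ) :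
    index K (⊤ : LieSubalgebra K (Matrix (Fin m) (Fin m) K)) = m := by
  refine (index_eq_card_of_diagonal (ι := Fin m) (E := fun i => i) ⊤ Fin.val_injective
    (fun i => by simp) (fun _ _ _ => trivial) (fun W => ⟨W, trivial, fun _ _ => rfl⟩)
    (fun W _ h => ?_) (z := fun i : Fin m => ((i : ℕ) : K)) ?_ trivial id (fun d _ h => funext h)).trans
    (Fintype.card_fin m)
  · ext i j
    have := h (Matrix.single j i 1) trivial
    simpa [Matrix.trace_mul_single] using this
  · intro i j h
    simpa [Fin.ext_iff] using h

/-- The orthogonal Lie algebra of the symmetric form given by the reversal. -/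
def orth (K : Type*) [Field K] (d : ℕ) : LieSubalgebra K (Matrix (Fin d) (Fin d) K) where
  carrier := {X | antiTranspose X = -X}
  add_mem' := by
    intro X Y hX hY
    simp only [Set.mem_ofPred_eq] at *
    rw [antiTranspose_add, hX, hY, neg_add]
  zero_mem' := by simp [antiTranspose_zero]
  smul_mem' := by
    intro c X hX
    simp only [Set.mem_ofPred_eq] at *
    rw [antiTranspose_smul, hX, smul_neg]
  lie_mem' := by
    intro X Y hX hY
    simp only [Set.mem_ofPred_eq] at *
    rw [Ring.lie_def, antiTranspose_sub, antiTranspose_mul, antiTranspose_mul, hX, hY]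
    noncomm_ring

theorem mem_orth {d : ℕ} {X : Matrix (Fin d) (Fin d) K} :
    X ∈ orth K d ↔ antiTranspose X = -X := Iff.rfl

theorem trace_antiTranspose {d : ℕ} (X : Matrix (Fin d) (Fin d) K) :
    (antiTranspose X).trace = X.trace := by
  simp only [Matrix.trace, Matrix.diag, antiTranspose, Matrix.of_apply]
  exact Equiv.sum_comp Fin.revPerm fun i => X i i

theorem antiTranspose_pow {d : ℕ} (X : Matrix (Fin d) (Fin d) K) (k : ℕ) :
    antiTranspose (X ^ k) = antiTranspose X ^ k := by
  induction k with
  | zero => ext i j; simp [antiTranspose, Matrix.one_apply, eq_comm]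
  | succ k ih => rw [pow_succ, antiTranspose_mul, ih, pow_succ']

theorem index_orth [CharZero K] (d : ℕ) : index K (orth K d) = d / 2 := by
  have htr : ∀ W X : Matrix (Fin d) (Fin d) K, X ∈ orth K d →
      (antiTranspose W * X).trace = -(W * X).trace := fun W X hX => by
    rw [← trace_antiTranspose, antiTranspose_mul, antiTranspose_antiTranspose, mem_orth.mp hX,
      Matrix.trace_mul_comm, mul_neg, Matrix.trace_neg]
  -- Odd powers preserve the condition defining `orth`, and there are `d / 2` odd exponents below
  -- `d`. The entries `2 i - (d - 1)` are distinct and change sign under the reversal.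
  refine (index_eq_card_of_diagonal (ι := Fin (d / 2)) (E := fun i => 2 * i + 1) (orth K d)
    (fun i j h => Fin.ext (by simpa using h)) (fun i => ?_) (fun Y hY i => ?_) (fun W => ?_)
    (fun W hW h => ?_) (z := fun i => (2 * (i : ℕ) : K) - (d - 1)) ?_ ?_
    (fun i => ⟨i, by omega⟩) (fun c hc h => ?_)).trans (Fintype.card_fin _)
  · have := i.2
    rw [Fintype.card_fin]; omega
  · rw [mem_orth] at hY ⊢
    rw [antiTranspose_pow, hY, Odd.neg_pow ⟨i, rfl⟩]
  · refine ⟨(2⁻¹ : K) • (W - antiTranspose W), ?_, fun X hX => ?_⟩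
    · rw [mem_orth, antiTranspose_smul, antiTranspose_sub, antiTranspose_antiTranspose, ← smul_neg,
        neg_sub]
    · rw [smul_mul_assoc, Matrix.trace_smul, sub_mul, Matrix.trace_sub, htr W X hX, smul_eq_mul]
      ring
  · ext i j
    have h1 : (W * Matrix.single j i 1).trace = 0 := by
      have h2 := h (Matrix.single j i 1 - antiTranspose (Matrix.single j i 1)) (by
        rw [mem_orth, antiTranspose_sub, antiTranspose_antiTranspose, neg_sub])
      have h3 := htr (Matrix.single j i 1) W hW
      rw [mul_sub, Matrix.trace_sub, Matrix.trace_mul_comm W (antiTranspose _), h3,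
        Matrix.trace_mul_comm (Matrix.single j i 1) W, sub_neg_eq_add, ← two_mul] at h2
      exact (mul_eq_zero.mp h2).resolve_left two_ne_zero
    simpa [Matrix.trace_mul_single] using h1
  · intro i j h
    simpa [Fin.ext_iff] using h
  · rw [mem_orth]
    ext i j
    by_cases hij : i = j
    · subst hij
      have : ((i.rev : ℕ) : K) = d - 1 - i := by
        rw [Fin.val_rev, Nat.cast_sub (by omega)]; push_cast; ring
      simp only [antiTranspose, Matrix.of_apply, Matrix.diagonal_apply_eq, this, Matrix.neg_apply]
      ring
    · have : j.rev ≠ i.rev := fun h => hij (Fin.rev_injective h).symm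
      simp [antiTranspose, Matrix.diagonal_apply_ne _ hij, Matrix.diagonal_apply_ne _ this]
  · have hc' : ∀ i, c i.rev = -c i := fun i => by
      have := congrFun (congrFun (mem_orth.mp hc) i) i
      simpa [antiTranspose] using this
    funext i
    rcases lt_trichotomy (i : ℕ) (i.rev : ℕ) with hlt | heq | hgt
    · exact h ⟨i, by rw [Fin.val_rev] at hlt; omega⟩
    -- The middle entry, present for odd `d`, equals its own negative.
    · have h1 := hc' i
      rw [← Fin.ext heq] at h1
      exact self_eq_neg.mp h1
    · have h1 : c i.rev = 0 := h ⟨i.rev, by rw [Fin.val_rev] at hgt ⊢; omega⟩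
      rw [hc'] at h1
      exact neg_eq_zero.mp h1

end Reductive

end

section

/-! ### Subalgebras of the symplectic Lie algebra with prescribed supports -/

section Blk

variable {K : Type*} [Field K] {J : Type*}

/-- The block matrix `[P, Q; S, -Pᵀ]`. -/
def blk (P Q S : Matrix J J K) : Matrix (J ⊕ J) (J ⊕ J) K :=
  Matrix.fromBlocks P Q S (-P.transpose)

theorem trace_fromBlocks [Fintype J] (A B C D : Matrix J J K) :
    (Matrix.fromBlocks A B C D).trace = A.trace + D.trace := by
  simp [Matrix.trace, Fintype.sum_sum_type]

theorem blk_add (P Q S P' Q' S' : Matrix J J K) :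
    blk P Q S + blk P' Q' S' = blk (P + P') (Q + Q') (S + S') := by
  rw [blk, blk, Matrix.fromBlocks_add, blk, Matrix.transpose_add, neg_add]

theorem blk_sub (P Q S P' Q' S' : Matrix J J K) :
    blk P Q S - blk P' Q' S' = blk (P - P') (Q - Q') (S - S') := by
  rw [sub_eq_iff_eq_add, blk_add, sub_add_cancel, sub_add_cancel, sub_add_cancel]

theorem blk_smul (c : K) (P Q S : Matrix J J K) :
    c • blk P Q S = blk (c • P) (c • Q) (c • S) := by
  rw [blk, blk, Matrix.fromBlocks_smul, Matrix.transpose_smul, smul_neg]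

theorem blk_zero : blk (0 : Matrix J J K) 0 0 = 0 := by
  simp [blk]

theorem blk_inj {P Q S P' Q' S' : Matrix J J K} :
    blk P Q S = blk P' Q' S' ↔ P = P' ∧ Q = Q' ∧ S = S' := by
  rw [blk, blk, Matrix.fromBlocks_inj]
  constructor
  · rintro ⟨h1, h2, h3, -⟩; exact ⟨h1, h2, h3⟩
  · rintro ⟨rfl, rfl, rfl⟩; exact ⟨rfl, rfl, rfl, rfl⟩

variable [Fintype J] [DecidableEq J]

theorem lie_blk {P Q S P' Q' S' : Matrix J J K} (hQ : Q.IsSymm) (hS : S.IsSymm)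
    (hQ' : Q'.IsSymm) (hS' : S'.IsSymm) :
    ⁅blk P Q S, blk P' Q' S'⁆ = blk (P * P' - P' * P + (Q * S' - Q' * S))
      (P * Q' + (P * Q').transpose - (P' * Q + (P' * Q).transpose))
      (S * P' + (S * P').transpose - (S' * P + (S' * P).transpose)) := by
  rw [Ring.lie_def, blk, blk, Matrix.fromBlocks_multiply, Matrix.fromBlocks_multiply,
    sub_eq_add_neg, Matrix.fromBlocks_neg, Matrix.fromBlocks_add, blk]
  simp only [Matrix.transpose_add, Matrix.transpose_sub, Matrix.transpose_mul, hQ.eq, hS.eq,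
    hQ'.eq, hS'.eq]
  congr 1 <;> noncomm_ring

theorem trace_blk_mul_blk (P Q S P' Q' S' : Matrix J J K) :
    (blk P Q S * blk P' Q' S').trace =
      2 * (P * P').trace + (Q * S').trace + (S * Q').trace := by
  rw [blk, blk, Matrix.fromBlocks_multiply, trace_fromBlocks, Matrix.trace_add,
    Matrix.trace_add, neg_mul_neg, ← Matrix.transpose_mul, Matrix.trace_transpose,
    Matrix.trace_mul_comm P' P]
  ring

/-- Every functional `tr (W ·)` on block matrices is given by a block matrix. -/
theorem exists_blk_trace_eq [CharZero K] (W : Matrix (J ⊕ J) (J ⊕ J) K) :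
    ∃ P Q S : Matrix J J K, Q.IsSymm ∧ S.IsSymm ∧ ∀ P' Q' S' : Matrix J J K, Q'.IsSymm →
      S'.IsSymm → (W * blk P' Q' S').trace = (blk P Q S * blk P' Q' S').trace := by
  -- A symmetric block pairs only with a symmetric part, and `P'` is met by both diagonal blocks of
  -- `W`; hence these averages.
  refine ⟨(2⁻¹ : K) • (W.toBlocks₁₁ - W.toBlocks₂₂.transpose),
    (2⁻¹ : K) • (W.toBlocks₁₂ + W.toBlocks₁₂.transpose),
    (2⁻¹ : K) • (W.toBlocks₂₁ + W.toBlocks₂₁.transpose), ?_, ?_, fun P' Q' S' hQ hS => ?_⟩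
  · rw [Matrix.IsSymm, Matrix.transpose_smul, Matrix.transpose_add, Matrix.transpose_transpose,
      add_comm]
  · rw [Matrix.IsSymm, Matrix.transpose_smul, Matrix.transpose_add, Matrix.transpose_transpose,
      add_comm]
  · have ht : ∀ A B : Matrix J J K, B.IsSymm → (A.transpose * B).trace = (A * B).trace :=
      fun A B hB => by
        rw [← Matrix.trace_transpose, Matrix.transpose_mul, Matrix.transpose_transpose, hB.eq,
          Matrix.trace_mul_comm]
    have h22 : (W.toBlocks₂₂.transpose * P').trace = (W.toBlocks₂₂ * P'.transpose).trace := by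
      rw [← Matrix.trace_transpose, Matrix.transpose_mul, Matrix.transpose_transpose,
        Matrix.trace_mul_comm]
    rw [trace_blk_mul_blk]
    conv_lhs => rw [← Matrix.fromBlocks_toBlocks W, blk, Matrix.fromBlocks_multiply,
      trace_fromBlocks]
    simp only [smul_mul_assoc, Matrix.trace_smul, add_mul, sub_mul, Matrix.trace_add,
      Matrix.trace_sub, ht _ _ hQ, ht _ _ hS, h22, smul_eq_mul, mul_neg, Matrix.trace_neg]
    ring

/-- Pairing with elementary elements recovers the representing blocks from the functional; the
factor 2 comes from the two diagonal blocks. -/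
theorem trace_blk_mul_single (P Q S : Matrix J J K) (i j : J) :
    (blk P Q S * blk (Matrix.single j i 1) 0 0).trace = 2 * P i j := by
  rw [trace_blk_mul_blk]
  simp [Matrix.trace_mul_single]

theorem trace_blk_mul_low (P Q S : Matrix J J K) (hQ : Q.IsSymm) (i j : J) :
    (blk P Q S * blk 0 0 (Matrix.single i j 1 + Matrix.single j i 1)).trace = 2 * Q i j := by
  rw [trace_blk_mul_blk]
  simp only [Matrix.mul_add, Matrix.trace_add, mul_zero, Matrix.trace_zero, zero_add,
    Matrix.trace_mul_single, add_zero, MulOpposite.op_one, one_smul, hQ.apply]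
  ring

theorem trace_blk_mul_up (P Q S : Matrix J J K) (hS : S.IsSymm) (i j : J) :
    (blk P Q S * blk 0 (Matrix.single i j 1 + Matrix.single j i 1) 0).trace = 2 * S i j := by
  rw [trace_blk_mul_blk]
  simp only [Matrix.mul_add, Matrix.trace_add, mul_zero, Matrix.trace_zero, zero_add,
    Matrix.trace_mul_single, add_zero, MulOpposite.op_one, one_smul, hS.apply]
  ring

theorem isSymm_single_add_single (i j : J) :
    (Matrix.single i j (1 : K) + Matrix.single j i 1).IsSymm := by
  rw [Matrix.IsSymm, Matrix.transpose_add, Matrix.transpose_single, Matrix.transpose_single,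
    add_comm]

end Blk

/-- The shape of a subalgebra of `sp`: `rel` is the support of the upper left block, `up` and `low`
are the index sets of the upper right and the lower left block. -/
structure Shape (J : Type*) where
  rel : J → J → Prop
  up : J → Prop
  low : J → Prop
  refl : ∀ i, rel i i
  -- The four conditions from here on confine the products `P P'`, `P Q'`, `S P'` and `Q S'` that
  -- occur in a bracket to the pattern.
  trans : ∀ {i j k}, rel i j → rel j k → rel i k
  up_of_rel : ∀ {i j}, rel i j → up j → up i
  low_of_rel : ∀ {i j}, rel i j → low i → low j
  rel_of_up_low : ∀ {i j}, up i → low j → rel i j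

theorem mul_apply_eq_zero_of_support {K J : Type*} [Field K] [Fintype J] {A B : Matrix J J K}
    {r s t : J → J → Prop} (hA : ∀ i j, ¬ r i j → A i j = 0) (hB : ∀ i j, ¬ s i j → B i j = 0)
    (h : ∀ i j k, r i j → s j k → t i k) (i k : J) (hik : ¬ t i k) : (A * B) i k = 0 := by
  rw [Matrix.mul_apply]
  refine Finset.sum_eq_zero fun j _ => ?_
  by_cases hij : r i j
  · rw [hB j k fun hjk => hik (h i j k hij hjk), mul_zero]
  · rw [hA i j hij, zero_mul]

namespace Shape

variable {K : Type*} [Field K] {J : Type*} (D : Shape J)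

/-- The blocks `P, Q, S` have the shape `D`. -/
structure Mem (P Q S : Matrix J J K) : Prop where
  symmQ : Q.IsSymm
  symmS : S.IsSymm
  supp : ∀ i j, ¬ D.rel i j → P i j = 0
  suppQ : ∀ i j, ¬ D.up i → Q i j = 0
  suppS : ∀ i j, ¬ D.low i → S i j = 0

variable {D}

theorem Mem.suppQ' {P Q S : Matrix J J K} (h : D.Mem P Q S) (i j : J) (hj : ¬ D.up j) :
    Q i j = 0 := by
  rw [← h.symmQ.apply]; exact h.suppQ j i hj

theorem Mem.suppS' {P Q S : Matrix J J K} (h : D.Mem P Q S) (i j : J) (hj : ¬ D.low j) :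
    S i j = 0 := by
  rw [← h.symmS.apply]; exact h.suppS j i hj

variable (D) [Fintype J] [DecidableEq J]

/-- The subalgebra of shape `D`. -/
def alg (K : Type*) [Field K] : LieSubalgebra K (Matrix (J ⊕ J) (J ⊕ J) K) where
  carrier := {X | ∃ P Q S, D.Mem P Q S ∧ X = blk P Q S}
  add_mem' := by
    rintro _ _ ⟨P, Q, S, h, rfl⟩ ⟨P', Q', S', h', rfl⟩
    refine ⟨P + P', Q + Q', S + S', ⟨h.symmQ.add h'.symmQ, h.symmS.add h'.symmS, ?_, ?_, ?_⟩,
      blk_add _ _ _ _ _ _⟩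
    · intro i j hij; rw [Matrix.add_apply, h.supp i j hij, h'.supp i j hij, add_zero]
    · intro i j hi; rw [Matrix.add_apply, h.suppQ i j hi, h'.suppQ i j hi, add_zero]
    · intro i j hi; rw [Matrix.add_apply, h.suppS i j hi, h'.suppS i j hi, add_zero]
  zero_mem' := ⟨0, 0, 0, ⟨Matrix.isSymm_zero, Matrix.isSymm_zero, fun _ _ _ => rfl,
    fun _ _ _ => rfl, fun _ _ _ => rfl⟩, blk_zero.symm⟩
  smul_mem' := by
    rintro c _ ⟨P, Q, S, h, rfl⟩
    refine ⟨c • P, c • Q, c • S, ⟨h.symmQ.smul c, h.symmS.smul c, ?_, ?_, ?_⟩,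
      blk_smul _ _ _ _⟩
    · intro i j hij; rw [Matrix.smul_apply, h.supp i j hij, smul_zero]
    · intro i j hi; rw [Matrix.smul_apply, h.suppQ i j hi, smul_zero]
    · intro i j hi; rw [Matrix.smul_apply, h.suppS i j hi, smul_zero]
  lie_mem' := by
    have key : ∀ {P Q S P' Q' S' : Matrix J J K}, D.Mem P Q S → D.Mem P' Q' S' →
        (∀ i j, ¬ D.rel i j → (P * P') i j = 0) ∧ (∀ i j, ¬ D.rel i j → (Q * S') i j = 0) ∧
        (∀ i j, ¬ D.up i → (P * Q') i j = 0) ∧ (∀ i j, ¬ D.up j → (P * Q') i j = 0) ∧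
        (∀ i j, ¬ D.low i → (S * P') i j = 0) ∧ (∀ i j, ¬ D.low j → (S * P') i j = 0) := by
      intro P Q S P' Q' S' h h'
      refine ⟨mul_apply_eq_zero_of_support h.supp h'.supp fun i j k => D.trans, ?_, ?_, ?_, ?_, ?_⟩
      · exact mul_apply_eq_zero_of_support (r := fun i _ => D.up i) (s := fun _ j => D.low j)
          (fun i j => h.suppQ i j) (fun i j => h'.suppS' i j) fun i j k => D.rel_of_up_low
      · exact mul_apply_eq_zero_of_support (s := fun i _ => D.up i) (t := fun i _ => D.up i)
          h.supp (fun i j => h'.suppQ i j) fun i j k => D.up_of_rel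
      · exact mul_apply_eq_zero_of_support (s := fun _ j => D.up j) (t := fun _ j => D.up j)
          h.supp (fun i j => h'.suppQ' i j) fun i j k _ hk => hk
      · exact mul_apply_eq_zero_of_support (r := fun i _ => D.low i) (t := fun i _ => D.low i)
          (fun i j => h.suppS i j) h'.supp fun i j k hi _ => hi
      · exact mul_apply_eq_zero_of_support (r := fun _ j => D.low j) (t := fun _ j => D.low j)
          (fun i j => h.suppS' i j) h'.supp fun i j k hj hjk => D.low_of_rel hjk hj
    rintro _ _ ⟨P, Q, S, h, rfl⟩ ⟨P', Q', S', h', rfl⟩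
    refine ⟨_, _, _, ⟨?_, ?_, ?_, ?_, ?_⟩,
      lie_blk h.symmQ h.symmS h'.symmQ h'.symmS⟩
    · exact (Matrix.isSymm_add_transpose_self _).sub (Matrix.isSymm_add_transpose_self _)
    · exact (Matrix.isSymm_add_transpose_self _).sub (Matrix.isSymm_add_transpose_self _)
    · intro i j hij
      simp only [Matrix.add_apply, Matrix.sub_apply, (key h h').1 i j hij, (key h' h).1 i j hij,
        (key h h').2.1 i j hij, (key h' h).2.1 i j hij, sub_zero, add_zero]
    · intro i j hi
      simp only [Matrix.add_apply, Matrix.sub_apply, Matrix.transpose_apply,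
        (key h h').2.2.1 i j hi, (key h' h).2.2.1 i j hi, (key h h').2.2.2.1 j i hi,
        (key h' h).2.2.2.1 j i hi, sub_zero, add_zero]
    · intro i j hi
      simp only [Matrix.add_apply, Matrix.sub_apply, Matrix.transpose_apply,
        (key h h').2.2.2.2.1 i j hi, (key h' h).2.2.2.2.1 i j hi, (key h h').2.2.2.2.2 j i hi,
        (key h' h).2.2.2.2.2 j i hi, sub_zero, add_zero]

variable {D}

theorem blk_mem_alg {P Q S : Matrix J J K} : blk P Q S ∈ D.alg K ↔ D.Mem P Q S := by
  constructor
  · rintro ⟨P', Q', S', h, he⟩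
    obtain ⟨rfl, rfl, rfl⟩ := blk_inj.mp he
    exact h
  · intro h; exact ⟨P, Q, S, h, rfl⟩

/-- The element with given blocks. -/
def Mem.elt {P Q S : Matrix J J K} (h : D.Mem P Q S) : D.alg K := ⟨blk P Q S, blk_mem_alg.mpr h⟩

theorem exists_elt (X : D.alg K) : ∃ P Q S, ∃ h : D.Mem (K := K) P Q S, X = h.elt := by
  obtain ⟨X, P, Q, S, h, rfl⟩ := X
  exact ⟨P, Q, S, h, rfl⟩

theorem mem_single {i j : J} (h : D.rel i j) : D.Mem (Matrix.single i j (1 : K)) 0 0 where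
  symmQ := Matrix.isSymm_zero
  symmS := Matrix.isSymm_zero
  supp i' j' h' := by
    rw [Matrix.single_apply_of_ne]
    rintro ⟨rfl, rfl⟩
    exact h' h
  suppQ _ _ _ := rfl
  suppS _ _ _ := rfl

theorem mem_low {i j : J} (hi : D.low i) (hj : D.low j) :
    D.Mem 0 0 (Matrix.single i j (1 : K) + Matrix.single j i 1) where
  symmQ := Matrix.isSymm_zero
  symmS := isSymm_single_add_single i j
  supp _ _ _ := rfl
  suppQ _ _ _ := rfl
  suppS i' j' h' := by
    rw [Matrix.add_apply, Matrix.single_apply_of_ne, Matrix.single_apply_of_ne, add_zero]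
    · rintro ⟨rfl, rfl⟩; exact h' hj
    · rintro ⟨rfl, rfl⟩; exact h' hi

theorem mem_up {i j : J} (hi : D.up i) (hj : D.up j) :
    D.Mem 0 (Matrix.single i j (1 : K) + Matrix.single j i 1) 0 where
  symmQ := isSymm_single_add_single i j
  symmS := Matrix.isSymm_zero
  supp _ _ _ := rfl
  suppS _ _ _ := rfl
  suppQ i' j' h' := by
    rw [Matrix.add_apply, Matrix.single_apply_of_ne, Matrix.single_apply_of_ne, add_zero]
    · rintro ⟨rfl, rfl⟩; exact h' hj
    · rintro ⟨rfl, rfl⟩; exact h' hi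

theorem exists_trace [CharZero K] (f : Module.Dual K (D.alg K)) :
    ∃ P Q S : Matrix J J K, Q.IsSymm ∧ S.IsSymm ∧
      ∀ X : D.alg K, f X = (blk P Q S * X.1).trace := by
  obtain ⟨g, hg⟩ := LinearMap.exists_extend (p := (D.alg K).toSubmodule) f
  obtain ⟨W, hW⟩ := exists_trace_eq g
  obtain ⟨P, Q, S, hQ, hS, h⟩ := exists_blk_trace_eq W
  refine ⟨P, Q, S, hQ, hS, fun X => ?_⟩
  obtain ⟨X, P', Q', S', h', rfl⟩ := X
  rw [← h _ _ _ h'.symmQ h'.symmS, ← hW, ← hg]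
  rfl

variable (D) in
/-- Conjugation by an invertible matrix that preserves the subalgebra. -/
def conj (u v : Matrix (J ⊕ J) (J ⊕ J) K) (huv : u * v = 1)
    (hu : ∀ X ∈ D.alg K, u * X * v ∈ D.alg K) (hv : ∀ X ∈ D.alg K, v * X * u ∈ D.alg K) :
    D.alg K ≃ₗ⁅K⁆ D.alg K where
  toFun X := ⟨u * X.1 * v, hu _ X.2⟩
  invFun X := ⟨v * X.1 * u, hv _ X.2⟩
  map_add' X Y := Subtype.ext (by simp [mul_add, add_mul])
  map_smul' c X := Subtype.ext (by simp)
  map_lie' {X Y} := Subtype.ext (by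
    have hvu : v * u = 1 := _root_.mul_eq_one_comm.mp huv
    have key : ∀ A B : Matrix (J ⊕ J) (J ⊕ J) K, u * A * v * (u * B * v) = u * (A * B) * v :=
      fun A B => by
        calc u * A * v * (u * B * v) = u * A * (v * u) * B * v := by noncomm_ring
          _ = u * (A * B) * v := by rw [hvu]; noncomm_ring
    simp only [LieSubalgebra.coe_bracket, Ring.lie_def, key]
    noncomm_ring)
  left_inv X := Subtype.ext (by
    have hvu : v * u = 1 := _root_.mul_eq_one_comm.mp huv
    calc v * (u * X.1 * v) * u = v * u * X.1 * (v * u) := by noncomm_ring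
      _ = X.1 := by rw [hvu, one_mul, mul_one])
  right_inv X := Subtype.ext (by
    calc u * (v * X.1 * u) * v = u * v * X.1 * (u * v) := by noncomm_ring
      _ = X.1 := by rw [huv, one_mul, mul_one])

/-- Conjugating the argument amounts to conjugating the representing matrix the other way: this
coadjoint action brings functionals to normal form. -/
theorem trace_conj {u v : Matrix (J ⊕ J) (J ⊕ J) K} (huv : u * v = 1)
    (hu : ∀ X ∈ D.alg K, u * X * v ∈ D.alg K) (hv : ∀ X ∈ D.alg K, v * X * u ∈ D.alg K)
    (Y : Matrix (J ⊕ J) (J ⊕ J) K) (X : D.alg K) :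
    (Y * (D.conj u v huv hu hv X).1).trace = (v * Y * u * X.1).trace := by
  change (Y * (u * X.1 * v)).trace = _
  rw [Matrix.trace_mul_comm (v * Y * u), ← mul_assoc, Matrix.trace_mul_comm, ← mul_assoc,
    ← mul_assoc, Matrix.trace_mul_comm X.1]

/-- The shape of the transposed matrices. -/
def op {J : Type*} (D : Shape J) : Shape J where
  rel i j := D.rel j i
  up := D.low
  low := D.up
  refl := D.refl
  trans h h' := D.trans h' h
  up_of_rel h h' := D.low_of_rel h h'
  low_of_rel h h' := D.up_of_rel h h'
  rel_of_up_low h h' := D.rel_of_up_low h' h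

theorem neg_transpose_mem_op {X : Matrix (J ⊕ J) (J ⊕ J) K} (hX : X ∈ D.alg K) :
    -X.transpose ∈ D.op.alg K := by
  obtain ⟨P, Q, S, h, rfl⟩ := hX
  refine ⟨-P.transpose, -S, -Q, ⟨h.symmS.neg, h.symmQ.neg, ?_, ?_, ?_⟩, ?_⟩
  · intro i j hij
    rw [Matrix.neg_apply, Matrix.transpose_apply, h.supp j i hij, neg_zero]
  · intro i j hi; rw [Matrix.neg_apply, h.suppS i j hi, neg_zero]
  · intro i j hi; rw [Matrix.neg_apply, h.suppQ i j hi, neg_zero]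
  · rw [blk, Matrix.fromBlocks_transpose, Matrix.fromBlocks_neg, blk, h.symmQ.eq, h.symmS.eq]

/-- The isomorphism is `X ↦ -Xᵀ`. For seaweeds it exchanges the two strings. -/
theorem index_op : index K (D.op.alg K) = index K (D.alg K) := by
  refine (index_congr (K := K) (L := D.alg K) (L' := D.op.alg K)
    { toFun := fun X => ⟨-X.1.transpose, neg_transpose_mem_op X.2⟩
      invFun := fun X => ⟨-X.1.transpose, neg_transpose_mem_op X.2⟩
      map_add' := fun X Y => Subtype.ext (by simp [add_comm])
      map_smul' := fun c X => Subtype.ext (by simp)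
      map_lie' := fun {X Y} => Subtype.ext (by
        simp [Ring.lie_def, Matrix.transpose_mul])
      left_inv := fun X => Subtype.ext (by simp)
      right_inv := fun X => Subtype.ext (by simp) }).symm

/-- Transport of a shape along a bijection. -/
def comap {J J' : Type*} (D : Shape J) (e : J' ≃ J) : Shape J' where
  rel i j := D.rel (e i) (e j)
  up i := D.up (e i)
  low i := D.low (e i)
  refl i := D.refl (e i)
  trans h h' := D.trans h h'
  up_of_rel h h' := D.up_of_rel h h'
  low_of_rel h h' := D.low_of_rel h h'
  rel_of_up_low h h' := D.rel_of_up_low h h'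

theorem submatrix_mem_comap {J' : Type*} [Fintype J'] [DecidableEq J'] (e : J' ≃ J)
    {X : Matrix (J ⊕ J) (J ⊕ J) K} (hX : X ∈ D.alg K) :
    X.submatrix (e.sumCongr e) (e.sumCongr e) ∈ (D.comap e).alg K := by
  obtain ⟨P, Q, S, h, rfl⟩ := hX
  refine ⟨P.submatrix e e, Q.submatrix e e, S.submatrix e e, ⟨h.symmQ.submatrix e,
    h.symmS.submatrix e, fun i j => h.supp _ _, fun i j => h.suppQ _ _, fun i j => h.suppS _ _⟩, ?_⟩
  ext (i | i) (j | j) <;> rfl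

theorem index_comap {J' : Type*} [Fintype J'] [DecidableEq J'] (e : J' ≃ J) :
    index K ((D.comap e).alg K) = index K (D.alg K) := by
  have hsymm : (D.comap e).comap e.symm = D := by
    simp [comap]
  refine (index_congr (K := K) (L := D.alg K) (L' := (D.comap e).alg K)
    { toFun := fun X => ⟨X.1.submatrix (e.sumCongr e) (e.sumCongr e), submatrix_mem_comap e X.2⟩
      invFun := fun X => ⟨X.1.submatrix (e.symm.sumCongr e.symm) (e.symm.sumCongr e.symm), by
        have := submatrix_mem_comap e.symm X.2
        rwa [hsymm] at this⟩
      map_add' := fun X Y => rfl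
      map_smul' := fun c X => rfl
      map_lie' := fun {X Y} => Subtype.ext (by
        simp only [LieSubalgebra.coe_bracket, Ring.lie_def, Matrix.submatrix_mul_equiv]
        rfl)
      left_inv := fun X => Subtype.ext (by ext (i | i) (j | j) <;> simp)
      right_inv := fun X => Subtype.ext (by ext (i | i) (j | j) <;> simp) }).symm

/-- The shape of the whole symplectic Lie algebra. -/
def full (J : Type*) : Shape J where
  rel _ _ := True
  up _ := True
  low _ := True
  refl _ := trivial
  trans _ _ := trivial
  up_of_rel _ _ := trivial
  low_of_rel _ _ := trivial
  rel_of_up_low _ _ := trivial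

theorem mem_full {P Q S : Matrix J J K} (hQ : Q.IsSymm) (hS : S.IsSymm) :
    (full J).Mem P Q S :=
  ⟨hQ, hS, fun _ _ h => (h trivial).elim, fun _ _ h => (h trivial).elim,
    fun _ _ h => (h trivial).elim⟩

/-- The description by the form `Matrix.J` makes it visible that odd powers stay in the algebra. -/
theorem mem_full_alg_iff {X : Matrix (J ⊕ J) (J ⊕ J) K} :
    X ∈ (full J).alg K ↔ X.transpose * Matrix.J J K = -(Matrix.J J K * X) := by
  constructor
  · rintro ⟨P, Q, S, h, rfl⟩
    simp [blk, Matrix.J, Matrix.fromBlocks_transpose, Matrix.fromBlocks_multiply,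
      Matrix.fromBlocks_neg, h.symmQ.eq, h.symmS.eq]
  · intro h
    rw [← Matrix.fromBlocks_toBlocks X] at h ⊢
    rw [Matrix.J, Matrix.fromBlocks_transpose, Matrix.fromBlocks_multiply,
      Matrix.fromBlocks_multiply, Matrix.fromBlocks_neg, Matrix.fromBlocks_inj] at h
    simp only [mul_zero, mul_one, zero_add, mul_neg, add_zero, zero_mul, neg_mul, one_mul,
      neg_neg] at h
    obtain ⟨h1, h2, h3, h4⟩ := h
    refine ⟨_, _, _, mem_full (P := X.toBlocks₁₁) (Q := X.toBlocks₁₂) (S := X.toBlocks₂₁) ?_ h1, ?_⟩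
    · exact neg_injective h4
    · rw [blk, Matrix.fromBlocks_inj]
      exact ⟨rfl, rfl, rfl, h2.symm⟩

theorem index_full [CharZero K] (n : ℕ) : index K ((full (Fin n)).alg K) = n := by
  -- The exponents are 1, 3, …, 2n - 1; the diagonal matrix has the entries 1, …, n, -1, …, -n,
  -- distinct in characteristic zero.
  refine (index_eq_card_of_diagonal (ι := Fin n) (E := fun i => 2 * i + 1) ((full (Fin n)).alg K)
    (fun i j h => Fin.ext (by simpa using h)) (fun i => ?_) (fun Y hY i => ?_) (fun W => ?_)
    (fun W hW h => ?_)
    (z := Sum.elim (fun i : Fin n => (((i : ℕ) + 1 : ℕ) : K))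
      fun i : Fin n => -(((i : ℕ) + 1 : ℕ) : K)) ?_ ?_
    Sum.inl (fun c hc h => ?_)).trans (Fintype.card_fin _)
  · have := i.2
    rw [Fintype.card_sum, Fintype.card_fin]; omega
  · rw [mem_full_alg_iff] at hY ⊢
    have key : ∀ k, (Y ^ k).transpose * Matrix.J (Fin n) K =
        (-1 : K) ^ k • (Matrix.J (Fin n) K * Y ^ k) := by
      intro k
      induction k with
      | zero => simp
      | succ k ih =>
        rw [pow_succ, Matrix.transpose_mul, mul_assoc, ih, mul_smul_comm, ← mul_assoc, hY,
          pow_succ, neg_mul, mul_assoc, (Commute.pow_self Y k).eq]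
        simp
    rw [key, Odd.neg_one_pow ⟨i, rfl⟩, neg_smul, one_smul]
  · obtain ⟨P, Q, S, hQ, hS, hY⟩ := exists_blk_trace_eq W
    refine ⟨blk P Q S, blk_mem_alg.mpr (mem_full hQ hS), ?_⟩
    rintro _ ⟨P', Q', S', h', rfl⟩
    exact hY _ _ _ h'.symmQ h'.symmS
  · obtain ⟨P, Q, S, hm, rfl⟩ := hW
    have h1 : P = 0 := by
      ext i j
      have := h _ (blk_mem_alg.mpr (mem_single (D := full (Fin n)) (i := j) (j := i) trivial))
      rw [trace_blk_mul_single] at this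
      exact (mul_eq_zero.mp this).resolve_left two_ne_zero
    have h2 : Q = 0 := by
      ext i j
      have := h _ (blk_mem_alg.mpr (mem_low (D := full (Fin n)) (i := i) (j := j) trivial trivial))
      rw [trace_blk_mul_low _ _ _ hm.symmQ] at this
      exact (mul_eq_zero.mp this).resolve_left two_ne_zero
    have h3 : S = 0 := by
      ext i j
      have := h _ (blk_mem_alg.mpr (mem_up (D := full (Fin n)) (i := i) (j := j) trivial trivial))
      rw [trace_blk_mul_up _ _ _ hm.symmS] at this
      exact (mul_eq_zero.mp this).resolve_left two_ne_zero
    rw [h1, h2, h3, blk_zero]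
  · have hne : ∀ i j : ℕ, ((i + 1 : ℕ) : K) ≠ -((j + 1 : ℕ) : K) := fun i j h => by
      rw [eq_neg_iff_add_eq_zero, ← Nat.cast_add, Nat.cast_eq_zero] at h
      omega
    rintro (i | i) (j | j) h
    · simpa [Fin.ext_iff] using h
    · exact (hne _ _ h).elim
    · exact (hne _ _ h.symm).elim
    · simpa [Fin.ext_iff] using h
  · refine ⟨Matrix.diagonal fun i : Fin n => (((i : ℕ) + 1 : ℕ) : K), 0, 0,
      mem_full Matrix.isSymm_zero Matrix.isSymm_zero, ?_⟩
    rw [blk, Matrix.diagonal_transpose, Matrix.diagonal_neg, Matrix.fromBlocks_diagonal]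
  · obtain ⟨P, Q, S, hm, he⟩ := hc
    funext p
    have h0 : ∀ i : Fin n, P i i = 0 := fun i => by
      rw [← h i]
      simpa [blk] using (congrFun (congrFun he (Sum.inl i)) (Sum.inl i)).symm
    rcases p with i | i
    · exact h i
    · simpa [blk, h0] using congrFun (congrFun he (Sum.inr i)) (Sum.inr i)

end Shape

end

section

namespace Shape

variable {K : Type*} [Field K] {J J₀ J₁ : Type*} [Fintype J] [DecidableEq J] [Fintype J₀]
  [DecidableEq J₀] [Fintype J₁] [DecidableEq J₁] {D : Shape J}

/-! ### Conjugation by block diagonal matrices -/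

theorem conj_blk (h h' P Q S : Matrix J J K) :
    Matrix.fromBlocks h 0 0 h'.transpose * blk P Q S * Matrix.fromBlocks h' 0 0 h.transpose =
      blk (h * P * h') (h * Q * h.transpose) (h'.transpose * S * h') := by
  simp [blk, Matrix.fromBlocks_multiply, Matrix.transpose_mul, mul_assoc]

theorem Mem.conj {h h' : Matrix J J K} (hs : ∀ i j, ¬ D.rel i j → h i j = 0)
    (hs' : ∀ i j, ¬ D.rel i j → h' i j = 0) {P Q S : Matrix J J K} (hm : D.Mem P Q S) :
    D.Mem (h * P * h') (h * Q * h.transpose) (h'.transpose * S * h') where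
  symmQ := by
    rw [Matrix.IsSymm, Matrix.transpose_mul, Matrix.transpose_mul, Matrix.transpose_transpose,
      hm.symmQ.eq, mul_assoc]
  symmS := by
    rw [Matrix.IsSymm, Matrix.transpose_mul, Matrix.transpose_mul, Matrix.transpose_transpose,
      hm.symmS.eq, mul_assoc]
  supp := mul_apply_eq_zero_of_support
    (mul_apply_eq_zero_of_support hs hm.supp fun _ _ _ => D.trans) hs' fun _ _ _ => D.trans
  suppQ i j := mul_apply_eq_zero_of_support (r := fun i _ => D.up i) (s := fun _ _ => True)
    (t := fun i _ => D.up i)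
    (mul_apply_eq_zero_of_support hs (fun i j => hm.suppQ i j) fun _ _ _ => D.up_of_rel)
    (fun _ _ hn => (hn trivial).elim) (fun _ _ _ hi _ => hi) i j
  suppS i j := mul_apply_eq_zero_of_support (r := fun i _ => D.low i) (s := fun _ _ => True)
    (t := fun i _ => D.low i)
    (mul_apply_eq_zero_of_support (r := fun i j => D.rel j i) (fun i j => hs' j i)
      (fun i j => hm.suppS i j) fun _ _ _ => D.low_of_rel)
    (fun _ _ hn => (hn trivial).elim) (fun _ _ _ hi _ => hi) i j

/-- An invertible matrix `h` supported in `D.rel` acts on the algebra of shape `D`. -/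
theorem exists_conj {h h' : Matrix J J K} (hh : h * h' = 1)
    (hs : ∀ i j, ¬ D.rel i j → h i j = 0) (hs' : ∀ i j, ¬ D.rel i j → h' i j = 0) :
    ∃ φ : D.alg K ≃ₗ⁅K⁆ D.alg K, ∀ (P Q S : Matrix J J K) (X : D.alg K),
      (blk P Q S * (φ X).1).trace =
        (blk (h' * P * h) (h' * Q * h'.transpose) (h.transpose * S * h) * X.1).trace := by
  have hh' : h' * h = 1 := mul_eq_one_comm.mp hh
  have huv : Matrix.fromBlocks h 0 0 h'.transpose * Matrix.fromBlocks h' 0 0 h.transpose = 1 := by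
    simp [Matrix.fromBlocks_multiply, ← Matrix.transpose_mul, hh]
  refine ⟨D.conj _ _ huv ?_ ?_, fun P Q S X => ?_⟩
  · rintro _ ⟨P, Q, S, hm, rfl⟩
    rw [conj_blk]
    exact blk_mem_alg.mpr (hm.conj hs hs')
  · rintro _ ⟨P, Q, S, hm, rfl⟩
    rw [conj_blk]
    exact blk_mem_alg.mpr (hm.conj hs' hs)
  · rw [trace_conj, conj_blk]

/-! ### Lie homomorphisms from smaller shapes -/

/-- The extension of a square matrix by zero. -/
def extendZero (J₀ : Type*) (Q : Matrix J₁ J₁ K) : Matrix (J₀ ⊕ J₁) (J₀ ⊕ J₁) K :=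
  Matrix.fromBlocks 0 0 0 Q

theorem extendZero_isSymm {Q : Matrix J₁ J₁ K} (h : Q.IsSymm) : (extendZero J₀ Q).IsSymm := by
  rw [extendZero, Matrix.isSymm_fromBlocks_iff]
  exact ⟨Matrix.isSymm_zero, rfl, rfl, h⟩

theorem extendZero_sub (Q Q' : Matrix J₁ J₁ K) :
    extendZero J₀ (Q - Q') = extendZero J₀ Q - extendZero J₀ Q' := by
  simp only [extendZero]
  ext (i | i) (j | j) <;> simp

theorem extendZero_add (Q Q' : Matrix J₁ J₁ K) :
    extendZero J₀ (Q + Q') = extendZero J₀ Q + extendZero J₀ Q' := by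
  simp only [extendZero]
  ext (i | i) (j | j) <;> simp

theorem extendZero_transpose (Q : Matrix J₁ J₁ K) :
    extendZero J₀ Q.transpose = (extendZero J₀ Q).transpose := by
  simp [extendZero, Matrix.fromBlocks_transpose]

/-- A Lie homomorphism between algebras of given shapes from a linear map on the upper left block
that is multiplicative where necessary. -/
def embed {D : Shape (J₀ ⊕ J₁)} {D' : Shape J₁}
    (φ : Matrix J₁ J₁ K →ₗ[K] Matrix (J₀ ⊕ J₁) (J₀ ⊕ J₁) K)
    (hmem : ∀ {P Q S}, D'.Mem P Q S → D.Mem (φ P) (extendZero J₀ Q) (extendZero J₀ S))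
    (hmul : ∀ {P Q S P' Q' S'}, D'.Mem P Q S → D'.Mem P' Q' S' → φ (P * P') = φ P * φ P')
    (hQS : ∀ {P Q S P' Q' S'}, D'.Mem P Q S → D'.Mem P' Q' S' →
      φ (Q * S') = extendZero J₀ Q * extendZero J₀ S')
    (hPQ : ∀ {P Q S P' Q' S'}, D'.Mem P Q S → D'.Mem P' Q' S' →
      φ P * extendZero J₀ Q' = extendZero J₀ (P * Q'))
    (hSP : ∀ {P Q S P' Q' S'}, D'.Mem P Q S → D'.Mem P' Q' S' →
      extendZero J₀ S * φ P' = extendZero J₀ (S * P')) :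
    D'.alg K →ₗ⁅K⁆ D.alg K where
  toFun X := ⟨blk (φ X.1.toBlocks₁₁) (extendZero J₀ X.1.toBlocks₁₂) (extendZero J₀ X.1.toBlocks₂₁),
    by
      obtain ⟨X, P, Q, S, hm, rfl⟩ := X
      exact blk_mem_alg.mpr (hmem hm)⟩
  map_add' X Y := Subtype.ext (by
    change blk _ _ _ = blk _ _ _ + blk _ _ _
    rw [blk_add, ← map_add, ← extendZero_add, ← extendZero_add]
    rfl)
  map_smul' c X := Subtype.ext (by
    change blk _ _ _ = c • blk _ _ _
    rw [blk_smul, ← map_smul]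
    congr 1 <;> ext (i | i) (j | j) <;> simp [extendZero, Matrix.toBlocks₁₂, Matrix.toBlocks₂₁])
  map_lie' {X Y} := Subtype.ext (by
    obtain ⟨X, P, Q, S, hm, rfl⟩ := X
    obtain ⟨Y, P', Q', S', hm', rfl⟩ := Y
    have h1 : ⁅blk P Q S, blk P' Q' S'⁆ = _ := lie_blk hm.symmQ hm.symmS hm'.symmQ hm'.symmS
    have h2 := lie_blk (P := φ P) (P' := φ P') (extendZero_isSymm (J₀ := J₀) hm.symmQ)
      (extendZero_isSymm (J₀ := J₀) hm.symmS) (extendZero_isSymm (J₀ := J₀) hm'.symmQ)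
      (extendZero_isSymm (J₀ := J₀) hm'.symmS)
    simp only [LieSubalgebra.coe_bracket, h1]
    refine Eq.trans ?_ h2.symm
    simp only [blk, Matrix.toBlocks_fromBlocks₁₁, Matrix.toBlocks_fromBlocks₁₂,
      Matrix.toBlocks_fromBlocks₂₁]
    simp only [map_add, map_sub, extendZero_sub, extendZero_add, extendZero_transpose,
      hmul hm hm', hmul hm' hm, hQS hm hm', hQS hm' hm, hPQ hm hm', hPQ hm' hm, hSP hm hm',
      hSP hm' hm])

/-- The block diagonal embedding of the product of a matrix Lie algebra and an algebra of given
shape. -/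
def embedProd {D : Shape (J₀ ⊕ J₁)} {D' : Shape J₁} (L₀ : LieSubalgebra K (Matrix J₀ J₀ K))
    (hmem : ∀ {A P Q S}, A ∈ L₀ → D'.Mem P Q S →
      D.Mem (Matrix.fromBlocks A 0 0 P) (extendZero J₀ Q) (extendZero J₀ S)) :
    L₀ × D'.alg K →ₗ⁅K⁆ D.alg K where
  toFun X := ⟨blk (Matrix.fromBlocks X.1.1 0 0 X.2.1.toBlocks₁₁)
    (extendZero J₀ X.2.1.toBlocks₁₂) (extendZero J₀ X.2.1.toBlocks₂₁),
    by
      obtain ⟨A, X, P, Q, S, hm, rfl⟩ := X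
      exact blk_mem_alg.mpr (hmem A.2 hm)⟩
  map_add' X Y := Subtype.ext (by
    change blk _ _ _ = blk _ _ _ + blk _ _ _
    rw [blk_add, ← extendZero_add, ← extendZero_add, Matrix.fromBlocks_add, add_zero, add_zero]
    rfl)
  map_smul' c X := Subtype.ext (by
    change blk _ _ _ = c • blk _ _ _
    rw [blk_smul, Matrix.fromBlocks_smul]
    congr 1 <;> ext (i | i) (j | j) <;>
      simp [extendZero, Matrix.toBlocks₁₁, Matrix.toBlocks₁₂, Matrix.toBlocks₂₁])
  map_lie' {X Y} := Subtype.ext (by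
    obtain ⟨A, X, P, Q, S, hm, rfl⟩ := X
    obtain ⟨A', Y, P', Q', S', hm', rfl⟩ := Y
    have h1 : ⁅blk P Q S, blk P' Q' S'⁆ = _ := lie_blk hm.symmQ hm.symmS hm'.symmQ hm'.symmS
    have h2 := lie_blk (P := Matrix.fromBlocks A.1 0 0 P) (P' := Matrix.fromBlocks A'.1 0 0 P')
      (extendZero_isSymm (J₀ := J₀) hm.symmQ)
      (extendZero_isSymm (J₀ := J₀) hm.symmS) (extendZero_isSymm (J₀ := J₀) hm'.symmQ)
      (extendZero_isSymm (J₀ := J₀) hm'.symmS)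
    simp only [LieAlgebra.Prod.bracket_apply, LieSubalgebra.coe_bracket, h1]
    refine Eq.trans ?_ h2.symm
    simp only [blk, Matrix.toBlocks_fromBlocks₁₁, Matrix.toBlocks_fromBlocks₁₂,
      Matrix.toBlocks_fromBlocks₂₁, Ring.lie_def]
    congr 1
    · ext (i | i) (j | j) <;> simp [extendZero, Matrix.fromBlocks_multiply]
    · ext (i | i) (j | j) <;> simp [extendZero, Matrix.fromBlocks_multiply, -Matrix.transpose_mul]
    · ext (i | i) (j | j) <;> simp [extendZero, Matrix.fromBlocks_multiply, -Matrix.transpose_mul]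
    · ext (i | i) (j | j) <;> simp [extendZero, Matrix.fromBlocks_multiply])

theorem embedProd_elt {D : Shape (J₀ ⊕ J₁)} {D' : Shape J₁} {L₀ : LieSubalgebra K (Matrix J₀ J₀ K)}
    {hmem} {P Q S : Matrix J₁ J₁ K} (A : L₀) (h : D'.Mem P Q S) :
    embedProd (D := D) L₀ hmem (A, h.elt) = (hmem A.2 h).elt := rfl

/-! ### Splitting off a general linear Lie algebra -/

/-- No entry joins the first `c` indices to the others, and `Q`, `S` vanish there; so the algebra is
`gl(c) × D'.alg K`, and the index is additive. -/
theorem index_alg_of_split [CharZero K] {c : ℕ} {D : Shape (Fin c ⊕ J₁)} {D' : Shape J₁}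
    (h₀₀ : ∀ i i', D.rel (.inl i) (.inl i')) (h₀₁ : ∀ i j, ¬ D.rel (.inl i) (.inr j))
    (h₁₀ : ∀ i j, ¬ D.rel (.inr j) (.inl i))
    (h₁₁ : ∀ j j', D.rel (.inr j) (.inr j') ↔ D'.rel j j')
    (hup₀ : ∀ i, ¬ D.up (.inl i)) (hup₁ : ∀ j, D.up (.inr j) ↔ D'.up j)
    (hlow₀ : ∀ i, ¬ D.low (.inl i)) (hlow₁ : ∀ j, D.low (.inr j) ↔ D'.low j) :
    index K (D.alg K) = c + index K (D'.alg K) := by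
  have hmem : ∀ {A : Matrix (Fin c) (Fin c) K} {P Q S : Matrix J₁ J₁ K},
      A ∈ (⊤ : LieSubalgebra K (Matrix (Fin c) (Fin c) K)) → D'.Mem P Q S →
      D.Mem (Matrix.fromBlocks A 0 0 P) (extendZero (Fin c) Q) (extendZero (Fin c) S) := by
    intro A P Q S _ hm
    refine ⟨extendZero_isSymm hm.symmQ, extendZero_isSymm hm.symmS, ?_, ?_, ?_⟩
    · rintro (i | i) (j | j) hij
      · exact (hij (h₀₀ i j)).elim
      · rfl
      · rfl
      · exact hm.supp i j (by rwa [h₁₁] at hij)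
    · rintro (i | i) (j | j) hi
      · rfl
      · rfl
      · rfl
      · exact hm.suppQ i j (by rwa [hup₁] at hi)
    · rintro (i | i) (j | j) hi
      · rfl
      · rfl
      · rfl
      · exact hm.suppS i j (by rwa [hlow₁] at hi)
  refine Eq.trans ?_ (congrArg (· + index K (D'.alg K)) (index_top_matrix (K := K) c))
  refine Eq.trans (Eq.symm ?_) index_prod
  refine index_congr (LieEquiv.ofBijective (embedProd (D := D) ⊤ hmem) ⟨?_, ?_⟩)
  · rw [injective_iff_map_eq_zero]
    rintro ⟨A, X⟩ h
    obtain ⟨P, Q, S, hm, rfl⟩ := exists_elt X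
    rw [embedProd_elt] at h
    have h1 : blk (Matrix.fromBlocks A.1 0 0 P) (extendZero (Fin c) Q) (extendZero (Fin c) S) =
      blk 0 0 0 := (congrArg Subtype.val h).trans blk_zero.symm
    obtain ⟨hP, hQ, hS⟩ := blk_inj.mp h1
    rw [← Matrix.fromBlocks_zero, Matrix.fromBlocks_inj] at hP
    rw [extendZero, ← Matrix.fromBlocks_zero, Matrix.fromBlocks_inj] at hQ hS
    obtain ⟨hA, -, -, rfl⟩ := hP
    obtain ⟨-, -, -, rfl⟩ := hQ
    obtain ⟨-, -, -, rfl⟩ := hS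
    exact Prod.ext (Subtype.ext hA) (Subtype.ext blk_zero)
  · intro X
    obtain ⟨P, Q, S, hm, rfl⟩ := exists_elt X
    have hm' : D'.Mem P.toBlocks₂₂ Q.toBlocks₂₂ S.toBlocks₂₂ := by
      refine ⟨?_, ?_, ?_, ?_, ?_⟩
      · ext i j; exact hm.symmQ.apply _ _
      · ext i j; exact hm.symmS.apply _ _
      · intro i j hij; exact hm.supp _ _ (by rwa [h₁₁])
      · intro i j hi; exact hm.suppQ _ _ (by rwa [hup₁])
      · intro i j hi; exact hm.suppS _ _ (by rwa [hlow₁])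
    refine ⟨(⟨P.toBlocks₁₁, trivial⟩, hm'.elt), ?_⟩
    rw [embedProd_elt]
    refine Subtype.ext (blk_inj.mpr ⟨?_, ?_, ?_⟩)
    · ext (i | i) (j | j)
      · rfl
      · exact (hm.supp _ _ (h₀₁ i j)).symm
      · exact (hm.supp _ _ (h₁₀ j i)).symm
      · rfl
    · ext (i | i) (j | j)
      · exact (hm.suppQ _ _ (hup₀ i)).symm
      · exact (hm.suppQ _ _ (hup₀ i)).symm
      · exact (hm.suppQ' _ _ (hup₀ j)).symm
      · rfl
    · ext (i | i) (j | j)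
      · exact (hm.suppS _ _ (hlow₀ i)).symm
      · exact (hm.suppS _ _ (hlow₀ i)).symm
      · exact (hm.suppS' _ _ (hlow₀ j)).symm
      · rfl

end Shape

end

section

namespace Shape

variable {K : Type*} [Field K] {J₀ J₁ : Type*} [Fintype J₀]
  [DecidableEq J₀] [Fintype J₁] [DecidableEq J₁]

/-! ### Contraction of a block -/

/-- The shape `D` contracts to the shape `D'` by identifying the indices `i` and `κ i`. The set `A`
consists of the remaining indices of the smaller block, and `M` is the middle part of the larger
one; one of these sets is empty. -/
structure Contraction (D : Shape (J₀ ⊕ J₁)) (D' : Shape J₁) (A M : J₁ → Prop) (κ : J₀ → J₁) :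
    Prop where
  -- The smaller block is `J₀ ∪ A` and the larger one `J₀ ∪ A ∪ M ∪ κ(J₀)`. In `D'` both lose `J₀`,
  -- and `M`, if nonempty, becomes separated from `κ(J₀)`.
  inj : Function.Injective κ
  not_A : ∀ i, ¬ A (κ i)
  not_M : ∀ i, ¬ M (κ i)
  empty : ∀ {j j'}, A j → ¬ M j'
  rel₀₀ : ∀ i i', D.rel (.inl i) (.inl i')
  rel₀₁ : ∀ i j, D.rel (.inl i) (.inr j) ↔ A j ∨ M j ∨ j ∈ Set.range κ
  rel₁₀ : ∀ i j, D.rel (.inr j) (.inl i) ↔ A j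
  rel₁₁ : ∀ j j', D.rel (.inr j) (.inr j') ↔ D'.rel j j' ∨ (M j ∧ j' ∈ Set.range κ)
  not_rel_M : ∀ {j} i, M j → ¬ D'.rel j (κ i)
  rel_A : ∀ {j} i, A j → D'.rel j (κ i)
  A_of_rel : ∀ {j j'}, D'.rel j j' → A j' → A j
  of_rel : ∀ {j j'}, D'.rel j j' → (A j ∨ M j ∨ j ∈ Set.range κ) →
    (A j' ∨ M j' ∨ j' ∈ Set.range κ)
  up₀ : ∀ i, ¬ D.up (.inl i)
  up₁ : ∀ j, D.up (.inr j) ↔ D'.up j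
  low₀ : ∀ i, ¬ D.low (.inl i)
  low₁ : ∀ j, D.low (.inr j) ↔ D'.low j
  not_up : ∀ {j}, (A j ∨ M j ∨ j ∈ Set.range κ) → ¬ D'.up j
  not_low : ∀ {j}, A j → ¬ D'.low j

namespace Contraction

open Classical in
/-- The upper left block of the embedding of a contracted algebra. -/
def emb (A : J₁ → Prop) (κ : J₀ → J₁) :
    Matrix J₁ J₁ K →ₗ[K] Matrix (J₀ ⊕ J₁) (J₀ ⊕ J₁) K where
  toFun P := Matrix.fromBlocks (P.submatrix κ κ) 0
    (Matrix.of fun j i => if A j then P j (κ i) else 0)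
    (Matrix.of fun j j' => if A j ∧ j' ∈ Set.range κ then 0 else P j j')
  map_add' P P' := by
    ext (i | i) (j | j) <;> simp <;> split_ifs <;> simp
  map_smul' c P := by
    ext (i | i) (j | j) <;> simp

variable {D : Shape (J₀ ⊕ J₁)} {D' : Shape J₁} {A M : J₁ → Prop} {κ : J₀ → J₁}

theorem emb_mem (h : Contraction D D' A M κ) {P Q S : Matrix J₁ J₁ K} (hm : D'.Mem P Q S) :
    D.Mem (emb A κ P) (extendZero J₀ Q) (extendZero J₀ S) := by
  refine ⟨extendZero_isSymm hm.symmQ, extendZero_isSymm hm.symmS, ?_, ?_, ?_⟩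
  · rintro (i | i) (j | j) hij
    · exact (hij (h.rel₀₀ i j)).elim
    · rfl
    · rw [h.rel₁₀] at hij
      simp [emb, hij]
    · rw [h.rel₁₁, not_or] at hij
      simp [emb, hm.supp i j hij.1]
  · rintro (i | i) (j | j) hi
    · rfl
    · rfl
    · rfl
    · exact hm.suppQ i j (by rwa [h.up₁] at hi)
  · rintro (i | i) (j | j) hi
    · rfl
    · rfl
    · rfl
    · exact hm.suppS i j (by rwa [h.low₁] at hi)

/-- Rows of `P` in the larger block are supported in that block, and columns in `A` meet only rows
in `A`. So copying the `κ` rows and columns to `J₀`, and moving the entries between `A` and `κ(J₀)`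
over to `J₀`, respects products. -/
theorem emb_mul (h : Contraction D D' A M κ) {P Q S P' Q' S' : Matrix J₁ J₁ K}
    (hm : D'.Mem P Q S) (hm' : D'.Mem P' Q' S') :
    emb A κ (P * P') = emb A κ P * emb A κ P' := by
  classical
  have key : ∀ {j l}, A j → ¬ A l → l ∉ Set.range κ → P j l = 0 := fun {j l} hj hl hl' => by
    by_contra hne
    have hr : D'.rel j l := by
      by_contra hn; exact hne (hm.supp j l hn)
    rcases h.of_rel hr (Or.inl hj) with h1 | h1 | h1
    · exact hl h1
    · exact h.empty hj h1
    · exact hl' h1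
  have key' : ∀ {j l} {P Q S : Matrix J₁ J₁ K}, D'.Mem P Q S → ¬ A j → A l → P j l = 0 :=
    fun hm hj hl => hm.supp _ _ fun hr => hj (h.A_of_rel hr hl)
  simp only [emb, LinearMap.coe_mk, AddHom.coe_mk, Matrix.fromBlocks_multiply,
    Matrix.zero_mul, Matrix.mul_zero, add_zero, zero_add]
  congr 1
  · ext i j
    simp only [Matrix.submatrix_apply, Matrix.mul_apply]
    refine (Fintype.sum_of_injective κ h.inj _ _ (fun l hl => ?_) fun _ => rfl).symm
    by_cases hr : D'.rel (κ i) l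
    · rcases h.of_rel hr (Or.inr (Or.inr ⟨i, rfl⟩)) with h1 | h1 | h1
      · exact (h.not_A i (h.A_of_rel hr h1)).elim
      · rw [hm'.supp l (κ j) (h.not_rel_M j h1), mul_zero]
      · exact (hl h1).elim
    · rw [hm.supp _ _ hr, zero_mul]
  · ext j i
    simp only [Matrix.of_apply, Matrix.add_apply, Matrix.mul_apply, Matrix.submatrix_apply]
    by_cases hj : A j
    · simp only [hj, if_true, true_and]
      have h1 : ∑ i', P j (κ i') * P' (κ i') (κ i) =
          ∑ l, if l ∈ Set.range κ then P j l * P' l (κ i) else 0 :=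
        Fintype.sum_of_injective κ h.inj _ _ (fun l hl => if_neg hl) fun i' => by simp
      rw [h1, ← Finset.sum_add_distrib]
      refine Finset.sum_congr rfl fun l _ => ?_
      by_cases hl : l ∈ Set.range κ
      · simp [hl]
      · by_cases hA : A l
        · simp [hl, hA]
        · simp [hl, key hj hA hl]
    · simp only [hj, if_false, zero_mul, Finset.sum_const_zero, zero_add, false_and]
      refine (Finset.sum_eq_zero fun l _ => ?_).symm
      by_cases hA : A l
      · rw [key' hm hj hA, zero_mul]
      · rw [if_neg hA, mul_zero]
  · ext j j'
    simp only [Matrix.of_apply, Matrix.mul_apply]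
    by_cases hjj : A j ∧ j' ∈ Set.range κ
    · rw [if_pos hjj]
      refine (Finset.sum_eq_zero fun l _ => ?_).symm
      by_cases hl : l ∈ Set.range κ
      · rw [if_pos ⟨hjj.1, hl⟩, zero_mul]
      · by_cases hA : A l
        · rw [if_pos (⟨hA, hjj.2⟩ : A l ∧ _), mul_zero]
        · rw [key hjj.1 hA hl]; simp
    · rw [if_neg hjj]
      refine Finset.sum_congr rfl fun l _ => ?_
      by_cases h1 : A j ∧ l ∈ Set.range κ
      · rw [if_pos h1, zero_mul]
        obtain ⟨i, rfl⟩ := h1.2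
        by_cases hr : D'.rel (κ i) j'
        · rcases h.of_rel hr (Or.inr (Or.inr ⟨i, rfl⟩)) with h2 | h2 | h2
          · exact (h.not_A i (h.A_of_rel hr h2)).elim
          · exact (h.empty h1.1 h2).elim
          · exact (hjj ⟨h1.1, h2⟩).elim
        · rw [hm'.supp _ _ hr, mul_zero]
      · rw [if_neg h1]
        by_cases h2 : A l ∧ j' ∈ Set.range κ
        · rw [if_pos h2, mul_zero, key' hm (fun hj => hjj ⟨hj, h2.2⟩) h2.1, zero_mul]
        · rw [if_neg h2]

/-- By `not_up` the rows of `Q` in the larger block vanish, so `emb` has nothing to copy from `Q *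
S'`. -/
theorem emb_mul_up_low (h : Contraction D D' A M κ) {P Q S S' : Matrix J₁ J₁ K}
    (hm : D'.Mem P Q S) : emb A κ (Q * S') = extendZero J₀ Q * extendZero J₀ S' := by
  have key : ∀ {j}, (A j ∨ M j ∨ j ∈ Set.range κ) → ∀ l, (Q * S') j l = 0 := fun hj l => by
    rw [Matrix.mul_apply]
    exact Finset.sum_eq_zero fun l' _ => by rw [hm.suppQ _ _ (h.not_up hj), zero_mul]
  simp only [emb, extendZero, LinearMap.coe_mk, AddHom.coe_mk, Matrix.fromBlocks_multiply,
    Matrix.zero_mul, Matrix.mul_zero, add_zero, zero_add]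
  congr 1
  · ext i j
    exact key (Or.inr (Or.inr ⟨i, rfl⟩)) _
  · ext j i
    simp only [Matrix.of_apply, Matrix.zero_apply]
    split_ifs with hj
    · exact key (Or.inl hj) _
    · rfl
  · ext j j'
    simp only [Matrix.of_apply]
    split_ifs with hj
    · exact (key (Or.inl hj.1) _).symm
    · rfl

theorem emb_mul_up (h : Contraction D D' A M κ) {P P' Q' S' : Matrix J₁ J₁ K}
    (hm' : D'.Mem P' Q' S') : emb A κ P * extendZero J₀ Q' = extendZero J₀ (P * Q') := by
  simp only [emb, extendZero, LinearMap.coe_mk, AddHom.coe_mk, Matrix.fromBlocks_multiply,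
    Matrix.zero_mul, Matrix.mul_zero, add_zero, zero_add]
  congr 1
  ext j j'
  simp only [Matrix.mul_apply, Matrix.of_apply]
  refine Finset.sum_congr rfl fun l _ => ?_
  split_ifs with hl
  · rw [hm'.suppQ _ _ (h.not_up (Or.inr (Or.inr hl.2))), mul_zero, mul_zero]
  · rfl

theorem low_mul_emb (h : Contraction D D' A M κ) {P Q S P' : Matrix J₁ J₁ K}
    (hm : D'.Mem P Q S) : extendZero J₀ S * emb A κ P' = extendZero J₀ (S * P') := by
  simp only [emb, extendZero, LinearMap.coe_mk, AddHom.coe_mk, Matrix.fromBlocks_multiply,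
    Matrix.zero_mul, Matrix.mul_zero, add_zero, zero_add]
  congr 1
  · ext j i
    simp only [Matrix.mul_apply, Matrix.of_apply, Matrix.zero_apply]
    refine Finset.sum_eq_zero fun l _ => ?_
    split_ifs with hl
    · rw [hm.suppS' _ _ (h.not_low hl), zero_mul]
    · rw [mul_zero]
  · ext j j'
    simp only [Matrix.mul_apply, Matrix.of_apply]
    refine Finset.sum_congr rfl fun l _ => ?_
    split_ifs with hl
    · rw [hm.suppS' _ _ (h.not_low hl.1), zero_mul, zero_mul]
    · rfl

/-- The embedding of the contracted algebra. -/
def hom (h : Contraction D D' A M κ) : D'.alg K →ₗ⁅K⁆ D.alg K :=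
  embed (emb A κ) h.emb_mem h.emb_mul (fun hm _ => h.emb_mul_up_low hm)
    (fun _ hm' => h.emb_mul_up hm') (fun hm _ => h.low_mul_emb hm)

end Contraction

end Shape

end

/-! ### Symplectic reduction for a contraction -/

section

namespace Shape

variable {K : Type*} [Field K] {J₀ J₁ : Type*} [Fintype J₀]
  [DecidableEq J₀] [Fintype J₁] [DecidableEq J₁]

theorem apply_lie_eq {J : Type*} [Fintype J] [DecidableEq J] {D : Shape J}
    {f : Module.Dual K (D.alg K)} {P Q S P' Q' S' : Matrix J J K} (hQ : Q.IsSymm) (hS : S.IsSymm)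
    (hf : ∀ X : D.alg K, f X = (blk P Q S * X.1).trace) (hm : D.Mem P' Q' S') (Z : D.alg K) :
    f ⁅hm.elt, Z⁆ = (blk (P * P' - P' * P + (Q * S' - Q' * S))
      (P * Q' + (P * Q').transpose - (P' * Q + (P' * Q).transpose))
      (S * P' + (S * P').transpose - (S' * P + (S' * P).transpose)) * Z.1).trace := by
  rw [hf, ← lie_blk hQ hS hm.symmQ hm.symmS]
  exact trace_mul_lie _ _ _

namespace Contraction

variable {D : Shape (J₀ ⊕ J₁)} {D' : Shape J₁} {A M : J₁ → Prop} {κ : J₀ → J₁}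

/-- The smaller block. -/
def small (A : J₁ → Prop) : J₀ ⊕ J₁ → Prop := Sum.elim (fun _ => True) A

/-- The part of the larger block outside the smaller one. -/
def rest (M : J₁ → Prop) (κ : J₀ → J₁) : J₀ ⊕ J₁ → Prop :=
  Sum.elim (fun _ => False) fun j => M j ∨ j ∈ Set.range κ

theorem small_of_rel (h : Contraction D D' A M κ) {p q : J₀ ⊕ J₁} (hr : D.rel p q)
    (hq : small A q) : small A p := by
  rcases p with i | j
  · trivial
  · rcases q with i' | j'
    · exact (h.rel₁₀ _ _).mp hr
    · rcases (h.rel₁₁ _ _).mp hr with h1 | ⟨-, i, rfl⟩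
      · exact h.A_of_rel h1 hq
      · exact (h.not_A i hq).elim

theorem not_small_of_rest (h : Contraction D D' A M κ) {p : J₀ ⊕ J₁} (hp : rest M κ p) :
    ¬ small A p := by
  rcases p with i | j
  · exact hp.elim
  · rcases hp with h1 | ⟨i, rfl⟩
    · exact fun h2 => h.empty h2 h1
    · exact h.not_A i

theorem rest_of_rel (h : Contraction D D' A M κ) {p q : J₀ ⊕ J₁} (hr : D.rel p q)
    (hp : rest M κ p) : rest M κ q := by
  rcases p with i | j
  · exact hp.elim
  · have hq : ¬ small A q := fun hq => h.not_small_of_rest hp (h.small_of_rel hr hq)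
    rcases q with i' | j'
    · exact (hq trivial).elim
    · rcases (h.rel₁₁ _ _).mp hr with h1 | ⟨-, h1⟩
      · exact (h.of_rel h1 (Or.inr hp)).resolve_left hq
      · exact Or.inr h1

theorem rel_of_small_rest (h : Contraction D D' A M κ) {p q : J₀ ⊕ J₁} (hp : small A p)
    (hq : rest M κ q) : D.rel p q := by
  rcases q with i' | j'
  · exact hq.elim
  · rcases p with i | j
    · exact (h.rel₀₁ _ _).mpr (Or.inr hq)
    · rcases hq with h1 | ⟨i, rfl⟩
      · exact (h.empty hp h1).elim
      · exact (h.rel₁₁ _ _).mpr (Or.inl (h.rel_A i hp))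

theorem not_up_of_rest (h : Contraction D D' A M κ) {p : J₀ ⊕ J₁} (hp : rest M κ p) :
    ¬ D.up p := by
  rcases p with i | j
  · exact hp.elim
  · rw [h.up₁]; exact h.not_up (Or.inr hp)

theorem not_low_of_small (h : Contraction D D' A M κ) {p : J₀ ⊕ J₁} (hp : small A p) :
    ¬ D.low p := by
  rcases p with i | j
  · exact h.low₀ i
  · rw [h.low₁]; exact h.not_low hp

/-- The matrix of the map `κ`. -/
def link (K : Type*) [Field K] (κ : J₀ → J₁) : Matrix (J₀ ⊕ J₁) (J₀ ⊕ J₁) K :=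
  Matrix.fromBlocks 0 0 (Matrix.of fun j i => if j = κ i then 1 else 0) 0

theorem link_mul_range (h : Contraction D D' A M κ) (P : Matrix (J₀ ⊕ J₁) (J₀ ⊕ J₁) K) (i : J₀)
    (q : J₀ ⊕ J₁) : (link K κ * P) (.inr (κ i)) q = P (.inl i) q := by
  simp [link, Matrix.mul_apply, Fintype.sum_sum_type, h.inj.eq_iff]

theorem link_mul_M (h : Contraction D D' A M κ) (P : Matrix (J₀ ⊕ J₁) (J₀ ⊕ J₁) K) {j : J₁}
    (hj : M j) (q : J₀ ⊕ J₁) : (link K κ * P) (.inr j) q = 0 := by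
  have : ∀ i, j ≠ κ i := fun i hi => h.not_M i (hi ▸ hj)
  simp [link, Matrix.mul_apply, Fintype.sum_sum_type, this]

theorem mul_link_inl (P : Matrix (J₀ ⊕ J₁) (J₀ ⊕ J₁) K) (i : J₀) (p : J₀ ⊕ J₁) :
    (P * link K κ) p (.inl i) = P p (.inr (κ i)) := by
  simp [link, Matrix.mul_apply, Fintype.sum_sum_type]

theorem mul_link_inr (P : Matrix (J₀ ⊕ J₁) (J₀ ⊕ J₁) K) (j : J₁) (p : J₀ ⊕ J₁) :
    (P * link K κ) p (.inr j) = 0 := by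
  simp [link, Matrix.mul_apply, Fintype.sum_sum_type]

/-- By the supports, the `rest` × `small` block of `[Y, X]` depends only on the same block of `Y`,
which is that of `link`. Orthogonality to `nil` thus becomes a condition on `P` alone. -/
theorem commutator_apply (h : Contraction D D' A M κ)
    {PY QY SY P Q S : Matrix (J₀ ⊕ J₁) (J₀ ⊕ J₁) K} (hm : D.Mem P Q S)
    (hY : ∀ x a, rest M κ x → small A a → PY x a = link K κ x a) {x a : J₀ ⊕ J₁}
    (hx : rest M κ x) (ha : small A a) :
    (PY * P - P * PY + (QY * S - Q * SY)) x a = (link K κ * P - P * link K κ) x a := by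
  simp only [Matrix.add_apply, Matrix.sub_apply, Matrix.mul_apply]
  have h1 : ∀ k, QY x k * S k a = 0 := fun k => by
    rw [hm.suppS' _ _ (h.not_low_of_small ha), mul_zero]
  have h2 : ∀ k, Q x k * SY k a = 0 := fun k => by
    rw [hm.suppQ _ _ (h.not_up_of_rest hx), zero_mul]
  simp only [h1, h2, Finset.sum_const_zero, sub_zero, add_zero]
  congr 1
  · refine Finset.sum_congr rfl fun k _ => ?_
    by_cases hk : small A k
    · rw [hY x k hx hk]
    · rw [hm.supp k a fun hr => hk (h.small_of_rel hr ha), mul_zero, mul_zero]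
  · refine Finset.sum_congr rfl fun k _ => ?_
    by_cases hk : rest M κ k
    · rw [hY k a hk ha]
    · rw [hm.supp x k fun hr => hk (h.rest_of_rel hr hx), zero_mul, zero_mul]

/-- The abelian subalgebra of matrices that map the complement to the smaller block. -/
def nil (_ : Contraction D D' A M κ) (K : Type*) [Field K] : Submodule K (D.alg K) where
  carrier := {X | ∃ P, (∀ p q, ¬ (small A p ∧ rest M κ q) → P p q = 0) ∧ X.1 = blk P 0 0}
  add_mem' := by
    rintro X Y ⟨P, hP, hX⟩ ⟨P', hP', hY⟩
    refine ⟨P + P', fun p q hpq => ?_, ?_⟩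
    · rw [Matrix.add_apply, hP p q hpq, hP' p q hpq, add_zero]
    · change X.1 + Y.1 = _
      rw [hX, hY, blk_add, add_zero]
  zero_mem' := ⟨0, fun _ _ _ => rfl, blk_zero.symm⟩
  smul_mem' := by
    rintro c X ⟨P, hP, hX⟩
    refine ⟨c • P, fun p q hpq => ?_, ?_⟩
    · rw [Matrix.smul_apply, hP p q hpq, smul_zero]
    · change c • X.1 = _
      rw [hX, blk_smul, smul_zero]

theorem mem_nil {h : Contraction D D' A M κ} {X : D.alg K} :
    X ∈ h.nil K ↔ ∃ P, (∀ p q, ¬ (small A p ∧ rest M κ q) → P p q = 0) ∧ X.1 = blk P 0 0 :=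
  Iff.rfl

theorem elt_mem_nil {h : Contraction D D' A M κ} {P Q S : Matrix (J₀ ⊕ J₁) (J₀ ⊕ J₁) K}
    {hm : D.Mem P Q S} :
    hm.elt ∈ h.nil K ↔ (∀ p q, ¬ (small A p ∧ rest M κ q) → P p q = 0) ∧ Q = 0 ∧ S = 0 := by
  rw [mem_nil]
  constructor
  · rintro ⟨P', hP', he⟩
    obtain ⟨rfl, rfl, rfl⟩ := blk_inj.mp he
    exact ⟨hP', rfl, rfl⟩
  · rintro ⟨hP, rfl, rfl⟩
    exact ⟨P, hP, rfl⟩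

theorem single_mem_nil (h : Contraction D D' A M κ) {p q : J₀ ⊕ J₁} (hp : small A p)
    (hq : rest M κ q) :
    (mem_single (K := K) (h.rel_of_small_rest hp hq)).elt ∈ h.nil K := by
  rw [elt_mem_nil]
  refine ⟨fun p' q' hn => ?_, rfl, rfl⟩
  rw [Matrix.single_apply_of_ne]
  rintro ⟨rfl, rfl⟩
  exact hn ⟨hp, hq⟩

/-- The normal form of a functional. -/
def model (κ : J₀ → J₁) (D : Shape (J₀ ⊕ J₁)) (K : Type*) [Field K] : Module.Dual K (D.alg K) where
  toFun X := 2 * (link K κ * X.1.toBlocks₁₁).trace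
  map_add' X Y := by
    have : (X + Y).1.toBlocks₁₁ = X.1.toBlocks₁₁ + Y.1.toBlocks₁₁ := rfl
    rw [this, mul_add, Matrix.trace_add, mul_add]
  map_smul' c X := by
    have : (c • X).1.toBlocks₁₁ = c • X.1.toBlocks₁₁ := rfl
    rw [this, mul_smul_comm, Matrix.trace_smul, smul_eq_mul, smul_eq_mul, RingHom.id_apply]
    ring

theorem model_elt {P Q S : Matrix (J₀ ⊕ J₁) (J₀ ⊕ J₁) K} (hm : D.Mem P Q S) :
    model κ D K hm.elt = 2 * (link K κ * P).trace := rfl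

theorem trace_mul_eq_of_support {W W' P : Matrix (J₀ ⊕ J₁) (J₀ ⊕ J₁) K}
    (hP : ∀ p q, ¬ (small A p ∧ rest M κ q) → P p q = 0)
    (hW : ∀ x a, rest M κ x → small A a → W x a = W' x a) :
    (W * P).trace = (W' * P).trace := by
  simp only [Matrix.trace, Matrix.diag, Matrix.mul_apply]
  refine Finset.sum_congr rfl fun x _ => Finset.sum_congr rfl fun a _ => ?_
  by_cases hax : small A a ∧ rest M κ x
  · rw [hW x a hax.2 hax.1]
  · rw [hP a x hax, mul_zero, mul_zero]

theorem hom_elt (h : Contraction D D' A M κ) {P Q S : Matrix J₁ J₁ K} (hm : D'.Mem P Q S) :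
    h.hom hm.elt = (h.emb_mem hm).elt := rfl

theorem hom_mem_nil (h : Contraction D D' A M κ) (y : D'.alg K) (hy : h.hom y ∈ h.nil K) :
    y = 0 := by
  classical
  obtain ⟨P, Q, S, hm, rfl⟩ := exists_elt y
  rw [hom_elt, elt_mem_nil] at hy
  obtain ⟨hP, hQ, hS⟩ := hy
  rw [extendZero, ← Matrix.fromBlocks_zero, Matrix.fromBlocks_inj] at hQ hS
  obtain ⟨-, -, -, rfl⟩ := hQ
  obtain ⟨-, -, -, rfl⟩ := hS
  have hP0 : P = 0 := by
    ext j j'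
    by_cases hj : A j
    · by_cases hj' : j' ∈ Set.range κ
      · obtain ⟨i, rfl⟩ := hj'
        have := hP (.inr j) (.inl i) (fun hn => hn.2)
        simpa [emb, hj] using this
      · by_cases hMj : M j'
        · exact (h.empty hj hMj).elim
        · have := hP (.inr j) (.inr j') (fun hn => hn.2.elim hMj hj')
          simpa [emb, hj', -Set.mem_range] using this
    · have := hP (.inr j) (.inr j') (fun hn => hj hn.1)
      simpa [emb, hj] using this
  subst hP0
  exact Subtype.ext blk_zero

/-- `link` intertwines the two copies made by `emb`. Hence the embedded algebra is orthogonal to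
`nil`. -/
theorem link_commutator_emb (h : Contraction D D' A M κ) {P Q S : Matrix J₁ J₁ K}
    (hm : D'.Mem P Q S) {x a : J₀ ⊕ J₁} (hx : rest M κ x) (ha : small A a) :
    (link K κ * emb A κ P - emb A κ P * link K κ) x a = 0 := by
  classical
  rw [Matrix.sub_apply]
  rcases x with i | x
  · exact hx.elim
  have hxA : ¬ A x := h.not_small_of_rest hx
  rcases hx with hx | ⟨i, rfl⟩
  · rw [h.link_mul_M _ hx]
    rcases a with i' | a
    · rw [mul_link_inl]
      simp [emb, hxA, hm.supp x _ (h.not_rel_M i' hx)]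
    · rw [mul_link_inr, sub_zero]
  · rw [h.link_mul_range]
    rcases a with i' | a
    · rw [mul_link_inl]
      simp [emb, hxA]
    · rw [mul_link_inr]
      simp [emb]

/-- Reduction by the abelian subalgebra `nil`: its orthogonal is the stabilizer of `link`, which is
the embedded algebra plus `nil`. -/
theorem finrank_ker_eq [CharZero K] (h : Contraction D D' A M κ) (f : Module.Dual K (D.alg K))
    (hf : ∀ v ∈ h.nil K, f v = model κ D K v) :
    Module.finrank K (LinearMap.ker (kirillovForm K (D.alg K) f)) =
      Module.finrank K (LinearMap.ker (kirillovForm K (D'.alg K)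
        (f ∘ₗ (h.hom (K := K) : D'.alg K →ₗ[K] D.alg K)))) := by
  classical
  obtain ⟨PY, QY, SY, hQY, hSY, hfY⟩ := exists_trace f
  have hY : ∀ x a, rest M κ x → small A a → PY x a = link K κ x a := fun x a hx ha => by
    have h1 := hf _ (h.single_mem_nil ha hx)
    rw [hfY, model_elt] at h1
    have h2 := trace_blk_mul_single PY QY SY x a
    rw [show (mem_single (K := K) (h.rel_of_small_rest ha hx)).elt.1 = blk (Matrix.single a x 1) 0 0
      from rfl, h2] at h1
    simpa [Matrix.trace_mul_single] using h1
  refine finrank_ker_eq_of_isotropic f h.hom (h.nil K) ?_ ?_ ?_ (h.hom_mem_nil)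
  · intro v hv hx
    obtain ⟨P, Q, S, hm, rfl⟩ := exists_elt v
    obtain ⟨hP, rfl, rfl⟩ := elt_mem_nil.mp hv
    have key : ∀ p q, D.rel p q → (PY * P - P * PY) q p = 0 := fun p q hpq => by
      have h1 := hx (mem_single hpq).elt
      rw [apply_lie_eq hQY hSY hfY] at h1
      rw [show (mem_single (K := K) hpq).elt.1 = blk (Matrix.single p q 1) 0 0 from rfl,
        trace_blk_mul_single] at h1
      simpa using h1
    -- Testing against the entry `(i, p)` isolates column `i` of `P * link`, which is column `κ i`
    -- of `P`.
    have hrange : ∀ p i, P p (.inr (κ i)) = 0 := fun p i => by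
      by_cases hp : small A p
      · have hr : D.rel (.inl i) p := by
          rcases p with i' | j
          · exact h.rel₀₀ _ _
          · exact (h.rel₀₁ _ _).mpr (Or.inl hp)
        have h1 := key _ _ hr
        have h2 : (PY * P) p (.inl i) = 0 := by
          rw [Matrix.mul_apply]
          exact Finset.sum_eq_zero fun k _ => by rw [hP k (.inl i) fun hn => hn.2, mul_zero]
        rw [Matrix.sub_apply, h2, zero_sub, neg_eq_zero] at h1
        refine (mul_link_inl (κ := κ) P i p).symm.trans (Eq.trans ?_ h1)
        rw [Matrix.mul_apply, Matrix.mul_apply]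
        refine Finset.sum_congr rfl fun k _ => ?_
        by_cases hk : rest M κ k
        · rw [hY k (.inl i) hk trivial]
        · rw [hP p k fun hn => hk hn.2, zero_mul, zero_mul]
      · exact hP _ _ fun hn => hp hn.1
    have hP0 : P = 0 := by
      ext p q
      by_cases hpq : small A p ∧ rest M κ q
      · obtain ⟨hp, hq⟩ := hpq
        rcases q with i' | j
        · exact hq.elim
        rcases hq with hq | ⟨i, rfl⟩
        · rcases p with i | j'
          · have hr : D.rel (.inr j) (.inr (κ i)) := (h.rel₁₁ _ _).mpr (Or.inr ⟨hq, i, rfl⟩)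
            have h1 := key _ _ hr
            have h2 : (P * PY) (.inr (κ i)) (.inr j) = 0 := by
              rw [Matrix.mul_apply]
              exact Finset.sum_eq_zero fun k _ => by
                rw [hP (.inr (κ i)) k fun hn => h.not_A i hn.1, zero_mul]
            rw [Matrix.sub_apply, h2, sub_zero] at h1
            refine (h.link_mul_range P i _).symm.trans (Eq.trans ?_ h1)
            rw [Matrix.mul_apply, Matrix.mul_apply]
            refine Finset.sum_congr rfl fun k _ => ?_
            by_cases hk : small A k
            · rw [hY (.inr (κ i)) k (Or.inr ⟨i, rfl⟩) hk]
            · rw [hP k _ fun hn => hk hn.1, mul_zero, mul_zero]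
          · exact (h.empty hp hq).elim
        · exact hrange _ _
      · exact hP p q hpq
    subst hP0
    exact Subtype.ext blk_zero
  · intro y v hv
    obtain ⟨P, Q, S, hm, rfl⟩ := exists_elt y
    obtain ⟨P', hP', hv'⟩ := hv
    rw [hom_elt, apply_lie_eq hQY hSY hfY, hv', trace_blk_mul_blk,
      trace_mul_eq_of_support (W' := 0) hP' fun x a hx ha => ?_]
    · simp
    · rw [h.commutator_apply (h.emb_mem hm) hY hx ha, h.link_commutator_emb hm hx ha,
        Matrix.zero_apply]
  · intro X hX
    obtain ⟨P, Q, S, hm, rfl⟩ := exists_elt X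
    -- Orthogonality to `nil` says that `P` commutes with `link` on this block; the three relations
    -- below are its entries.
    have key : ∀ x a, rest M κ x → small A a → (link K κ * P - P * link K κ) x a = 0 :=
      fun x a hx ha => by
        have h1 := hX _ (h.single_mem_nil ha hx)
        rw [apply_lie_eq hQY hSY hfY, show (mem_single (K := K) (h.rel_of_small_rest ha hx)).elt.1 =
          blk (Matrix.single a x 1) 0 0 from rfl, trace_blk_mul_single,
          h.commutator_apply hm hY hx ha] at h1
        exact (mul_eq_zero.mp h1).resolve_left two_ne_zero
    have k00 : ∀ i i', P (.inl i) (.inl i') = P (.inr (κ i)) (.inr (κ i')) := fun i i' => by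
      have h1 := key (.inr (κ i)) (.inl i') (Or.inr ⟨i, rfl⟩) trivial
      rwa [Matrix.sub_apply, h.link_mul_range, mul_link_inl, sub_eq_zero] at h1
    have k01 : ∀ i a, A a → P (.inl i) (.inr a) = 0 := fun i a ha => by
      have h1 := key (.inr (κ i)) (.inr a) (Or.inr ⟨i, rfl⟩) ha
      rwa [Matrix.sub_apply, h.link_mul_range, mul_link_inr, sub_zero] at h1
    have kM : ∀ x i, M x → P (.inr x) (.inr (κ i)) = 0 := fun x i hx => by
      have h1 := key (.inr x) (.inl i) (Or.inl hx) trivial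
      rwa [Matrix.sub_apply, h.link_mul_M _ hx, mul_link_inl, zero_sub, neg_eq_zero] at h1
    -- Inverse of `emb`: the entry from `A` to `κ i` is recovered from column `i` of `J₀`; what `P`
    -- itself has in that place belongs to `nil`.
    let P' : Matrix J₁ J₁ K := Matrix.of fun j j' =>
      if hj : A j ∧ j' ∈ Set.range κ then P (.inr j) (.inl hj.2.choose)
      else P (.inr j) (.inr j')
    have hP'κ : ∀ j i, A j → P' j (κ i) = P (.inr j) (.inl i) := fun j i hj => by
      have hj' : A j ∧ κ i ∈ Set.range κ := ⟨hj, i, rfl⟩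
      simp only [P', Matrix.of_apply, dif_pos hj']
      rw [h.inj hj'.2.choose_spec]
    have hP' : ∀ j j', ¬ (A j ∧ j' ∈ Set.range κ) → P' j j' = P (.inr j) (.inr j') :=
      fun j j' hj => by
        simp only [P', Matrix.of_apply, dif_neg hj]
    have hm' : D'.Mem P' Q.toBlocks₂₂ S.toBlocks₂₂ := by
      refine ⟨?_, ?_, ?_, ?_, ?_⟩
      · ext i j; exact hm.symmQ.apply _ _
      · ext i j; exact hm.symmS.apply _ _
      · intro j j' hjj
        by_cases hj : A j ∧ j' ∈ Set.range κ
        · obtain ⟨hj, i, rfl⟩ := hj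
          exact (hjj (h.rel_A i hj)).elim
        · rw [hP' _ _ hj]
          by_cases hM : M j ∧ j' ∈ Set.range κ
          · obtain ⟨hM, i, rfl⟩ := hM
            exact kM j i hM
          · exact hm.supp _ _ (by rw [h.rel₁₁]; exact fun hn => hn.elim hjj hM)
      · intro i j hi; exact hm.suppQ _ _ (by rwa [h.up₁])
      · intro i j hi; exact hm.suppS _ _ (by rwa [h.low₁])
    refine ⟨hm'.elt, ?_⟩
    rw [hom_elt]
    refine mem_nil.mpr ⟨P - emb A κ P', fun p q hpq => ?_, ?_⟩
    · rw [Matrix.sub_apply]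
      rcases p with i | j <;> rcases q with i' | j'
      · rw [k00]
        simp [emb, hP' (κ i) (κ i') fun hn => h.not_A i hn.1]
      · simp only [emb, LinearMap.coe_mk, AddHom.coe_mk, Matrix.fromBlocks_apply₁₂,
          Matrix.zero_apply, sub_zero]
        by_cases hA : A j'
        · exact k01 i j' hA
        · refine hm.supp _ _ fun hr => ?_
          exact hpq ⟨trivial, ((h.rel₀₁ _ _).mp hr).resolve_left hA⟩
      · by_cases hA : A j
        · simp [emb, hA, hP'κ]
        · simp [emb, hA, hm.supp (.inr j) (.inl i') (by rwa [h.rel₁₀])]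
      · by_cases hA : A j ∧ j' ∈ Set.range κ
        · exact (hpq ⟨hA.1, Or.inr hA.2⟩).elim
        · simp only [emb, LinearMap.coe_mk, AddHom.coe_mk, Matrix.fromBlocks_apply₂₂,
            Matrix.of_apply, if_neg hA, hP' _ _ hA, sub_self]
    · refine (blk_sub _ _ _ _ _ _).trans (blk_inj.mpr ⟨rfl, ?_, ?_⟩)
      · rw [sub_eq_zero]
        ext (i | i) (j | j)
        · exact hm.suppQ _ _ (h.up₀ i)
        · exact hm.suppQ _ _ (h.up₀ i)
        · exact hm.suppQ' _ _ (h.up₀ j)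
        · rfl
      · rw [sub_eq_zero]
        ext (i | i) (j | j)
        · exact hm.suppS _ _ (h.low₀ i)
        · exact hm.suppS _ _ (h.low₀ i)
        · exact hm.suppS' _ _ (h.low₀ j)
        · rfl

end Contraction

end Shape

end

/-! ### Normal form of a generic functional for a contraction -/

section

namespace Shape

variable {K : Type*} [Field K] {J₀ J₁ : Type*} [Fintype J₀]
  [DecidableEq J₀] [Fintype J₁] [DecidableEq J₁]

namespace Contraction

variable {D : Shape (J₀ ⊕ J₁)} {D' : Shape J₁} {A M : J₁ → Prop} {κ : J₀ → J₁}

/-- A matrix whose block between `κ` and the removed indices is invertible is conjugate to one in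
normal form. -/
theorem exists_normalizer (h : Contraction D D' A M κ) (Y : Matrix (J₀ ⊕ J₁) (J₀ ⊕ J₁) K)
    (hY : IsUnit (Matrix.of fun i i' => Y (.inr (κ i)) (.inl i'))) :
    ∃ g g' : Matrix (J₀ ⊕ J₁) (J₀ ⊕ J₁) K, g * g' = 1 ∧ (∀ p q, ¬ D.rel p q → g p q = 0) ∧
      (∀ p q, ¬ D.rel p q → g' p q = 0) ∧
      ∀ x a, rest M κ x → small A a → (g' * Y * g) x a = link K κ x a := by
  classical
  obtain ⟨E, hE⟩ := hY
  let G : Matrix J₀ J₀ K := E.inv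
  let F : Matrix J₀ J₀ K := E.val
  have hF : ∀ i i', F i i' = Y (.inr (κ i)) (.inl i') := fun i i' => by
    simp only [F, hE, Matrix.of_apply]
  have hFG : F * G = 1 := E.val_inv
  have hGF : G * F = 1 := E.inv_val
  let T : Matrix J₀ J₁ K := Matrix.of fun i j => if j = κ i then 1 else 0
  let dA : Matrix J₁ J₁ K := Matrix.diagonal fun j => if A j then 1 else 0
  let dM : Matrix J₁ J₁ K := Matrix.diagonal fun j => if M j then 1 else 0
  have hT : ∀ (B : Matrix J₁ J₁ K) i q, (T * B) i q = B (κ i) q := fun B i q => by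
    simp [T, Matrix.mul_apply]
  have hT₀ : ∀ (B : Matrix J₁ J₀ K) i q, (T * B) i q = B (κ i) q := fun B i q => by
    simp [T, Matrix.mul_apply]
  have hdM : ∀ (B : Matrix J₁ J₀ K) j q, M j → (dM * B) j q = B j q :=
    fun B j q hj => by simp [dM, Matrix.diagonal_mul, hj]
  have hdA : ∀ (B : Matrix J₀ J₁ K) p j, A j → (B * dA) p j = B p j :=
    fun B p j hj => by simp [dA, Matrix.mul_diagonal, hj]
  have hTM : T * dM = 0 := by
    ext i j; rw [hT]
    simp [dM, Matrix.diagonal_apply, h.not_M]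
  have hTA : T * dA = 0 := by
    ext i j; rw [hT]
    simp [dA, Matrix.diagonal_apply, h.not_A]
  have hAM : dA * dM = 0 := by
    rw [Matrix.diagonal_mul_diagonal, ← Matrix.diagonal_zero]
    congr 1; funext j
    by_cases hj : A j
    · simp [h.empty hj]
    · simp [hj]
  have hAA : dA * dA = dA := by
    rw [Matrix.diagonal_mul_diagonal]; congr 1; funext j; simp
  let y10 : Matrix J₁ J₀ K := Y.toBlocks₂₁
  let y11 : Matrix J₁ J₁ K := Y.toBlocks₂₂
  have hTy : T * y10 = F := by
    ext i i'; rw [hF]; exact hT₀ _ _ _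
  -- Elimination: `G = F⁻¹` makes the `κ` × `J₀` block the identity, `1 - z` clears the rows in `M`
  -- by those in `κ(J₀)`, and `w` clears the columns in `A` by those in `J₀`.
  let z : Matrix J₁ J₁ K := dM * (y10 * (G * T))
  let w : Matrix J₀ J₁ K := -(G * (T * (y11 * dA)))
  have hzz : z * z = 0 := by
    simp only [z, Matrix.mul_assoc]
    rw [← Matrix.mul_assoc T dM, hTM]; simp
  have hwz : w * z = 0 := by
    simp only [z, w, Matrix.neg_mul, Matrix.mul_assoc]
    rw [← Matrix.mul_assoc dA dM, hAM]; simp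
  have hTz : T * z = 0 := by
    simp only [z]; rw [← Matrix.mul_assoc, hTM, Matrix.zero_mul]
  have hzA : z * dA = 0 := by
    simp only [z, Matrix.mul_assoc]; rw [hTA]; simp
  have hwA : w * dA = w := by
    simp only [w, Matrix.neg_mul, Matrix.mul_assoc]; rw [hAA]
  have hws : ∀ i j, ¬ A j → w i j = 0 := fun i j hj => by
    rw [← hwA]; simp [dA, Matrix.mul_diagonal, hj]
  have hzs : ∀ j j', ¬ (M j ∧ j' ∈ Set.range κ) → z j j' = 0 := fun j j' hj => by
    by_cases hM : M j
    · have hj' : ∀ i, j' ≠ κ i := fun i hi => hj ⟨hM, i, hi.symm⟩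
      simp only [z, ← Matrix.mul_assoc]
      rw [Matrix.mul_apply]
      exact Finset.sum_eq_zero fun i _ => by simp [T, hj' i]
    · simp only [z]
      rw [Matrix.diagonal_mul, if_neg hM, zero_mul]
  have hs : ∀ (X : Matrix J₀ J₀ K) (w : Matrix J₀ J₁ K) (z : Matrix J₁ J₁ K),
      (∀ i j, ¬ A j → w i j = 0) → (∀ j j', ¬ (M j ∧ j' ∈ Set.range κ) → z j j' = 0) →
      ∀ p q, ¬ D.rel p q → Matrix.fromBlocks X w 0 (1 + z) p q = 0 := by
    rintro X w z hw hz (i | j) (i' | j') hpq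
    · exact (hpq (h.rel₀₀ _ _)).elim
    · exact hw _ _ fun hA => hpq ((h.rel₀₁ _ _).mpr (Or.inl hA))
    · rfl
    · have h1 : ¬ (M j ∧ j' ∈ Set.range κ) := fun hn => hpq ((h.rel₁₁ _ _).mpr (Or.inr hn))
      have h2 : j ≠ j' := fun hn => hpq (hn ▸ D.refl _)
      simp [hz _ _ h1, Matrix.one_apply_ne h2]
  let g : Matrix (J₀ ⊕ J₁) (J₀ ⊕ J₁) K := Matrix.fromBlocks G w 0 (1 + z)
  let g' : Matrix (J₀ ⊕ J₁) (J₀ ⊕ J₁) K := Matrix.fromBlocks F (-(F * w)) 0 (1 + -z)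
  let B₀ : Matrix J₁ J₀ K := (1 + -z) * y10 * G
  let B₁ : Matrix J₁ J₁ K := (1 + -z) * y10 * w + (1 + -z) * y11 * (1 + z)
  have hg : g' * Y * g = Matrix.fromBlocks (g' * Y * g).toBlocks₁₁ (g' * Y * g).toBlocks₁₂
      B₀ B₁ := by
    rw [← Matrix.fromBlocks_toBlocks (g' * Y * g)]
    simp only [Matrix.toBlocks_fromBlocks₁₁, Matrix.toBlocks_fromBlocks₁₂]
    congr 1
    · conv_lhs => rw [← Matrix.fromBlocks_toBlocks Y]
      simp only [g, g', B₀, y10, Matrix.fromBlocks_multiply, Matrix.toBlocks_fromBlocks₂₁]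
      simp
    · conv_lhs => rw [← Matrix.fromBlocks_toBlocks Y]
      simp only [g, g', B₁, y10, y11, Matrix.fromBlocks_multiply, Matrix.toBlocks_fromBlocks₂₂]
      simp
  refine ⟨g, g', ?_,
    hs _ _ _ hws hzs, hs _ _ _ (fun i j hj => ?_) (fun j j' hj => ?_), ?_⟩
  · simp only [g, g']
    rw [Matrix.fromBlocks_multiply, ← Matrix.fromBlocks_one]
    congr 1
    · rw [Matrix.mul_zero, add_zero, hGF]
    · rw [Matrix.mul_neg, ← Matrix.mul_assoc, hGF, Matrix.one_mul, Matrix.mul_add, Matrix.mul_one,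
        Matrix.mul_neg, hwz]
      simp
    · simp
    · rw [Matrix.zero_mul, zero_add, add_mul, mul_add, mul_add, mul_neg, mul_neg, hzz]
      simp
  · rw [Matrix.neg_apply, Matrix.mul_apply]
    simp [hws _ _ hj]
  · rw [Matrix.neg_apply, hzs _ _ hj, neg_zero]
  · intro x a hx ha
    rw [hg]
    rcases x with i | x
    · exact hx.elim
    rcases a with i' | a
    · rw [Matrix.fromBlocks_apply₂₁, link, Matrix.fromBlocks_apply₂₁, Matrix.of_apply]
      rcases hx with hx | ⟨i, rfl⟩
      · rw [if_neg (fun he : x = κ i' => h.not_M i' (he ▸ hx))]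
        refine (hdM B₀ x i' hx).symm.trans ?_
        have : dM * B₀ = 0 := by
          have h1 : dM * z = z := by
            simp only [z]
            rw [← Matrix.mul_assoc, Matrix.diagonal_mul_diagonal]
            congr 2; funext j; simp
          have h2 : z * y10 * G = dM * (y10 * G) := by
            simp only [z, Matrix.mul_assoc]
            rw [← Matrix.mul_assoc T, hTy, hFG, Matrix.mul_one]
          simp only [B₀]
          rw [Matrix.mul_assoc, Matrix.add_mul, Matrix.mul_add, Matrix.one_mul, Matrix.neg_mul,
            Matrix.mul_neg, ← Matrix.mul_assoc z, h2, ← Matrix.mul_assoc dM dM,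
            Matrix.diagonal_mul_diagonal]
          have h3 : (Matrix.diagonal fun j => (if M j then (1 : K) else 0) * if M j then 1 else 0) =
              dM := by congr 1; funext j; simp
          rw [h3, add_neg_cancel]
        rw [this]; rfl
      · refine (hT₀ B₀ i i').symm.trans ?_
        have : T * B₀ = 1 := by
          simp only [B₀]
          rw [← Matrix.mul_assoc, ← Matrix.mul_assoc, Matrix.mul_add, Matrix.mul_neg, hTz,
            Matrix.mul_one, neg_zero, add_zero, hTy, hFG]
        rw [this, Matrix.one_apply]
        simp [h.inj.eq_iff]
    · have ha' : A a := ha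
      rw [Matrix.fromBlocks_apply₂₂, link, Matrix.fromBlocks_apply₂₂, Matrix.zero_apply]
      rcases hx with hx | ⟨i, rfl⟩
      · exact (h.empty ha' hx).elim
      · refine (hT B₁ i a).symm.trans ((hdA _ _ _ ha').symm.trans ?_)
        have : T * B₁ * dA = 0 := by
          simp only [B₁]
          have h1 : T * (1 + -z) = T := by
            rw [Matrix.mul_add, Matrix.mul_neg, hTz, Matrix.mul_one, neg_zero, add_zero]
          have h2 : (1 + z) * dA = dA := by
            rw [Matrix.add_mul, Matrix.one_mul, hzA, add_zero]
          rw [Matrix.mul_add, ← Matrix.mul_assoc, ← Matrix.mul_assoc, ← Matrix.mul_assoc,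
            ← Matrix.mul_assoc, h1, hTy, Matrix.add_mul, Matrix.mul_assoc _ w, hwA,
            Matrix.mul_assoc _ (1 + z), h2]
          simp only [w]
          rw [Matrix.mul_neg, ← Matrix.mul_assoc F, hFG, Matrix.one_mul, Matrix.mul_assoc T,
            neg_add_cancel]
        rw [this]; rfl

/-- Generic means that the block of the functional between `κ(J₀)` and `J₀` is invertible; such
functionals are conjugate to ones in normal form, where the reduction applies. -/
theorem index_eq [CharZero K] (h : Contraction D D' A M κ) :
    index K (D.alg K) = index K (D'.alg K) := by
  have hs : ∀ i i', rest M κ (.inr (κ i)) ∧ small A (.inl i' : J₀ ⊕ J₁) :=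
    fun i i' => ⟨Or.inr ⟨i, rfl⟩, trivial⟩
  refine index_eq_of_reduction h.hom (h.nil K) (model κ D K) h.hom_mem_nil h.finrank_ker_eq
    (ι := J₀) (fun i i' => (mem_single (h.rel_of_small_rest (hs i i').2 (hs i i').1)).elt)
    (model κ D K) ?_ ?_
  · have : (Matrix.of fun i i' => model κ D K
        (mem_single (h.rel_of_small_rest (hs i i').2 (hs i i').1)).elt) =
        (2 : K) • (1 : Matrix J₀ J₀ K) := by
      ext i i'
      rw [Matrix.of_apply, model_elt]
      simp [Matrix.trace_mul_single, link, Matrix.one_apply, h.inj.eq_iff]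
    rw [this, Matrix.det_smul, Matrix.det_one, mul_one]
    exact pow_ne_zero _ two_ne_zero
  · intro f hdet
    obtain ⟨PY, QY, SY, hQY, hSY, hfY⟩ := exists_trace f
    have hE : (Matrix.of fun i i' => f
        (mem_single (h.rel_of_small_rest (hs i i').2 (hs i i').1)).elt) =
        (2 : K) • (Matrix.of fun i i' => PY (.inr (κ i)) (.inl i')) := by
      ext i i'
      rw [Matrix.of_apply, hfY]
      exact trace_blk_mul_single PY QY SY _ _
    rw [hE, Matrix.det_smul] at hdet
    obtain ⟨g, g', hgg, hsg, hsg', hnf⟩ := h.exists_normalizer PY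
      ((Matrix.isUnit_iff_isUnit_det _).mpr (right_ne_zero_of_mul hdet).isUnit)
    obtain ⟨φ, hφ⟩ := exists_conj hgg hsg hsg'
    refine ⟨φ, fun v hv => ?_⟩
    obtain ⟨P, Q, S, hm, rfl⟩ := exists_elt v
    obtain ⟨hP, rfl, rfl⟩ := elt_mem_nil.mp hv
    rw [hfY, hφ, model_elt]
    refine (trace_blk_mul_blk _ _ _ _ _ _).trans ?_
    rw [trace_mul_eq_of_support hP hnf]
    simp

end Contraction

end Shape

end

section

/-! ### Congruence of symmetric matrices -/

theorem associated_toBilin' {K : Type*} [Field K] [Invertible (2 : K)] {d : ℕ}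
    {A : Matrix (Fin d) (Fin d) K} (hA : A.IsSymm) :
    QuadraticMap.associated (LinearMap.BilinMap.toQuadraticMap (Matrix.toBilin' A)) =
      Matrix.toBilin' A := by
  refine QuadraticMap.associated_left_inverse _ fun x y => ?_
  simp only [Matrix.toBilin'_apply']
  rw [Matrix.dotProduct_mulVec, ← Matrix.mulVec_transpose, hA.eq, dotProduct_comm]

/-- Nondegenerate quadratic forms in the same number of variables over an algebraically closed field
are equivalent; as 2 is invertible, this is a congruence of Gram matrices. -/
theorem exists_congruence {K : Type*} [Field K] [IsAlgClosed K] [CharZero K] {d : ℕ}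
    {A B : Matrix (Fin d) (Fin d) K} (hA : A.IsSymm) (hB : B.IsSymm) (hA' : A.det ≠ 0)
    (hB' : B.det ≠ 0) :
    ∃ g g' : Matrix (Fin d) (Fin d) K, g * g' = 1 ∧ g * A * g.transpose = B := by
  have : Invertible (2 : K) := invertibleOfNonzero two_ne_zero
  have hsep : ∀ {A : Matrix (Fin d) (Fin d) K}, A.IsSymm → A.det ≠ 0 →
      (QuadraticMap.associated (R := K)
        (LinearMap.BilinMap.toQuadraticMap (Matrix.toBilin' A))).SeparatingLeft := by
    intro A hA hdet
    rw [associated_toBilin' hA]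
    exact (Matrix.nondegenerate_of_det_ne_zero hdet).toBilin'.1
  obtain ⟨ℓ₀⟩ := QuadraticForm.equivalent_of_isAlgClosed _ _ (hsep hB hB') (hsep hA hA')
  obtain ⟨ℓ, hℓ⟩ : ∃ ℓ : (Fin d → K) ≃ₗ[K] Fin d → K, ∀ x,
      LinearMap.BilinMap.toQuadraticMap (Matrix.toBilin' A) (ℓ x) =
      LinearMap.BilinMap.toQuadraticMap (Matrix.toBilin' B) x := ⟨ℓ₀.toLinearEquiv, ℓ₀.map_app⟩
  have h1 : (LinearMap.BilinMap.toQuadraticMap (Matrix.toBilin' A)).comp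
      (ℓ : (Fin d → K) →ₗ[K] Fin d → K) =
      LinearMap.BilinMap.toQuadraticMap (Matrix.toBilin' B) := by
    ext x; exact hℓ x
  have h2 := congrArg (QuadraticMap.associated (R := K)) h1
  rw [QuadraticMap.associated_comp, associated_toBilin' hA, associated_toBilin' hB] at h2
  have h3 := congrArg LinearMap.BilinForm.toMatrix' h2
  rw [LinearMap.BilinForm.toMatrix'_toBilin'] at h3
  refine ⟨(LinearMap.toMatrix' (ℓ : (Fin d → K) →ₗ[K] Fin d → K)).transpose,
    (LinearMap.toMatrix' (ℓ.symm : (Fin d → K) →ₗ[K] Fin d → K)).transpose, ?_, ?_⟩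
  · rw [← Matrix.transpose_mul, ← LinearMap.toMatrix'_comp]
    simp
  · rw [Matrix.transpose_transpose, ← h3]
    exact ((LinearMap.BilinForm.toMatrix'_comp (Matrix.toBilin' A) _ _).trans (by
      rw [LinearMap.BilinForm.toMatrix'_toBilin'])).symm

/-- The matrix of the reversal. -/
def reversal (K : Type*) [Field K] (d : ℕ) : Matrix (Fin d) (Fin d) K :=
  Matrix.of fun i j => if j = i.rev then 1 else 0

section reversal

variable {K : Type*} [Field K] {d : ℕ}

theorem eq_rev_comm {i j : Fin d} : i = j.rev ↔ j = i.rev := by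
  rw [eq_comm, Fin.rev_eq_iff]

theorem reversal_isSymm : (reversal K d).IsSymm := by
  ext i j
  simp only [reversal, Matrix.transpose_apply, Matrix.of_apply, eq_rev_comm (i := i)]

theorem reversal_mul_reversal : reversal K d * reversal K d = 1 := by
  ext i j
  simp [reversal, Matrix.mul_apply, Matrix.one_apply, eq_rev_comm (i := j), eq_comm (a := i)]

theorem det_reversal_ne_zero : (reversal K d).det ≠ 0 := fun h => by
  have := congrArg Matrix.det (reversal_mul_reversal (K := K) (d := d))
  rw [Matrix.det_mul, h, zero_mul, Matrix.det_one] at this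
  exact zero_ne_one this

/-- The form in which the stabilizer of `reversal` appears when a bracket is taken with a functional
whose `Q`-block is `reversal`. -/
theorem mem_orth_iff {X : Matrix (Fin d) (Fin d) K} :
    X ∈ orth K d ↔ X * reversal K d + (X * reversal K d).transpose = 0 := by
  have h : ∀ i j, (X * reversal K d) i j = X i j.rev := fun i j => by
    simp [reversal, Matrix.mul_apply, eq_rev_comm (i := j)]
  rw [mem_orth]
  constructor
  · intro hX
    ext i j
    have := congrFun (congrFun hX j) i.rev
    simp only [antiTranspose, Matrix.of_apply, Fin.rev_rev, Matrix.neg_apply] at this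
    simp only [Matrix.add_apply, Matrix.transpose_apply, h, Matrix.zero_apply, this,
      neg_add_cancel]
  · intro hX
    ext i j
    have := congrFun (congrFun hX i) j.rev
    simp only [Matrix.add_apply, Matrix.transpose_apply, h, Matrix.zero_apply, Fin.rev_rev] at this
    simp only [antiTranspose, Matrix.of_apply, Matrix.neg_apply]
    exact eq_neg_of_add_eq_zero_right this

end reversal

end

section

namespace Shape

variable {K : Type*} [Field K] {J₁ : Type*} [Fintype J₁] [DecidableEq J₁] {d : ℕ}

/-! ### Splitting off an orthogonal Lie algebra -/

/-- The shape `D` is obtained from `D'` by adding a block of size `d` that occurs in one of the two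
parabolic subalgebras only, the other one being the full symplectic algebra. -/
structure OrthExtension (D : Shape (Fin d ⊕ J₁)) (D' : Shape J₁) : Prop where
  rel₀₀ : ∀ i i', D.rel (.inl i) (.inl i')
  rel₀₁ : ∀ i j, ¬ D.rel (.inl i) (.inr j)
  rel₁₀ : ∀ i j, D.rel (.inr j) (.inl i)
  rel₁₁ : ∀ j j', D.rel (.inr j) (.inr j') ↔ D'.rel j j'
  up₀ : ∀ i, ¬ D.up (.inl i)
  up₁ : ∀ j, D.up (.inr j) ↔ D'.up j
  low : ∀ p, D.low p
  low₁ : ∀ j, D'.low j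

namespace OrthExtension

variable {D : Shape (Fin d ⊕ J₁)} {D' : Shape J₁}

theorem mem (h : OrthExtension D D') {A : Matrix (Fin d) (Fin d) K} {P Q S : Matrix J₁ J₁ K}
    (_ : A ∈ orth K d) (hm : D'.Mem P Q S) :
    D.Mem (Matrix.fromBlocks A 0 0 P) (extendZero (Fin d) Q) (extendZero (Fin d) S) := by
  refine ⟨extendZero_isSymm hm.symmQ, extendZero_isSymm hm.symmS, ?_, ?_, ?_⟩
  · rintro (i | i) (j | j) hij
    · exact (hij (h.rel₀₀ i j)).elim
    · rfl
    · rfl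
    · exact hm.supp i j (by rwa [h.rel₁₁] at hij)
  · rintro (i | i) (j | j) hi
    · rfl
    · rfl
    · rfl
    · exact hm.suppQ i j (by rwa [h.up₁] at hi)
  · intro i j hi
    exact (hi (h.low i)).elim

/-- The elements with upper left block supported in `p`, zero upper right block, and lower left
block zero outside the rows and columns of the added block. -/
def border (p : Fin d ⊕ J₁ → Fin d ⊕ J₁ → Prop) (D : Shape (Fin d ⊕ J₁)) (K : Type*) [Field K] :
    Submodule K (D.alg K) where
  carrier := {X | ∃ P S, (∀ i j, ¬ p i j → P i j = 0) ∧ S.toBlocks₂₂ = 0 ∧ X.1 = blk P 0 S}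
  add_mem' := by
    rintro X Y ⟨P, S, hP, hS, hX⟩ ⟨P', S', hP', hS', hY⟩
    refine ⟨P + P', S + S', fun p q hpq => ?_, ?_, ?_⟩
    · rw [Matrix.add_apply, hP p q hpq, hP' p q hpq, add_zero]
    · change S.toBlocks₂₂ + S'.toBlocks₂₂ = 0
      rw [hS, hS', add_zero]
    · change X.1 + Y.1 = _
      rw [hX, hY, blk_add, add_zero]
  zero_mem' := ⟨0, 0, fun _ _ _ => rfl, rfl, blk_zero.symm⟩
  smul_mem' := by
    rintro c X ⟨P, S, hP, hS, hX⟩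
    refine ⟨c • P, c • S, fun p q hpq => ?_, ?_, ?_⟩
    · rw [Matrix.smul_apply, hP p q hpq, smul_zero]
    · change c • S.toBlocks₂₂ = 0
      rw [hS, smul_zero]
    · change c • X.1 = _
      rw [hX, blk_smul, smul_zero]

theorem mem_border {p : Fin d ⊕ J₁ → Fin d ⊕ J₁ → Prop} {X : D.alg K} :
    X ∈ border p D K ↔
      ∃ P S, (∀ i j, ¬ p i j → P i j = 0) ∧ S.toBlocks₂₂ = 0 ∧ X.1 = blk P 0 S :=
  Iff.rfl

theorem elt_mem_border {p : Fin d ⊕ J₁ → Fin d ⊕ J₁ → Prop}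
    {P Q S : Matrix (Fin d ⊕ J₁) (Fin d ⊕ J₁) K} {hm : D.Mem P Q S} :
    hm.elt ∈ border p D K ↔ (∀ i j, ¬ p i j → P i j = 0) ∧ Q = 0 ∧ S.toBlocks₂₂ = 0 := by
  rw [mem_border]
  constructor
  · rintro ⟨P', S', hP', hS', he⟩
    obtain ⟨rfl, rfl, rfl⟩ := blk_inj.mp he
    exact ⟨hP', rfl, hS'⟩
  · rintro ⟨hP, rfl, hS⟩
    exact ⟨P, S, hP, hS, rfl⟩

/-- The position lies in the lower left block. -/
def IsLeft : Fin d ⊕ J₁ → Fin d ⊕ J₁ → Prop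
  | .inr _, .inl _ => True
  | _, _ => False

/-- The normal form of a functional. -/
def orthModel (D : Shape (Fin d ⊕ J₁)) (K : Type*) [Field K] : Module.Dual K (D.alg K) where
  toFun X := (reversal K d * X.1.toBlocks₂₁.toBlocks₁₁).trace
  map_add' X Y := by
    have : (X + Y).1.toBlocks₂₁.toBlocks₁₁ =
      X.1.toBlocks₂₁.toBlocks₁₁ + Y.1.toBlocks₂₁.toBlocks₁₁ := rfl
    rw [this, mul_add, Matrix.trace_add]
  map_smul' c X := by
    have : (c • X).1.toBlocks₂₁.toBlocks₁₁ = c • X.1.toBlocks₂₁.toBlocks₁₁ := rfl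
    rw [this, mul_smul_comm, Matrix.trace_smul, RingHom.id_apply]

theorem orthModel_elt {P Q S : Matrix (Fin d ⊕ J₁) (Fin d ⊕ J₁) K} (hm : D.Mem P Q S) :
    orthModel D K hm.elt = (reversal K d * S.toBlocks₁₁).trace := rfl

theorem low_mem_border (h : OrthExtension D D') (p : Fin d ⊕ J₁ → Fin d ⊕ J₁ → Prop) (i : Fin d)
    (q : Fin d ⊕ J₁) :
    (mem_low (K := K) (h.low (.inl i)) (h.low q)).elt ∈ border p D K := by
  rw [elt_mem_border]
  refine ⟨fun _ _ _ => rfl, rfl, ?_⟩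
  ext j j'
  simp [Matrix.toBlocks₂₂]

theorem single_mem_border (h : OrthExtension D D') (i : Fin d) (j : J₁) :
    (mem_single (K := K) (h.rel₁₀ i j)).elt ∈ border IsLeft D K := by
  rw [elt_mem_border]
  refine ⟨fun p q hpq => ?_, rfl, rfl⟩
  rw [Matrix.single_apply_of_ne]
  rintro ⟨rfl, rfl⟩
  exact hpq trivial

/-- A functional in normal form is represented by block triangular matrices. -/
theorem exists_trace_of_normal [CharZero K] (h : OrthExtension D D') {f : Module.Dual K (D.alg K)}
    (hf : ∀ v ∈ border IsLeft D K, f v = orthModel D K v) :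
    ∃ (A : Matrix (Fin d) (Fin d) K) (C : Matrix J₁ (Fin d) K) (E F : Matrix J₁ J₁ K)
      (S : Matrix (Fin d ⊕ J₁) (Fin d ⊕ J₁) K), F.IsSymm ∧ S.IsSymm ∧
      ∀ X : D.alg K, f X = (blk (Matrix.fromBlocks A 0 C E)
        (Matrix.fromBlocks (reversal K d) 0 0 F) S * X.1).trace := by
  obtain ⟨P, Q, S, hQ, hS, hfY⟩ := exists_trace f
  have hP : ∀ i j, P (.inl i) (.inr j) = 0 := fun i j => by
    have h1 := hf _ (h.single_mem_border i j)
    rw [hfY, orthModel_elt, show (mem_single (K := K) (h.rel₁₀ i j)).elt.1 =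
      blk (Matrix.single (.inr j) (.inl i) 1) 0 0 from rfl, trace_blk_mul_single,
      show (0 : Matrix (Fin d ⊕ J₁) (Fin d ⊕ J₁) K).toBlocks₁₁ = 0 from rfl] at h1
    simpa using h1
  have hQ0 : ∀ i q, 2 * Q (.inl i) q = (reversal K d *
      (Matrix.single (Sum.inl i) q (1 : K) + Matrix.single q (Sum.inl i) 1 :
        Matrix (Fin d ⊕ J₁) (Fin d ⊕ J₁) K).toBlocks₁₁).trace := fun i q => by
    have h1 := hf _ (h.low_mem_border IsLeft i q)
    rw [hfY, orthModel_elt, show (mem_low (K := K) (h.low (.inl i)) (h.low q)).elt.1 =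
      blk 0 0 (Matrix.single (.inl i) q (1 : K) + Matrix.single q (.inl i) 1) from rfl,
      trace_blk_mul_low _ _ _ hQ] at h1
    exact h1
  have hQ00 : ∀ i i', Q (.inl i) (.inl i') = reversal K d i i' := fun i i' => by
    have h1 := hQ0 i (.inl i')
    have h2 : (Matrix.single (Sum.inl i) (Sum.inl i') (1 : K) +
        Matrix.single (Sum.inl i') (Sum.inl i) 1 :
          Matrix (Fin d ⊕ J₁) (Fin d ⊕ J₁) K).toBlocks₁₁ =
        Matrix.single i i' 1 + Matrix.single i' i 1 := by
      ext; simp [Matrix.toBlocks₁₁, Matrix.single_apply]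
    rw [h2, Matrix.mul_add, Matrix.trace_add, Matrix.trace_mul_single, Matrix.trace_mul_single,
      reversal_isSymm.apply] at h1
    have h3 : (2 : K) * Q (.inl i) (.inl i') = 2 * reversal K d i i' := by
      rw [h1]; simp; ring
    exact mul_left_cancel₀ two_ne_zero h3
  have hQ01 : ∀ i j, Q (.inl i) (.inr j) = 0 := fun i j => by
    have h1 := hQ0 i (.inr j)
    have h2 : (Matrix.single (Sum.inl i) (Sum.inr j) (1 : K) +
        Matrix.single (Sum.inr j) (Sum.inl i) 1 :
          Matrix (Fin d ⊕ J₁) (Fin d ⊕ J₁) K).toBlocks₁₁ = 0 := by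
      ext; simp [Matrix.toBlocks₁₁]
    rw [h2, mul_zero, Matrix.trace_zero] at h1
    exact (mul_eq_zero.mp h1).resolve_left two_ne_zero
  refine ⟨P.toBlocks₁₁, P.toBlocks₂₁, P.toBlocks₂₂, Q.toBlocks₂₂, S, ?_, hS, fun X => ?_⟩
  · ext i j; exact hQ.apply _ _
  · rw [hfY]
    congr 4
    · ext (i | i) (j | j)
      · rfl
      · exact hP i j
      · rfl
      · rfl
    · ext (i | i) (j | j)
      · exact hQ00 i j
      · exact hQ01 i j
      · rw [← hQ.apply]; exact hQ01 j i
      · rfl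

/-- The embedding of the product with the orthogonal Lie algebra. -/
def orthHom (h : OrthExtension D D') (K : Type*) [Field K] :
    orth K d × D'.alg K →ₗ⁅K⁆ D.alg K :=
  embedProd (D := D) (orth K d) h.mem

theorem orthHom_elt (h : OrthExtension D D') {P Q S : Matrix J₁ J₁ K} (A : orth K d)
    (hm : D'.Mem P Q S) : h.orthHom K (A, hm.elt) = (h.mem A.2 hm).elt := rfl

theorem orthHom_mem_border (h : OrthExtension D D') (y : orth K d × D'.alg K)
    (hy : h.orthHom K y ∈ border IsLeft D K) : y = 0 := by
  obtain ⟨A, X⟩ := y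
  obtain ⟨P, Q, S, hm, rfl⟩ := exists_elt X
  rw [orthHom_elt, elt_mem_border] at hy
  obtain ⟨hP, hQ, hS⟩ := hy
  have hA : A = 0 := Subtype.ext (by ext i j; exact hP (.inl i) (.inl j) id)
  have hP' : P = 0 := by ext i j; exact hP (.inr i) (.inr j) id
  have hS' : S = 0 := hS
  rw [extendZero, ← Matrix.fromBlocks_zero, Matrix.fromBlocks_inj] at hQ
  obtain ⟨-, -, -, rfl⟩ := hQ
  subst hP' hS' hA
  exact Prod.ext rfl (Subtype.ext blk_zero)

theorem border_mono {p p' : Fin d ⊕ J₁ → Fin d ⊕ J₁ → Prop} (h : ∀ i j, p i j → p' i j) :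
    border p D K ≤ border p' D K := by
  rintro X ⟨P, S, hP, hS, hX⟩
  exact ⟨P, S, fun i j hij => hP i j (mt (h i j) hij), hS, hX⟩

theorem exists_fromBlocks (h : OrthExtension D D') {P Q S : Matrix (Fin d ⊕ J₁) (Fin d ⊕ J₁) K}
    (hm : D.Mem P Q S) : ∃ (A : Matrix (Fin d) (Fin d) K) (C : Matrix J₁ (Fin d) K)
      (E F : Matrix J₁ J₁ K), P = Matrix.fromBlocks A 0 C E ∧ Q = Matrix.fromBlocks 0 0 0 F := by
  refine ⟨P.toBlocks₁₁, P.toBlocks₂₁, P.toBlocks₂₂, Q.toBlocks₂₂, ?_, ?_⟩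
  · ext (i | i) (j | j)
    · rfl
    · exact hm.supp _ _ (h.rel₀₁ i j)
    · rfl
    · rfl
  · ext (i | i) (j | j)
    · exact hm.suppQ _ _ (h.up₀ i)
    · exact hm.suppQ _ _ (h.up₀ i)
    · exact hm.suppQ' _ _ (h.up₀ j)
    · rfl

/-- The space to reduce by consists of the entries of `S` in the rows and columns of the added
block. Its orthogonal forces `A' ∈ orth K d` and `C' = 0`, which leaves `orth K d × D'.alg K` plus
the space itself. -/
theorem finrank_ker_eq [CharZero K] (h : OrthExtension D D') (f : Module.Dual K (D.alg K))
    (hf : ∀ v ∈ border IsLeft D K, f v = orthModel D K v) :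
    Module.finrank K (LinearMap.ker (kirillovForm K (D.alg K) f)) =
      Module.finrank K (LinearMap.ker (kirillovForm K (orth K d × D'.alg K)
        (f ∘ₗ (h.orthHom K : orth K d × D'.alg K →ₗ[K] D.alg K)))) := by
  obtain ⟨A, C, E, F, SY, hF, hSY, hfY⟩ := h.exists_trace_of_normal hf
  have hQY : (Matrix.fromBlocks (reversal K d) 0 0 F).IsSymm := by
    rw [Matrix.isSymm_fromBlocks_iff]
    exact ⟨reversal_isSymm, by simp, by simp, hF⟩
  refine finrank_ker_eq_of_isotropic f (h.orthHom K) (border (fun _ _ => False) D K) ?_ ?_ ?_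
    fun y hy => h.orthHom_mem_border y (border_mono (fun _ _ hn => hn.elim) hy)
  · intro v hv hx
    obtain ⟨P, Q, S, hm, rfl⟩ := exists_elt v
    obtain ⟨hP, rfl, hS⟩ := elt_mem_border.mp hv
    obtain rfl : P = 0 := by ext i j; exact hP i j id
    have key : ∀ p q, D.rel p q →
        (Matrix.fromBlocks (reversal K d) 0 0 F * S : Matrix _ _ K) q p = 0 := fun p q hpq => by
      have h1 := hx (mem_single hpq).elt
      rw [apply_lie_eq hQY hSY hfY] at h1
      rw [show (mem_single (K := K) hpq).elt.1 = blk (Matrix.single p q 1) 0 0 from rfl,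
        trace_blk_mul_single] at h1
      simpa using h1
    have hrow : ∀ i q, S (.inl i) q = 0 := fun i q => by
      -- Row `i.rev` of the product with `reversal` is row `i` of `S`.
      have h1 := key q (.inl i.rev) (by
        rcases q with q | q
        · exact h.rel₀₀ _ _
        · exact h.rel₁₀ _ _)
      simpa [Matrix.mul_apply, Fintype.sum_sum_type, reversal] using h1
    obtain rfl : S = 0 := by
      ext (i | i) (j | j)
      · exact hrow _ _
      · exact hrow _ _
      · rw [← hm.symmS.apply]; exact hrow _ _
      · exact congrFun (congrFun hS i) j
    exact Subtype.ext blk_zero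
  · rintro ⟨A', y⟩ v hv
    obtain ⟨P, Q, S, hm, rfl⟩ := exists_elt y
    obtain ⟨P', Q', S', hm', rfl⟩ := exists_elt v
    obtain ⟨hP, rfl, hS⟩ := elt_mem_border.mp hv
    obtain rfl : P' = 0 := by ext i j; exact hP i j id
    rw [orthHom_elt, apply_lie_eq hQY hSY hfY]
    refine (trace_blk_mul_blk _ _ _ _ _ _).trans ?_
    rw [← Matrix.fromBlocks_toBlocks S', hS]
    have hA := mem_orth_iff.mp A'.2
    simp only [extendZero, Matrix.fromBlocks_multiply, Matrix.fromBlocks_transpose,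
      Matrix.fromBlocks_add, sub_eq_add_neg, Matrix.fromBlocks_neg, Matrix.zero_mul,
      Matrix.mul_zero, add_zero, zero_add, Matrix.transpose_zero, neg_zero, hA]
    simp [Matrix.trace, Fintype.sum_sum_type]
  · intro X hX
    obtain ⟨P, Q, S, hm, rfl⟩ := exists_elt X
    obtain ⟨A', C', E', F', rfl, rfl⟩ := h.exists_fromBlocks hm
    -- The upper right block of the bracket, up to sign, in the rows of the added block. The
    -- `P`-block of the functional has a zero upper right corner, so `F'` does not enter.
    have key : ∀ i q, (Matrix.fromBlocks (A' * reversal K d + (A' * reversal K d).transpose)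
        (C' * reversal K d).transpose (C' * reversal K d) 0 :
          Matrix (Fin d ⊕ J₁) (Fin d ⊕ J₁) K) (.inl i) q = 0 := fun i q => by
      have h1 := hX _ (h.low_mem_border (fun _ _ => False) i q)
      rw [apply_lie_eq hQY hSY hfY, show (mem_low (K := K) (h.low (.inl i)) (h.low q)).elt.1 =
        blk 0 0 (Matrix.single (.inl i) q (1 : K) + Matrix.single q (.inl i) 1) from rfl,
        trace_blk_mul_low _ _ _ ?_] at h1
      · have h2 := (mul_eq_zero.mp h1).resolve_left two_ne_zero
        rw [← neg_eq_zero, ← h2]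
        rcases q with q | q <;>
          simp [Matrix.fromBlocks_multiply, Matrix.fromBlocks_transpose, -Matrix.transpose_mul]
      · rw [Matrix.IsSymm]
        simp only [Matrix.transpose_sub, Matrix.transpose_add, Matrix.transpose_transpose]
        rw [add_comm, add_comm (Matrix.transpose _)]
    have hA' : A' ∈ orth K d := mem_orth_iff.mpr (by ext i j; exact key i (.inl j))
    have hC' : C' = 0 := by
      have h1 : C' * reversal K d = 0 := by ext i j; exact key j (.inr i)
      rw [← Matrix.mul_one C', ← reversal_mul_reversal, ← Matrix.mul_assoc, h1, Matrix.zero_mul]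
    subst hC'
    have hm' : D'.Mem E' F' S.toBlocks₂₂ := by
      refine ⟨?_, ?_, ?_, ?_, ?_⟩
      · ext i j; exact hm.symmQ.apply (.inr i) (.inr j)
      · ext i j; exact hm.symmS.apply _ _
      · intro i j hij; exact hm.supp (.inr i) (.inr j) (by rwa [h.rel₁₁])
      · intro i j hi; exact hm.suppQ (.inr i) (.inr j) (by rwa [h.up₁])
      · intro i j hi; exact (hi (h.low₁ i)).elim
    refine ⟨(⟨A', hA'⟩, hm'.elt), ?_⟩
    rw [orthHom_elt]
    refine mem_border.mpr ⟨0, S - extendZero (Fin d) S.toBlocks₂₂, fun _ _ _ => rfl, ?_, ?_⟩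
    · ext i j; simp [extendZero, Matrix.toBlocks₂₂]
    · refine (blk_sub _ _ _ _ _ _).trans (blk_inj.mpr ⟨?_, ?_, rfl⟩)
      · exact sub_self _
      · exact sub_self _

end OrthExtension

end Shape

end

/-! ### Normal form of a generic functional on an added block -/

section

namespace Shape

variable {K : Type*} [Field K] {J₁ : Type*} [Fintype J₁] [DecidableEq J₁] {d : ℕ}

section shear

variable {J : Type*} [Fintype J] [DecidableEq J] {D : Shape J}

theorem shear_blk {σ : Matrix J J K} (hσ : σ.IsSymm) {P Q S : Matrix J J K} (hQ : Q.IsSymm) :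
    Matrix.fromBlocks 1 0 σ 1 * blk P Q S * Matrix.fromBlocks 1 0 (-σ) 1 =
      blk (P - Q * σ) Q (S + (σ * P + (σ * P).transpose - σ * Q * σ)) := by
  simp only [blk, Matrix.fromBlocks_multiply, Matrix.transpose_mul, Matrix.transpose_sub, hσ.eq,
    hQ.eq]
  congr 1 <;> noncomm_ring

theorem Mem.shear (hlow : ∀ i, D.low i) {σ : Matrix J J K} (hσ : σ.IsSymm) {P Q S : Matrix J J K}
    (hm : D.Mem P Q S) :
    D.Mem (P - Q * σ) Q (S + (σ * P + (σ * P).transpose - σ * Q * σ)) where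
  symmQ := hm.symmQ
  symmS := by
    rw [Matrix.IsSymm]
    simp only [Matrix.transpose_add, Matrix.transpose_sub, Matrix.transpose_mul,
      Matrix.transpose_transpose, hσ.eq, hm.symmQ.eq, hm.symmS.eq, mul_assoc]
    rw [add_comm (P.transpose * σ)]
  supp i j hij := by
    rw [Matrix.sub_apply, hm.supp i j hij, Matrix.mul_apply, Finset.sum_eq_zero, sub_zero]
    intro k _
    rw [hm.suppQ i k fun hi => hij (D.rel_of_up_low hi (hlow j)), zero_mul]
  suppQ := hm.suppQ
  suppS i _ hi := (hi (hlow i)).elim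

/-- A symmetric matrix acts on an algebra with full lower left block. -/
theorem exists_shear (hlow : ∀ i, D.low i) {σ : Matrix J J K} (hσ : σ.IsSymm) :
    ∃ φ : D.alg K ≃ₗ⁅K⁆ D.alg K, ∀ (P Q S : Matrix J J K), Q.IsSymm → ∃ S', ∀ X : D.alg K,
      (blk P Q S * (φ X).1).trace = (blk (P + Q * σ) Q S' * X.1).trace := by
  have huv : (Matrix.fromBlocks 1 0 σ 1 : Matrix (J ⊕ J) (J ⊕ J) K) *
      Matrix.fromBlocks 1 0 (-σ) 1 = 1 := by
    simp [Matrix.fromBlocks_multiply]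
  have hneg : ∀ {P Q S : Matrix J J K}, Q.IsSymm →
      Matrix.fromBlocks 1 0 (-σ) 1 * blk P Q S * Matrix.fromBlocks 1 0 σ 1 =
        blk (P - Q * -σ) Q (S + (-σ * P + (-σ * P).transpose - -σ * Q * -σ)) := by
    intro P Q S hQ
    have := shear_blk hσ.neg (P := P) (S := S) hQ
    rwa [neg_neg] at this
  refine ⟨D.conj _ _ huv ?_ ?_, fun P Q S hQ =>
    ⟨S + (-σ * P + (-σ * P).transpose - -σ * Q * -σ), fun X => ?_⟩⟩
  · rintro _ ⟨P, Q, S, hm, rfl⟩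
    rw [shear_blk hσ hm.symmQ]
    exact blk_mem_alg.mpr (hm.shear hlow hσ)
  · rintro _ ⟨P, Q, S, hm, rfl⟩
    rw [hneg hm.symmQ]
    exact blk_mem_alg.mpr (hm.shear hlow hσ.neg)
  · rw [trace_conj, hneg hQ, mul_neg, sub_neg_eq_add]

end shear

namespace OrthExtension

variable {D : Shape (Fin d ⊕ J₁)} {D' : Shape J₁}

theorem exists_normalizer [IsAlgClosed K] [CharZero K] (h : OrthExtension D D')
    {f : Module.Dual K (D.alg K)} {P Q S : Matrix (Fin d ⊕ J₁) (Fin d ⊕ J₁) K}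
    (hQ : Q.IsSymm) (hf : ∀ X : D.alg K, f X = (blk P Q S * X.1).trace)
    (hdet : Q.toBlocks₁₁.det ≠ 0) :
    ∃ φ : D.alg K ≃ₗ⁅K⁆ D.alg K, ∀ v ∈ border IsLeft D K, f (φ v) = orthModel D K v := by
  have hQ00 : Q.toBlocks₁₁.IsSymm := by ext i j; exact hQ.apply _ _
  obtain ⟨g, g', hg, hgQ⟩ := exists_congruence hQ00 (reversal_isSymm (K := K)) hdet
    det_reversal_ne_zero
  have hinv : Q.toBlocks₁₁ * Q.toBlocks₁₁⁻¹ = 1 := Matrix.mul_nonsing_inv _ hdet.isUnit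
  have hinv' : Q.toBlocks₁₁⁻¹ * Q.toBlocks₁₁ = 1 := Matrix.nonsing_inv_mul _ hdet.isUnit
  -- Schur complement: `w` clears the off-diagonal blocks of `Q`, while `g` brings the first
  -- diagonal block to `reversal`.
  let w : Matrix J₁ (Fin d) K := -(Q.toBlocks₂₁ * Q.toBlocks₁₁⁻¹)
  have hw : w * Q.toBlocks₁₁ + Q.toBlocks₂₁ = 0 := by
    simp only [w]
    rw [Matrix.neg_mul, Matrix.mul_assoc, hinv', Matrix.mul_one, neg_add_cancel]
  have hQ12 : Q.toBlocks₁₂ = Q.toBlocks₂₁.transpose := by ext i j; exact (hQ.apply _ _).symm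
  have hw' : Q.toBlocks₁₁ * w.transpose + Q.toBlocks₁₂ = 0 := by
    have := congrArg Matrix.transpose hw
    rwa [Matrix.transpose_add, Matrix.transpose_mul, hQ00.eq, ← hQ12, Matrix.transpose_zero] at this
  have hsupp : ∀ (X : Matrix (Fin d) (Fin d) K) (Z : Matrix J₁ (Fin d) K) (p q : Fin d ⊕ J₁),
      ¬ D.rel p q → Matrix.fromBlocks X 0 Z (1 : Matrix J₁ J₁ K) p q = 0 := by
    rintro X Z (i | i) (j | j) hij
    · exact (hij (h.rel₀₀ i j)).elim
    · rfl
    · exact (hij (h.rel₁₀ j i)).elim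
    · exact Matrix.one_apply_ne fun he => hij (he ▸ D.refl _)
  have hg' : g' * g = 1 := mul_eq_one_comm.mp hg
  have hh : (Matrix.fromBlocks g' 0 (-(w * g')) 1 : Matrix (Fin d ⊕ J₁) (Fin d ⊕ J₁) K) *
      Matrix.fromBlocks g 0 w (1 : Matrix J₁ J₁ K) = 1 := by
    rw [Matrix.fromBlocks_multiply, ← Matrix.fromBlocks_one]
    congr 1
    · simp [hg']
    · simp
    · rw [Matrix.neg_mul, Matrix.mul_assoc, hg']; simp
    · simp
  obtain ⟨φ₁, hφ₁⟩ := exists_conj hh (hsupp _ _) (hsupp _ _)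
  let P₁ : Matrix (Fin d ⊕ J₁) (Fin d ⊕ J₁) K :=
    Matrix.fromBlocks g 0 w 1 * P * Matrix.fromBlocks g' 0 (-(w * g')) 1
  let Q₁ : Matrix (Fin d ⊕ J₁) (Fin d ⊕ J₁) K :=
    Matrix.fromBlocks g 0 w 1 * Q * (Matrix.fromBlocks g 0 w 1).transpose
  have hQ₁ : ∃ F : Matrix J₁ J₁ K, Q₁ = Matrix.fromBlocks (reversal K d) 0 0 F := by
    refine ⟨Q₁.toBlocks₂₂, ?_⟩
    conv_lhs => rw [← Matrix.fromBlocks_toBlocks Q₁]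
    have he : Q₁ = Matrix.fromBlocks g 0 w 1 *
      Matrix.fromBlocks Q.toBlocks₁₁ Q.toBlocks₁₂ Q.toBlocks₂₁ Q.toBlocks₂₂ *
      (Matrix.fromBlocks g 0 w 1).transpose := by rw [Matrix.fromBlocks_toBlocks]
    rw [Matrix.fromBlocks_transpose, Matrix.fromBlocks_multiply, Matrix.fromBlocks_multiply] at he
    congr 1
    · rw [he]; simp [hgQ]
    · rw [he]
      simp only [Matrix.toBlocks_fromBlocks₁₂, Matrix.zero_mul, add_zero, Matrix.transpose_one,
        Matrix.mul_one]
      rw [Matrix.mul_assoc, ← Matrix.mul_add, hw', Matrix.mul_zero]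
    · rw [he]
      simp only [Matrix.toBlocks_fromBlocks₂₁, Matrix.one_mul, Matrix.transpose_zero,
        Matrix.mul_zero, add_zero]
      rw [hw, Matrix.zero_mul]
  obtain ⟨F, hF⟩ := hQ₁
  have hQ₁s : Q₁.IsSymm := by
    rw [Matrix.IsSymm]
    simp only [Q₁]
    rw [Matrix.transpose_mul, Matrix.transpose_mul, Matrix.transpose_transpose, hQ.eq, mul_assoc]
  -- The shear adds `Q₁ * σ` to `P₁`; as `reversal` is its own inverse, this `s` cancels the upper
  -- right corner.
  let s : Matrix (Fin d) J₁ K := -(reversal K d * P₁.toBlocks₁₂)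
  obtain ⟨φ₂, hφ₂⟩ := exists_shear (D := D) h.low
    (σ := Matrix.fromBlocks 0 s s.transpose 0) (by
      rw [Matrix.isSymm_fromBlocks_iff]
      exact ⟨Matrix.isSymm_zero, rfl, by simp, Matrix.isSymm_zero⟩)
  obtain ⟨S₂, hS₂⟩ := hφ₂ P₁ Q₁
    ((Matrix.fromBlocks g' 0 (-(w * g')) 1).transpose * S * Matrix.fromBlocks g' 0 (-(w * g')) 1)
    hQ₁s
  have hP₂ : (P₁ + Q₁ * Matrix.fromBlocks 0 s s.transpose 0).toBlocks₁₂ = 0 := by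
    have h1 : (Q₁ * Matrix.fromBlocks 0 s s.transpose 0).toBlocks₁₂ = -P₁.toBlocks₁₂ := by
      rw [hF, Matrix.fromBlocks_multiply, Matrix.toBlocks_fromBlocks₁₂]
      simp only [s, Matrix.mul_neg, Matrix.mul_zero, add_zero]
      rw [← Matrix.mul_assoc, reversal_mul_reversal, Matrix.one_mul]
    change P₁.toBlocks₁₂ + (Q₁ * Matrix.fromBlocks 0 s s.transpose 0).toBlocks₁₂ = 0
    rw [h1, add_neg_cancel]
  refine ⟨φ₂.trans φ₁, fun v hv => ?_⟩
  obtain ⟨P', Q', S', hm, rfl⟩ := exists_elt v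
  obtain ⟨hP', rfl, hS'⟩ := elt_mem_border.mp hv
  have htr : f ((φ₂.trans φ₁) hm.elt) =
      (blk (P₁ + Q₁ * Matrix.fromBlocks 0 s s.transpose 0) Q₁ S₂ * hm.elt.1).trace := by
    rw [hf, ← hS₂]
    exact hφ₁ P Q S (φ₂ hm.elt)
  rw [htr, orthModel_elt]
  refine (trace_blk_mul_blk _ _ _ _ _ _).trans ?_
  rw [Matrix.mul_zero, Matrix.trace_zero, add_zero]
  have h1 : ((P₁ + Q₁ * Matrix.fromBlocks 0 s s.transpose 0) * P').trace = 0 := by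
    have hP'' : P' = Matrix.fromBlocks 0 0 P'.toBlocks₂₁ 0 := by
      ext (i | i) (j | j)
      · exact hP' _ _ id
      · exact hP' _ _ id
      · rfl
      · exact hP' _ _ id
    rw [hP'', ← Matrix.fromBlocks_toBlocks (P₁ + Q₁ * Matrix.fromBlocks 0 s s.transpose 0), hP₂,
      Matrix.fromBlocks_multiply]
    simp [Matrix.trace, Fintype.sum_sum_type]
  rw [h1, mul_zero, zero_add, hF]
  conv_lhs => rw [← Matrix.fromBlocks_toBlocks S', hS', Matrix.fromBlocks_multiply]
  simp [Matrix.trace, Fintype.sum_sum_type]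

/-- For a generic functional the block of `Q` on the added indices is a nondegenerate symmetric
form; its stabilizer contributes `d / 2` by `index_orth`. -/
theorem index_eq [IsAlgClosed K] [CharZero K] (h : OrthExtension D D') :
    index K (D.alg K) = d / 2 + index K (D'.alg K) := by
  refine Eq.trans ?_ (congrArg (· + index K (D'.alg K)) (index_orth (K := K) d))
  refine Eq.trans ?_ index_prod
  refine index_eq_of_reduction (h.orthHom K) (border IsLeft D K) (orthModel D K)
    h.orthHom_mem_border h.finrank_ker_eq (ι := Fin d)
    (fun i j => (mem_low (h.low (.inl i)) (h.low (.inl j))).elt) (orthModel D K) ?_ ?_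
  · have : (Matrix.of fun i j => orthModel D K (mem_low (h.low (.inl i)) (h.low (.inl j))).elt) =
        (2 : K) • reversal K d := by
      ext i j
      rw [Matrix.of_apply, orthModel_elt]
      have h2 : (Matrix.single (Sum.inl i) (Sum.inl j) (1 : K) +
          Matrix.single (Sum.inl j) (Sum.inl i) 1 :
            Matrix (Fin d ⊕ J₁) (Fin d ⊕ J₁) K).toBlocks₁₁ =
          Matrix.single i j 1 + Matrix.single j i 1 := by
        ext; simp [Matrix.toBlocks₁₁, Matrix.single_apply]
      rw [h2, Matrix.mul_add, Matrix.trace_add, Matrix.trace_mul_single, Matrix.trace_mul_single,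
        reversal_isSymm.apply]
      simp; ring
    rw [this, Matrix.det_smul]
    exact mul_ne_zero (pow_ne_zero _ two_ne_zero) det_reversal_ne_zero
  · intro f hdet
    obtain ⟨P, Q, S, hQ, hS, hf⟩ := exists_trace f
    have hE : (Matrix.of fun i j => f (mem_low (h.low (.inl i)) (h.low (.inl j))).elt) =
        (2 : K) • Q.toBlocks₁₁ := by
      ext i j
      rw [Matrix.of_apply, hf]
      exact trace_blk_mul_low P Q S hQ _ _
    rw [hE, Matrix.det_smul] at hdet
    exact h.exists_normalizer hQ hf (right_ne_zero_of_mul hdet)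

end OrthExtension

end Shape

end

section

/-! ### The shape attached to two strings -/

/-- The block of `a` that contains the position `x`; all positions from `a.sum` on lie in the last
block. -/
def blockOf : List ℕ → ℕ → ℕ
  | [], _ => 0
  | c :: a, x => if x < c then 0 else blockOf a (x - c) + 1

theorem blockOf_mono (a : List ℕ) : Monotone (blockOf a) := by
  induction a with
  | nil => exact fun _ _ _ => le_rfl
  | cons c a ih =>
    intro x y h
    simp only [blockOf]
    split_ifs
    · exact le_rfl
    · exact Nat.zero_le _
    · omega
    · exact Nat.succ_le_succ (ih (by omega))

theorem blockOf_eq_length_iff (a : List ℕ) (x : ℕ) : blockOf a x = a.length ↔ a.sum ≤ x := by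
  induction a generalizing x with
  | nil => simp [blockOf]
  | cons c a ih =>
    have := ih (x - c)
    simp only [blockOf, List.length_cons, List.sum_cons]
    by_cases h : x < c
    · rw [if_pos h]
      exact ⟨fun h' => by omega, fun h' => by omega⟩
    · rw [if_neg h]
      omega

theorem blockOf_eq_of_sum_le {a : List ℕ} {x y : ℕ} (hx : a.sum ≤ x) (hy : a.sum ≤ y) :
    blockOf a x = blockOf a y :=
  ((blockOf_eq_length_iff a x).mpr hx).trans ((blockOf_eq_length_iff a y).mpr hy).symm

theorem sum_le_of_blockOf_eq {a : List ℕ} {x y : ℕ} (h : blockOf a x = blockOf a y)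
    (hx : a.sum ≤ x) : a.sum ≤ y :=
  (blockOf_eq_length_iff a y).mp (h ▸ (blockOf_eq_length_iff a x).mpr hx)

theorem blockOf_eq_of_le {a : List ℕ} {x y z : ℕ} (h : blockOf a x = blockOf a z) (hxy : x ≤ y)
    (hyz : y ≤ z) : blockOf a x = blockOf a y ∧ blockOf a y = blockOf a z := by
  have h1 := blockOf_mono a hxy
  have h2 := blockOf_mono a hyz
  omega

/-- The positions that may be nonzero in the upper left block of a seaweed. -/
def listRel (a b : List ℕ) (x y : ℕ) : Prop :=
  (x ≤ y ∧ blockOf b x = blockOf b y) ∨ (y ≤ x ∧ blockOf a x = blockOf a y)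

/-- The shape of the seaweed attached to two strings. -/
def listShape (n : ℕ) (a b : List ℕ) : Shape (Fin n) where
  rel i j := listRel a b i j
  up i := b.sum ≤ i
  low i := a.sum ≤ i
  refl i := Or.inl ⟨le_rfl, rfl⟩
  trans {i j k} h h' := by
    rcases h with ⟨h1, h2⟩ | ⟨h1, h2⟩ <;> rcases h' with ⟨h3, h4⟩ | ⟨h3, h4⟩
    · exact Or.inl ⟨h1.trans h3, h2.trans h4⟩
    -- Both `i` and `k` are at most `j`. The smaller of them shares a block with `j`, and blocks are
    -- intervals, so it shares that block with the other.
    · rcases le_total (i : ℕ) k with h5 | h5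
      · exact Or.inl ⟨h5, (blockOf_eq_of_le h2 h5 h3).1⟩
      · exact Or.inr ⟨h5, (blockOf_eq_of_le h4.symm h5 h1).1.symm⟩
    · rcases le_total (i : ℕ) k with h5 | h5
      · exact Or.inl ⟨h5, (blockOf_eq_of_le h4 h1 h5).2⟩
      · exact Or.inr ⟨h5, (blockOf_eq_of_le h2.symm h3 h5).2.symm⟩
    · exact Or.inr ⟨h3.trans h1, h2.trans h4⟩
  up_of_rel {i j} h hj := by
    rcases h with ⟨-, h2⟩ | ⟨h1, -⟩
    · exact sum_le_of_blockOf_eq h2.symm hj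
    · exact hj.trans h1
  low_of_rel {i j} h hi := by
    rcases h with ⟨h1, -⟩ | ⟨-, h2⟩
    · exact hi.trans h1
    · exact sum_le_of_blockOf_eq h2 hi
  rel_of_up_low {i j} hi hj := by
    rcases le_total (i : ℕ) j with h | h
    · exact Or.inl ⟨h, blockOf_eq_of_sum_le hi (hi.trans h)⟩
    · exact Or.inr ⟨h, blockOf_eq_of_sum_le (hj.trans h) hj⟩

/-- The index of the algebra attached to two strings. -/
def listIndex (K : Type*) [Field K] (n : ℕ) (a b : List ℕ) : ℕ :=
  index K ((listShape n a b).alg K)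

variable {K : Type*} [Field K]

theorem listShape_op (n : ℕ) (a b : List ℕ) : (listShape n a b).op = listShape n b a := by
  have h : (fun i j : Fin n => listRel b a i j) = fun i j : Fin n => listRel a b j i := by
    funext i j
    simp only [listRel, eq_comm (a := blockOf a i), eq_comm (a := blockOf b i), or_comm]
  simp only [listShape, Shape.op, h]

theorem listIndex_swap (n : ℕ) (a b : List ℕ) : listIndex K n a b = listIndex K n b a := by
  rw [listIndex, listIndex, ← listShape_op n a b, Shape.index_op]

/-- Parts equal to 0 have to be handled because a contraction with `d = 2 * c` creates one. -/
theorem listIndex_zero_cons (n : ℕ) (a b : List ℕ) :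
    listIndex K n (0 :: a) b = listIndex K n a b := by
  have : listShape n (0 :: a) b = listShape n a b := by
    simp [listShape, listRel, blockOf]
  rw [listIndex, listIndex, this]

theorem listIndex_nil [CharZero K] (n : ℕ) : listIndex K n [] [] = n := by
  have : listShape n [] [] = Shape.full (Fin n) := by
    simp [listShape, listRel, blockOf, Shape.full, le_total]
  rw [listIndex, this, Shape.index_full]

theorem listIndex_add (c m : ℕ) (a b : List ℕ) : listIndex K (c + m) a b =
    index K (((listShape (c + m) a b).comap finSumFinEquiv).alg K) :=
  (Shape.index_comap _).symm

theorem blockOf_cons_of_lt {c x : ℕ} (a : List ℕ) (h : x < c) : blockOf (c :: a) x = 0 :=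
  if_pos h

theorem blockOf_cons_add (c x : ℕ) (a : List ℕ) :
    blockOf (c :: a) (c + x) = blockOf a x + 1 := by
  simp [blockOf]

theorem listIndex_cons_cons [CharZero K] (c m : ℕ) (a b : List ℕ) :
    listIndex K (c + m) (c :: a) (c :: b) = c + listIndex K m a b := by
  rw [listIndex_add]
  refine Shape.index_alg_of_split ?_ ?_ ?_ ?_ ?_ ?_ ?_ ?_
  all_goals
    simp only [Shape.comap, listShape, listRel, finSumFinEquiv_apply_left,
      finSumFinEquiv_apply_right, Fin.val_castAdd, Fin.val_natAdd, blockOf_cons_add,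
      blockOf_cons_of_lt, Fin.is_lt, List.sum_cons, and_true, le_total, implies_true]
  all_goals
    intros
    omega

/-- With an empty first string `low` holds everywhere, while `up` fails on the first block: the
situation of `OrthExtension`. -/
theorem listIndex_nil_cons [IsAlgClosed K] [CharZero K] (d m : ℕ) (b : List ℕ) :
    listIndex K (d + m) [] (d :: b) = d / 2 + listIndex K m [] b := by
  rw [listIndex_add]
  refine Shape.OrthExtension.index_eq ⟨?_, ?_, ?_, ?_, ?_, ?_, ?_, ?_⟩
  all_goals
    simp only [Shape.comap, listShape, listRel, finSumFinEquiv_apply_left,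
      finSumFinEquiv_apply_right, Fin.val_castAdd, Fin.val_natAdd, blockOf_cons_add,
      blockOf_cons_of_lt, Fin.is_lt, List.sum_cons, List.sum_nil, Nat.zero_le, implies_true]
  all_goals
    try simp only [blockOf, and_true, le_total, implies_true]
  all_goals
    intros
    omega

theorem mem_range_shift {k m s : ℕ} (f : Fin k → Fin m) (hf : ∀ i, (f i : ℕ) = i + s) (j : Fin m) :
    j ∈ Set.range f ↔ s ≤ j ∧ (j : ℕ) < s + k := by
  constructor
  · rintro ⟨i, rfl⟩
    rw [hf]; omega
  · rintro ⟨h1, h2⟩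
    exact ⟨⟨j - s, by omega⟩, Fin.ext (by rw [hf]; simp only; omega)⟩

/-- `J₀` is the whole block of length `c`, `κ` shifts it to the end of the block of length `d`, and
`M` is the gap of length `d - 2 * c` between the two. -/
theorem listIndex_contract_large [CharZero K] {c d m : ℕ} (a b : List ℕ) (h : 2 * c ≤ d)
    (hd : d ≤ c + m) :
    listIndex K (c + m) (c :: a) (d :: b) = listIndex K m a ((d - 2 * c) :: c :: b) := by
  rw [listIndex_add]
  have hκ := mem_range_shift (s := d - 2 * c) (fun i : Fin c => (⟨i + (d - 2 * c), by omega⟩ : Fin m))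
    fun _ => rfl
  refine Shape.Contraction.index_eq (A := fun _ => False) (M := fun j => (j : ℕ) < d - 2 * c)
    (κ := fun i : Fin c => (⟨i + (d - 2 * c), by omega⟩ : Fin m))
    ⟨?_, ?_, ?_, ?_, ?_, ?_, ?_, ?_, ?_, ?_, ?_, ?_, ?_, ?_, ?_, ?_, ?_, ?_⟩
  · intro i j hij
    simp only [Fin.mk.injEq] at hij
    exact Fin.ext (by omega)
  all_goals
    try simp only [Shape.comap, listShape, listRel, finSumFinEquiv_apply_left,
      finSumFinEquiv_apply_right, Fin.val_castAdd, Fin.val_natAdd, blockOf_cons_add,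
      blockOf_cons_of_lt, Fin.is_lt, List.sum_cons, hκ]
    try simp only [blockOf]
    try grind
  intro j j'
  -- Past the larger block the old and the new string compute the same offset by different natural
  -- subtractions.
  have e : ∀ j, j - (d - 2 * c) - c = c + j - d := fun j => by omega
  simp only [e]
  split_ifs <;> (try simp only [and_true, and_false, false_or]) <;> omega

/-- `J₀` is the first `d - c` positions, `A` the other `2 * c - d` positions of the smaller block,
and `κ(J₀)` the last `d - c` positions of the larger one. -/
theorem listIndex_contract_small [CharZero K] {c d m : ℕ} (a b : List ℕ) (h : d < 2 * c)
    (hc : c < d) (hd : c ≤ m) :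
    listIndex K (d - c + m) (c :: a) (d :: b) = listIndex K m ((2 * c - d) :: a) (c :: b) := by
  rw [listIndex_add]
  have hκ := mem_range_shift (s := 2 * c - d)
    (fun i : Fin (d - c) => (⟨i + (2 * c - d), by omega⟩ : Fin m)) fun _ => rfl
  refine Shape.Contraction.index_eq (A := fun j => (j : ℕ) < 2 * c - d) (M := fun _ => False)
    (κ := fun i : Fin (d - c) => (⟨i + (2 * c - d), by omega⟩ : Fin m))
    ⟨?_, ?_, ?_, ?_, ?_, ?_, ?_, ?_, ?_, ?_, ?_, ?_, ?_, ?_, ?_, ?_, ?_, ?_⟩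
  · intro i j hij
    simp only [Fin.mk.injEq] at hij
    exact Fin.ext (by omega)
  all_goals
    try simp only [Shape.comap, listShape, listRel, finSumFinEquiv_apply_left,
      finSumFinEquiv_apply_right, Fin.val_castAdd, Fin.val_natAdd, List.sum_cons, hκ]
    try simp only [blockOf]
    try grind
  intro j j'
  have e : ∀ j, j - (2 * c - d) = d - c + j - c := fun j => by omega
  have e' : ∀ j, j - c = d - c + j - d := fun j => by omega
  rw [e, e, e' j, e' j']
  split_ifs <;> (try simp only [and_true, false_and, and_false, or_false, false_or]) <;> omega

end

section

/-! ### Counting cycles of permutations -/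

/-- The number of cycles of `σ` that contain exactly `0` or exactly `2` elements of `T`. -/
def cycleCount {α : Type*} (σ : Equiv.Perm α) (T : Set α) : ℕ :=
  {S ∈ permCycles σ | (S ∩ T).ncard = 0 ∨ (S ∩ T).ncard = 2}.ncard

section cycleCount

variable {α β γ : Type*}

theorem permCycles_inv (σ : Equiv.Perm α) : permCycles σ⁻¹ = permCycles σ := by
  simp only [permCycles, Equiv.Perm.sameCycle_inv]

theorem cycleCount_inv (σ : Equiv.Perm α) (T : Set α) : cycleCount σ⁻¹ T = cycleCount σ T := by
  rw [cycleCount, cycleCount, permCycles_inv]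

theorem setOf_sameCycle_eq {σ : Equiv.Perm α} {x y : α} (h : σ.SameCycle x y) :
    {z | σ.SameCycle x z} = {z | σ.SameCycle y z} := by
  ext z
  exact ⟨fun hz => h.symm.trans hz, fun hz => h.trans hz⟩

theorem setOf_sameCycle_eq_iff {σ : Equiv.Perm α} {x y : α} :
    {z | σ.SameCycle x z} = {z | σ.SameCycle y z} ↔ σ.SameCycle x y := by
  refine ⟨fun h => ?_, setOf_sameCycle_eq⟩
  have : y ∈ {z | σ.SameCycle x z} := by
    rw [h]; exact Equiv.Perm.SameCycle.refl _ _
  exact this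

theorem sameCycle_image_iff [Finite α] {σ : Equiv.Perm α} {τ : Equiv.Perm β} {ι : β → α}
    (hι : Function.Injective ι) (h : ∀ y, σ (ι y) = ι (τ y)) {y y' : β} :
    σ.SameCycle (ι y) (ι y') ↔ τ.SameCycle y y' := by
  have hpow : ∀ (n : ℕ) y, (σ ^ n) (ι y) = ι ((τ ^ n) y) := by
    intro n
    induction n with
    | zero => intro y; rfl
    | succ n ih => intro y; rw [pow_succ, pow_succ, Equiv.Perm.mul_apply, h, ih]; rfl
  have : Finite β := Finite.of_injective ι hι
  constructor
  · intro hs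
    obtain ⟨n, hn⟩ := hs.exists_nat_pow_eq
    exact ⟨n, hι (by rw [← hn, hpow]; rfl)⟩
  · intro hs
    obtain ⟨n, hn⟩ := hs.exists_nat_pow_eq
    exact ⟨n, by rw [← hn]; exact hpow n y⟩

theorem cycleCount_one [Finite α] : cycleCount (1 : Equiv.Perm α) ∅ = Nat.card α := by
  have : {S ∈ permCycles (1 : Equiv.Perm α) | (S ∩ ∅).ncard = 0 ∨ (S ∩ ∅).ncard = 2} =
      Set.range fun x : α => ({x} : Set α) := by
    ext S
    simp only [permCycles, Equiv.Perm.sameCycle_one, Set.inter_empty, Set.ncard_empty,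
      true_or, and_true, Set.mem_ofPred_eq, Set.mem_range]
    refine exists_congr fun x => ?_
    rw [eq_comm]
    simp [Set.ext_iff, eq_comm]
  rw [cycleCount, this, ← Set.image_univ, Set.ncard_image_of_injective _ Set.singleton_injective,
    Set.ncard_univ]

theorem setOf_sameCycle_image [Finite α] {σ : Equiv.Perm α} {τ : Equiv.Perm β} {ι : β → α}
    (hι : Function.Injective ι) (h : ∀ y, σ (ι y) = ι (τ y)) (y : β) :
    {x | σ.SameCycle (ι y) x} = ι '' {x | τ.SameCycle y x} := by
  ext x
  constructor
  · intro hx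
    obtain ⟨n, rfl⟩ := Equiv.Perm.SameCycle.exists_nat_pow_eq hx
    have hpow : ∃ z, (σ ^ n) (ι y) = ι z := by
      clear hx
      induction n with
      | zero => exact ⟨y, rfl⟩
      | succ n ih =>
        obtain ⟨z, hz⟩ := ih
        exact ⟨τ z, by rw [pow_succ', Equiv.Perm.mul_apply, hz, h]⟩
    obtain ⟨z, hz⟩ := hpow
    rw [hz] at hx ⊢
    exact ⟨z, (sameCycle_image_iff hι h).mp hx, rfl⟩
  · rintro ⟨z, hz, rfl⟩
    exact (sameCycle_image_iff hι h).mpr hz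

theorem ncard_image_inter {ι : β → α} (hι : Function.Injective ι) (S : Set β) (T : Set α) :
    (ι '' S ∩ T).ncard = (S ∩ ι ⁻¹' T).ncard := by
  rw [← Set.image_inter_preimage, Set.ncard_image_of_injective _ hι]

/-- Cycles in a disjoint union of two invariant subsets. -/
theorem cycleCount_add [Finite α] {σ : Equiv.Perm α} {τ₁ : Equiv.Perm β} {τ₂ : Equiv.Perm γ}
    {ι₁ : β → α} {ι₂ : γ → α} (h₁ : Function.Injective ι₁) (h₂ : Function.Injective ι₂)
    (hne : ∀ y z, ι₁ y ≠ ι₂ z) (hcov : ∀ x, (∃ y, ι₁ y = x) ∨ ∃ z, ι₂ z = x)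
    (hσ₁ : ∀ y, σ (ι₁ y) = ι₁ (τ₁ y)) (hσ₂ : ∀ z, σ (ι₂ z) = ι₂ (τ₂ z)) (T : Set α) :
    cycleCount σ T = cycleCount τ₁ (ι₁ ⁻¹' T) + cycleCount τ₂ (ι₂ ⁻¹' T) := by
  have : Finite β := Finite.of_injective ι₁ h₁
  have : Finite γ := Finite.of_injective ι₂ h₂
  have hu : {S ∈ permCycles σ | (S ∩ T).ncard = 0 ∨ (S ∩ T).ncard = 2} =
      (ι₁ '' ·) '' {S ∈ permCycles τ₁ | (S ∩ ι₁ ⁻¹' T).ncard = 0 ∨ (S ∩ ι₁ ⁻¹' T).ncard = 2} ∪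
      (ι₂ '' ·) '' {S ∈ permCycles τ₂ | (S ∩ ι₂ ⁻¹' T).ncard = 0 ∨ (S ∩ ι₂ ⁻¹' T).ncard = 2} := by
    ext S
    constructor
    · rintro ⟨⟨x, rfl⟩, hT⟩
      rcases hcov x with ⟨y, rfl⟩ | ⟨y, rfl⟩
      · rw [setOf_sameCycle_image h₁ hσ₁, ncard_image_inter h₁] at hT
        exact Or.inl ⟨_, ⟨⟨y, rfl⟩, hT⟩, (setOf_sameCycle_image h₁ hσ₁ y).symm⟩
      · rw [setOf_sameCycle_image h₂ hσ₂, ncard_image_inter h₂] at hT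
        exact Or.inr ⟨_, ⟨⟨y, rfl⟩, hT⟩, (setOf_sameCycle_image h₂ hσ₂ y).symm⟩
    · rintro (⟨S', ⟨⟨y, rfl⟩, hT⟩, rfl⟩ | ⟨S', ⟨⟨y, rfl⟩, hT⟩, rfl⟩)
      · refine ⟨⟨ι₁ y, (setOf_sameCycle_image h₁ hσ₁ y).symm⟩, ?_⟩
        rwa [ncard_image_inter h₁]
      · refine ⟨⟨ι₂ y, (setOf_sameCycle_image h₂ hσ₂ y).symm⟩, ?_⟩
        rwa [ncard_image_inter h₂]
  rw [cycleCount, hu, Set.ncard_union_eq,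
    Set.ncard_image_of_injective _ h₁.image_injective,
    Set.ncard_image_of_injective _ h₂.image_injective]
  · rfl
  · rw [Set.disjoint_left]
    rintro _ ⟨_, ⟨⟨y, rfl⟩, -⟩, rfl⟩ ⟨_, ⟨⟨z, rfl⟩, -⟩, he⟩
    have : ι₁ y ∈ ι₁ '' {x | τ₁.SameCycle y x} := ⟨y, Equiv.Perm.SameCycle.refl _ _, rfl⟩
    simp only at he
    rw [← he] at this
    obtain ⟨z', -, hz'⟩ := this
    exact hne _ _ hz'.symm

/-- The count does not change under passing to the first return map to a subset that meets every
cycle and contains `T`. -/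
theorem cycleCount_return [Finite α] {σ : Equiv.Perm α} {τ : Equiv.Perm β} {ι : β → α}
    (hι : Function.Injective ι)
    (hret : ∀ y, σ (ι y) = ι (τ y) ∨ (σ (ι y) ∉ Set.range ι ∧ σ (σ (ι y)) = ι (τ y)))
    (hmeet : ∀ x, x ∉ Set.range ι → σ x ∈ Set.range ι) {T : Set α} (hT : T ⊆ Set.range ι) :
    cycleCount σ T = cycleCount τ (ι ⁻¹' T) := by
  have : Finite β := Finite.of_injective ι hι
  have hstep : ∀ y, σ.SameCycle (ι y) (ι (τ y)) := fun y => by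
    rcases hret y with h | ⟨-, h⟩
    · exact ⟨1, by rw [zpow_one, h]⟩
    · exact ⟨2, h⟩
  -- Strong induction, since one step of `τ` uses up one or two steps of `σ`.
  have hpow : ∀ (n : ℕ) y y', (σ ^ n) (ι y) = ι y' → τ.SameCycle y y' := by
    intro n
    induction n using Nat.strong_induction_on with
    | _ n ih =>
      intro y y' h
      match n, ih, h with
      | 0, _, h => rw [hι h]
      | n + 1, ih, h =>
        rcases hret y with h1 | ⟨h1, h2⟩
        · rw [pow_succ, Equiv.Perm.mul_apply, h1] at h
          exact Equiv.Perm.sameCycle_apply_left.mp (ih n (by omega) _ _ h)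
        · rcases n with _ | n
          · rw [zero_add, pow_one] at h
            exact (h1 ⟨y', h.symm⟩).elim
          · rw [pow_succ, pow_succ, Equiv.Perm.mul_apply, Equiv.Perm.mul_apply, h2] at h
            exact Equiv.Perm.sameCycle_apply_left.mp (ih n (by omega) _ _ h)
  have hsame : ∀ y y', σ.SameCycle (ι y) (ι y') ↔ τ.SameCycle y y' := fun y y' => by
    constructor
    · intro h
      obtain ⟨n, hn⟩ := h.exists_nat_pow_eq
      exact hpow n y y' hn
    · intro h
      obtain ⟨n, rfl⟩ := h.exists_nat_pow_eq
      clear h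
      induction n with
      | zero => exact Equiv.Perm.SameCycle.refl _ _
      | succ n ih =>
        rw [pow_succ', Equiv.Perm.mul_apply]
        exact ih.trans (hstep _)
  have hpre : ∀ y, ι ⁻¹' {x | σ.SameCycle (ι y) x} = {y' | τ.SameCycle y y'} := fun y => by
    ext y'; exact hsame y y'
  have hrep : ∀ S ∈ permCycles σ, ∃ y, S = {x | σ.SameCycle (ι y) x} := by
    rintro _ ⟨x, rfl⟩
    by_cases hx : x ∈ Set.range ι
    · obtain ⟨y, rfl⟩ := hx
      exact ⟨y, rfl⟩
    · obtain ⟨y, hy⟩ := hmeet x hx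
      refine ⟨y, setOf_sameCycle_eq ?_⟩
      rw [hy]
      exact Equiv.Perm.sameCycle_apply_right.mpr (Equiv.Perm.SameCycle.refl _ _)
  have hcard : ∀ S : Set α, (ι ⁻¹' S ∩ ι ⁻¹' T).ncard = (S ∩ T).ncard := fun S => by
    rw [← Set.preimage_inter]
    exact Set.ncard_preimage_of_injective_subset_range hι (Set.inter_subset_right.trans hT)
  have himage : {S ∈ permCycles τ | (S ∩ ι ⁻¹' T).ncard = 0 ∨ (S ∩ ι ⁻¹' T).ncard = 2} =
      (ι ⁻¹' ·) '' {S ∈ permCycles σ | (S ∩ T).ncard = 0 ∨ (S ∩ T).ncard = 2} := by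
    ext S
    constructor
    · rintro ⟨⟨y, rfl⟩, h⟩
      rw [← hpre, hcard] at h
      exact ⟨_, ⟨⟨ι y, rfl⟩, h⟩, hpre y⟩
    · rintro ⟨S, ⟨hS, h⟩, rfl⟩
      obtain ⟨y, rfl⟩ := hrep S hS
      refine ⟨⟨y, hpre y⟩, ?_⟩
      rwa [hcard]
  rw [cycleCount, cycleCount, himage, Set.InjOn.ncard_image]
  rintro S ⟨hS, -⟩ S' ⟨hS', -⟩ he
  obtain ⟨y, rfl⟩ := hrep S hS
  obtain ⟨y', rfl⟩ := hrep S' hS'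
  simp only [hpre] at he
  exact setOf_sameCycle_eq ((hsame _ _).mpr (setOf_sameCycle_eq_iff.mp he))

theorem sameCycle_iff_of_involutive {σ : Equiv.Perm α} (h : σ * σ = 1) {x y : α} :
    σ.SameCycle x y ↔ y = x ∨ y = σ x := by
  constructor
  · rintro ⟨k, rfl⟩
    have h2 : σ ^ (2 : ℤ) = 1 := by rw [zpow_two, h]
    rcases Int.even_or_odd' k with ⟨l, rfl | rfl⟩
    · left; rw [zpow_mul, h2]; simp
    · right; rw [zpow_add, zpow_mul, h2]; simp
  · rintro (rfl | rfl)
    · exact Equiv.Perm.SameCycle.refl _ _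
    · exact Equiv.Perm.sameCycle_apply_right.mpr (Equiv.Perm.SameCycle.refl _ _)

/-- The pairs `{i, i.rev}` have two elements of the set each and count; for odd `d` the middle fixed
point has exactly one and does not. -/
theorem cycleCount_revPerm (d : ℕ) : cycleCount (Fin.revPerm : Equiv.Perm (Fin d)) Set.univ = d / 2 := by
  have hinv : (Fin.revPerm : Equiv.Perm (Fin d)) * Fin.revPerm = 1 := by
    ext i; simp
  have hc : ∀ x : Fin d, {y | (Fin.revPerm : Equiv.Perm (Fin d)).SameCycle x y} = {x, x.rev} := by
    intro x
    ext y
    rw [Set.mem_ofPred_eq, sameCycle_iff_of_involutive hinv]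
    simp
  have himage : {S ∈ permCycles (Fin.revPerm : Equiv.Perm (Fin d)) |
      (S ∩ Set.univ).ncard = 0 ∨ (S ∩ Set.univ).ncard = 2} =
      Set.range fun i : Fin (d / 2) => ({⟨i, by omega⟩, (⟨i, by omega⟩ : Fin d).rev} : Set (Fin d)) := by
    ext S
    simp only [Set.inter_univ, Set.mem_ofPred_eq, Set.mem_range]
    constructor
    · rintro ⟨⟨x, rfl⟩, h⟩
      rw [hc] at h ⊢
      have hne : x ≠ x.rev := fun he => by
        rw [← he, Set.pair_eq_singleton, Set.ncard_singleton] at h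
        omega
      have hne' : (x : ℕ) ≠ d - (x + 1) := fun he => hne (Fin.ext (by rw [Fin.val_rev]; exact he))
      by_cases hx : (x : ℕ) < d / 2
      · exact ⟨⟨x, hx⟩, rfl⟩
      · refine ⟨⟨x.rev, by rw [Fin.val_rev]; omega⟩, ?_⟩
        simp only [Fin.eta, Fin.rev_rev]
        exact Set.pair_comm _ _
    · rintro ⟨i, rfl⟩
      refine ⟨⟨_, (hc _).symm⟩, Or.inr (Set.ncard_pair fun he => ?_)⟩
      have := congrArg Fin.val he
      rw [Fin.val_rev] at this
      simp only at this
      omega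
  rw [cycleCount, himage, ← Set.image_univ, Set.ncard_image_of_injective, Set.ncard_univ,
    Nat.card_eq_fintype_card, Fintype.card_fin]
  intro i j hij
  have : (⟨i, by omega⟩ : Fin d) ∈ ({⟨j, by omega⟩, (⟨j, by omega⟩ : Fin d).rev} : Set (Fin d)) := by
    simp only at hij
    rw [← hij]; exact Set.mem_insert _ _
  rcases this with h | h
  · exact Fin.ext (Fin.mk.inj_iff.mp h)
  · have := congrArg Fin.val (Set.mem_singleton_iff.mp h)
    rw [Fin.val_rev] at this
    simp only at this
    omega

end cycleCount

end

section

/-! ### The involution attached to a string -/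

/-- The involution of the natural numbers that reverses each block of `a`. -/
def reflect : List ℕ → ℕ → ℕ
  | [], x => x
  | c :: a, x => if x < c then c - 1 - x else c + reflect a (x - c)

theorem reflect_cons_of_lt {c x : ℕ} (a : List ℕ) (h : x < c) :
    reflect (c :: a) x = c - 1 - x := if_pos h

theorem reflect_cons_of_le {c x : ℕ} (a : List ℕ) (h : c ≤ x) :
    reflect (c :: a) x = c + reflect a (x - c) := if_neg (not_lt.mpr h)

theorem reflect_of_sum_le {a : List ℕ} {x : ℕ} (h : a.sum ≤ x) : reflect a x = x := by
  induction a generalizing x with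
  | nil => rfl
  | cons c a ih =>
    rw [List.sum_cons] at h
    rw [reflect, if_neg (by omega), ih (by omega)]
    omega

theorem reflect_eq {a : List ℕ} {x : ℕ} (i : Fin a.length) (h₁ : (a.take i).sum ≤ x)
    (h₂ : x < (a.take i).sum + a[i]) : reflect a x + x + 1 = 2 * (a.take i).sum + a[i] := by
  induction a generalizing x with
  | nil => exact i.elim0
  | cons c a ih =>
    refine Fin.cases ?_ (fun i => ?_) i h₁ h₂
    · intro h₁ h₂
      simp only [Fin.val_zero, List.take_zero, List.sum_nil, Fin.getElem_fin,
        List.getElem_cons_zero] at h₁ h₂ ⊢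
      rw [reflect, if_pos (by omega)]
      omega
    · intro h₁ h₂
      simp only [Fin.val_succ, List.take_succ_cons, List.sum_cons, Fin.getElem_fin,
        List.getElem_cons_succ] at h₁ h₂ ⊢
      have := ih (x := x - c) i (by omega) (by simp only [Fin.getElem_fin]; omega)
      simp only [Fin.getElem_fin] at this
      rw [reflect, if_neg (by omega)]
      omega

theorem exists_block {a : List ℕ} {x : ℕ} (h : x < a.sum) :
    ∃ i : Fin a.length, (a.take i).sum ≤ x ∧ x < (a.take i).sum + a[i] := by
  induction a generalizing x with
  | nil => simp at h
  | cons c a ih =>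
    by_cases hx : x < c
    · exact ⟨0, by simp, by simpa using hx⟩
    · rw [List.sum_cons] at h
      obtain ⟨i, h₁, h₂⟩ := ih (x := x - c) (by omega)
      refine ⟨i.succ, ?_, ?_⟩
      · simp only [Fin.val_succ, List.take_succ_cons, List.sum_cons]
        omega
      · simp only [Fin.val_succ, List.take_succ_cons, List.sum_cons, Fin.getElem_fin,
          List.getElem_cons_succ] at h₂ ⊢
        omega

theorem reflect_of_arc {n : ℕ} {a : List ℕ} {j k : Fin n} (h : Arc a j k) : reflect a j = k := by
  obtain ⟨-, i, ⟨h₁, h₂⟩, -, he⟩ := h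
  have := reflect_eq (a := a) (x := j) i (by simp only [label] at h₁; omega)
    (by simp only [label] at h₂; omega)
  simp only [label] at he
  omega

theorem sum_take_add_getElem_le {a : List ℕ} (i : Fin a.length) :
    (a.take i).sum + a[i] ≤ a.sum := by
  have h := List.sum_take_succ a i i.isLt
  have h' : (a.take (i + 1)).sum ≤ a.sum := (List.take_sublist _ _).sum_le_sum (by simp)
  simp only [Fin.getElem_fin]
  omega

theorem arc_of_reflect_ne {n : ℕ} {a : List ℕ} (ha : a.sum ≤ n) {j : Fin n}
    (h : reflect a j ≠ j) : ∃ k, Arc a j k := by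
  have hj : (j : ℕ) < a.sum := by
    by_contra hn
    exact h (reflect_of_sum_le (not_lt.mp hn))
  obtain ⟨i, h₁, h₂⟩ := exists_block hj
  have h₃ := reflect_eq i h₁ h₂
  have h₄ := sum_take_add_getElem_le i
  refine ⟨⟨reflect a j, by omega⟩, fun he => h (congrArg Fin.val he).symm, i, ⟨?_, ?_⟩, ⟨?_, ?_⟩, ?_⟩
    <;> simp only [label] <;> omega

/-- Replaces the choice in `partner` by arithmetic on natural numbers, where a leading block can be
peeled off. The bound on the sum keeps mirror images among the `n` vertices. -/
theorem arcPerm_apply {n : ℕ} {a : List ℕ} (ha : a.sum ≤ n) (j : Fin n) :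
    (arcPerm n a j : ℕ) = reflect a j := by
  change ((partner a j : Fin n) : ℕ) = _
  by_cases h : reflect a j = j
  · rw [partner, dif_neg, h]
    rintro ⟨k, hk⟩
    exact hk.1 (Fin.ext (h.symm.trans (reflect_of_arc hk)))
  · obtain ⟨k, hk⟩ := arc_of_reflect_ne ha h
    rw [partner_of_arc hk, reflect_of_arc hk]

theorem arcPerm_mul_self (n : ℕ) (a : List ℕ) : arcPerm n a * arcPerm n a = 1 := by
  ext j
  simp only [Equiv.Perm.mul_apply, Equiv.Perm.one_apply]
  exact congrArg Fin.val (partner_involutive a j)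

theorem arcPerm_inv (n : ℕ) (a : List ℕ) : (arcPerm n a)⁻¹ = arcPerm n a :=
  inv_eq_of_mul_eq_one_left (arcPerm_mul_self n a)

theorem sigma_apply {n : ℕ} {a b : List ℕ} (ha : a.sum ≤ n) (hb : b.sum ≤ n) (j : Fin n) :
    (sigma n a b j : ℕ) = reflect a (reflect b j) := by
  rw [sigma, Equiv.Perm.mul_apply, arcPerm_apply ha, arcPerm_apply hb]

theorem sigma_swap (n : ℕ) (a b : List ℕ) : sigma n b a = (sigma n a b)⁻¹ := by
  rw [sigma, sigma, mul_inv_rev, arcPerm_inv, arcPerm_inv]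

theorem tail_swap (n : ℕ) (a b : List ℕ) : tail n b a = tail n a b := symmDiff_comm _ _

theorem mem_tail {n : ℕ} {a b : List ℕ} {v : Fin n} :
    v ∈ tail n a b ↔ (a.sum ≤ v ∧ (v : ℕ) < b.sum) ∨ (b.sum ≤ v ∧ (v : ℕ) < a.sum) := by
  rw [tail, Set.mem_symmDiff]
  simp only [tailOf, label, Set.mem_ofPred_eq]
  omega

/-- The count of cycles attached to two strings. -/
def listCount (n : ℕ) (a b : List ℕ) : ℕ := cycleCount (sigma n a b) (tail n a b)

theorem listCount_swap (n : ℕ) (a b : List ℕ) : listCount n a b = listCount n b a := by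
  rw [listCount, listCount, sigma_swap, tail_swap, cycleCount_inv]

theorem listCount_zero_cons {n : ℕ} {a b : List ℕ} (ha : a.sum ≤ n) :
    listCount n (0 :: a) b = listCount n a b := by
  have h : arcPerm n (0 :: a) = arcPerm n a := by
    ext j
    rw [arcPerm_apply ha, arcPerm_apply (by simpa using ha)]
    simp [reflect]
  rw [listCount, listCount, sigma, sigma, h, tail, tail]
  simp [tailOf]

theorem listCount_nil (n : ℕ) : listCount n [] [] = n := by
  have h : sigma n [] [] = 1 := by
    ext j; rw [sigma_apply (by simp) (by simp)]; rfl
  have ht : tail n [] [] = ∅ := symmDiff_self _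
  rw [listCount, h, ht, cycleCount_one, Nat.card_eq_fintype_card, Fintype.card_fin]

/-- On the first `c` vertices both reflections agree, so `sigma` fixes them, and none of them is in
the tail. -/
theorem listCount_cons_cons {c m : ℕ} {a b : List ℕ} (ha : a.sum ≤ m) (hb : b.sum ≤ m) :
    listCount (c + m) (c :: a) (c :: b) = c + listCount m a b := by
  have ha' : (c :: a).sum ≤ c + m := by rw [List.sum_cons]; omega
  have hb' : (c :: b).sum ≤ c + m := by rw [List.sum_cons]; omega
  rw [listCount, cycleCount_add (τ₁ := 1) (τ₂ := sigma m a b) (Fin.castAdd_injective c m)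
    (Fin.natAdd_injective m c) (fun y z h => ?_) (fun x => ?_) (fun y => ?_) (fun z => ?_)]
  · congr 1
    · have : Fin.castAdd m ⁻¹' tail (c + m) (c :: a) (c :: b) = ∅ := by
        ext v
        rw [Set.mem_preimage, mem_tail]
        simp only [List.sum_cons, Fin.val_castAdd, Set.mem_empty_iff_false, iff_false]
        omega
      rw [this, cycleCount_one, Nat.card_eq_fintype_card, Fintype.card_fin]
    · have : Fin.natAdd c ⁻¹' tail (c + m) (c :: a) (c :: b) = tail m a b := by
        ext v
        rw [Set.mem_preimage, mem_tail, mem_tail]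
        simp only [List.sum_cons, Fin.val_natAdd]
        omega
      rw [this, listCount]
  · have := congrArg Fin.val h
    simp only [Fin.val_castAdd, Fin.val_natAdd] at this
    omega
  · induction x using Fin.addCases with
    | left i => exact Or.inl ⟨i, rfl⟩
    | right i => exact Or.inr ⟨i, rfl⟩
  · refine Fin.ext ?_
    rw [sigma_apply ha' hb', Fin.val_castAdd, reflect_cons_of_lt b y.isLt,
      reflect_cons_of_lt a (by omega), Equiv.Perm.one_apply, Fin.val_castAdd]
    omega
  · refine Fin.ext ?_
    rw [sigma_apply ha' hb', Fin.val_natAdd, Fin.val_natAdd, sigma_apply ha hb]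
    simp [reflect]

/-- The first block lies in the tail, as the other sum is 0, and `sigma` reverses it: the
counterpart of the orthogonal summand. -/
theorem listCount_nil_cons {d m : ℕ} {b : List ℕ} (hb : b.sum ≤ m) :
    listCount (d + m) [] (d :: b) = d / 2 + listCount m [] b := by
  have hb' : (d :: b).sum ≤ d + m := by rw [List.sum_cons]; omega
  rw [listCount, cycleCount_add (τ₁ := Fin.revPerm) (τ₂ := sigma m [] b) (Fin.castAdd_injective d m)
    (Fin.natAdd_injective m d) (fun y z h => ?_) (fun x => ?_) (fun y => ?_) (fun z => ?_)]
  · congr 1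
    · have : Fin.castAdd m ⁻¹' tail (d + m) [] (d :: b) = Set.univ := by
        ext v
        rw [Set.mem_preimage, mem_tail]
        simp only [List.sum_cons, List.sum_nil, Fin.val_castAdd, Set.mem_univ, iff_true]
        omega
      rw [this, cycleCount_revPerm]
    · have : Fin.natAdd d ⁻¹' tail (d + m) [] (d :: b) = tail m [] b := by
        ext v
        rw [Set.mem_preimage, mem_tail, mem_tail]
        simp only [List.sum_cons, List.sum_nil, Fin.val_natAdd]
        omega
      rw [this, listCount]
  · have := congrArg Fin.val h
    simp only [Fin.val_castAdd, Fin.val_natAdd] at this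
    omega
  · induction x using Fin.addCases with
    | left i => exact Or.inl ⟨i, rfl⟩
    | right i => exact Or.inr ⟨i, rfl⟩
  · refine Fin.ext ?_
    rw [sigma_apply (by simp) hb', Fin.val_castAdd]
    simp only [reflect, Fin.val_castAdd, Fin.revPerm_apply, Fin.val_rev]
    rw [if_pos y.isLt]
    omega
  · refine Fin.ext ?_
    rw [sigma_apply (by simp) hb', Fin.val_natAdd, Fin.val_natAdd, sigma_apply (by simp) hb]
    simp [reflect]

theorem mem_range_natAdd {k m : ℕ} {x : Fin (k + m)} :
    x ∈ Set.range (Fin.natAdd k : Fin m → Fin (k + m)) ↔ k ≤ x := by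
  constructor
  · rintro ⟨y, rfl⟩
    simp
  · intro h
    exact ⟨⟨x - k, by omega⟩, Fin.ext (by simp only [Fin.val_natAdd]; omega)⟩

/-- Counterpart of the contraction: the first `c` vertices are deleted and `sigma` is followed
through them. A deleted vertex is left after one step, and none is in the tail, because both strings
cover these positions. -/
theorem listCount_contract_large {c d m : ℕ} {a b : List ℕ} (h : 2 * c ≤ d) (ha : a.sum ≤ m)
    (hb : d + b.sum ≤ c + m) :
    listCount (c + m) (c :: a) (d :: b) = listCount m a ((d - 2 * c) :: c :: b) := by
  have ha' : (c :: a).sum ≤ c + m := by rw [List.sum_cons]; omega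
  have hb' : (d :: b).sum ≤ c + m := by rw [List.sum_cons]; omega
  have hb'' : ((d - 2 * c) :: c :: b).sum ≤ m := by rw [List.sum_cons, List.sum_cons]; omega
  rw [listCount, cycleCount_return (τ := sigma m a ((d - 2 * c) :: c :: b))
    (Fin.natAdd_injective m c) (fun y => ?_) (fun x hx => ?_) (fun x hx => ?_), listCount]
  · congr 1
    ext v
    rw [Set.mem_preimage, mem_tail, mem_tail]
    simp only [List.sum_cons, Fin.val_natAdd]
    omega
  · rw [mem_range_natAdd, Fin.ext_iff, Fin.ext_iff, sigma_apply ha' hb', sigma_apply ha' hb',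
      sigma_apply ha' hb', Fin.val_natAdd, Fin.val_natAdd, sigma_apply ha hb'']
    simp only [reflect]
    grind
  · rw [mem_range_natAdd] at hx ⊢
    rw [sigma_apply ha' hb']
    simp only [reflect]
    grind
  · rw [mem_tail] at hx
    simp only [List.sum_cons] at hx
    rw [mem_range_natAdd]
    omega

/-- The first `d - c` vertices are deleted. They are fewer than `c`, hence covered by both strings,
and the first return map is `sigma` for the contracted strings. -/
theorem listCount_contract_small {c d m : ℕ} {a b : List ℕ} (h : d < 2 * c) (hc : c < d)
    (ha : c + a.sum ≤ d - c + m) (hb : c + b.sum ≤ m) :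
    listCount (d - c + m) (c :: a) (d :: b) = listCount m ((2 * c - d) :: a) (c :: b) := by
  have ha' : (c :: a).sum ≤ d - c + m := by rw [List.sum_cons]; omega
  have hb' : (d :: b).sum ≤ d - c + m := by rw [List.sum_cons]; omega
  have ha'' : ((2 * c - d) :: a).sum ≤ m := by rw [List.sum_cons]; omega
  have hb'' : (c :: b).sum ≤ m := by rw [List.sum_cons]; omega
  rw [listCount, cycleCount_return (τ := sigma m ((2 * c - d) :: a) (c :: b))
    (Fin.natAdd_injective m (d - c)) (fun y => ?_) (fun x hx => ?_) (fun x hx => ?_), listCount]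
  · congr 1
    ext v
    rw [Set.mem_preimage, mem_tail, mem_tail]
    simp only [List.sum_cons, Fin.val_natAdd]
    omega
  · rw [mem_range_natAdd, Fin.ext_iff, Fin.ext_iff, sigma_apply ha' hb', sigma_apply ha' hb',
      sigma_apply ha' hb', Fin.val_natAdd, Fin.val_natAdd, sigma_apply ha'' hb'']
    generalize (y : ℕ) = y
    by_cases hy : c ≤ y
    · left
      rw [reflect_cons_of_le b (by omega : d ≤ d - c + y), reflect_cons_of_le a (by omega),
        reflect_cons_of_le b hy, reflect_cons_of_le a (by omega),
        show d - c + y - d = y - c by omega,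
        show c + reflect b (y - c) - (2 * c - d) = d + reflect b (y - c) - c by omega]
      omega
    -- For these vertices the two reflections compose to a translation by `c - d`; the result is a
    -- deleted vertex exactly when `y < d - c`.
    · have h1 : reflect (c :: a) (reflect (d :: b) (d - c + y)) = y := by
        rw [reflect_cons_of_lt b (by omega), reflect_cons_of_lt a (by omega)]
        omega
      rw [h1, reflect_cons_of_lt b (by omega : y < c)]
      by_cases hy' : d - c ≤ y
      · left
        rw [reflect_cons_of_lt a (by omega)]
        omega
      · refine Or.inr ⟨hy', ?_⟩
        rw [reflect_cons_of_lt b (by omega), reflect_cons_of_le a (by omega),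
          reflect_cons_of_le a (by omega),
          show c - 1 - y - (2 * c - d) = d - 1 - y - c by omega]
        omega
  · rw [mem_range_natAdd] at hx ⊢
    rw [sigma_apply ha' hb']
    simp only [reflect]
    grind
  · rw [mem_tail] at hx
    simp only [List.sum_cons] at hx
    rw [mem_range_natAdd]
    omega

end

/-! ### Comparison of the two recursions -/

section

variable {K : Type*} [Field K] [IsAlgClosed K] [CharZero K]

/-- The Euclidean step: index and count contract to the same pair of strings on fewer vertices. -/
theorem listIndex_eq_listCount_of_lt {c d n : ℕ} {a b : List ℕ} (hc : 0 < c) (hcd : c < d)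
    (ha : (c :: a).sum ≤ n) (hb : (d :: b).sum ≤ n)
    (ih : ∀ m < n, ∀ a b : List ℕ, a.sum ≤ m → b.sum ≤ m → listIndex K m a b = listCount m a b) :
    listIndex K n (c :: a) (d :: b) = listCount n (c :: a) (d :: b) := by
  rw [List.sum_cons] at ha hb
  by_cases h : 2 * c ≤ d
  · obtain ⟨m, rfl⟩ : ∃ m, n = c + m := ⟨n - c, by omega⟩
    rw [listIndex_contract_large a b h (by omega), listCount_contract_large h (by omega) hb]
    exact ih m (by omega) _ _ (by omega) (by rw [List.sum_cons, List.sum_cons]; omega)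
  · obtain ⟨m, rfl⟩ : ∃ m, n = d - c + m := ⟨n - (d - c), by omega⟩
    rw [listIndex_contract_small a b (by omega) hcd (by omega),
      listCount_contract_small (by omega) hcd ha (by omega)]
    exact ih m (by omega) _ _ (by rw [List.sum_cons]; omega) (by rw [List.sum_cons]; omega)

theorem listIndex_nil_eq_listCount {n : ℕ} {b : List ℕ} (hb : b.sum ≤ n) :
    listIndex K n [] b = listCount n [] b := by
  induction b generalizing n with
  | nil => rw [listIndex_nil, listCount_nil]
  | cons d b ih =>
    rw [List.sum_cons] at hb
    obtain ⟨m, rfl⟩ : ∃ m, n = d + m := ⟨n - d, by omega⟩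
    rw [listIndex_nil_cons, listCount_nil_cons (by omega), ih (by omega)]

theorem listIndex_eq_listCount (n : ℕ) (a b : List ℕ) (ha : a.sum ≤ n) (hb : b.sum ≤ n) :
    listIndex K n a b = listCount n a b := by
  induction n using Nat.strong_induction_on generalizing a b with
  | _ n ihn =>
    -- The inner induction on the number of parts is for removing a part 0, which leaves `n`
    -- unchanged.
    induction hl : a.length + b.length using Nat.strong_induction_on generalizing a b with
    | _ l ihl =>
      match a, b, ha, hb, hl with
      | [], b, ha, hb, hl => exact listIndex_nil_eq_listCount hb
      | a, [], ha, hb, hl =>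
        rw [listIndex_swap, listCount_swap]
        exact listIndex_nil_eq_listCount ha
      | 0 :: a, b, ha, hb, hl =>
        rw [List.sum_cons, zero_add] at ha
        rw [listIndex_zero_cons, listCount_zero_cons ha]
        exact ihl _ (by rw [← hl, List.length_cons]; omega) a b ha hb rfl
      | a, 0 :: b, ha, hb, hl =>
        rw [List.sum_cons, zero_add] at hb
        rw [listIndex_swap, listCount_swap, listIndex_zero_cons, listCount_zero_cons hb]
        exact ihl _ (by rw [← hl, List.length_cons]; omega) b a hb ha rfl
      | (c + 1) :: a, (d + 1) :: b, ha, hb, hl =>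
        rcases lt_trichotomy (c + 1) (d + 1) with h | h | h
        · exact listIndex_eq_listCount_of_lt (Nat.succ_pos _) h ha hb ihn
        · rw [← h] at hb ⊢
          rw [List.sum_cons] at ha hb
          obtain ⟨m, rfl⟩ : ∃ m, n = c + 1 + m := ⟨n - (c + 1), by omega⟩
          rw [listIndex_cons_cons, listCount_cons_cons (by omega) (by omega),
            ihn m (by omega) a b (by omega) (by omega)]
        · rw [listIndex_swap, listCount_swap]
          exact listIndex_eq_listCount_of_lt (Nat.succ_pos _) h hb ha ihn

end

section

/-! ### Standard parabolic subalgebras -/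

section

variable {K : Type*} [Field K] {n : ℕ}

/-- The reversal of the second half of the indices. -/
def flipIndex (n : ℕ) : Fin n ⊕ Fin n ≃ Fin n ⊕ Fin n := (Equiv.refl _).sumCongr Fin.revPerm

/-- The automorphism that reverses the order of the second half of the rows and columns. -/
def flip (K : Type*) [Field K] (n : ℕ) : Mat K n ≃ₗ⁅K⁆ Mat K n :=
  Matrix.reindexLieEquiv (flipIndex n)

theorem flip_apply (X : Mat K n) : flip K n X = X.submatrix (flipIndex n) (flipIndex n) := by
  have : (flipIndex n).symm = flipIndex n := by
    ext (i | i) <;> simp [flipIndex]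
  rw [flip, Matrix.reindexLieEquiv_apply, Matrix.reindex_apply, this]

theorem flip_flip (X : Mat K n) : flip K n (flip K n X) = X := by
  rw [flip_apply, flip_apply]
  ext (i | i) (j | j) <;> simp [flipIndex]

theorem flip_inj {X Y : Mat K n} : flip K n X = flip K n Y ↔ X = Y :=
  ⟨fun h => by rw [← flip_flip X, h, flip_flip], fun h => h ▸ rfl⟩

theorem flip_inl_inl (X : Mat K n) (i j : Fin n) :
    flip K n X (.inl i) (.inl j) = X (.inl i) (.inl j) := by
  rw [flip_apply]; rfl

theorem flip_inl_inr (X : Mat K n) (i j : Fin n) :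
    flip K n X (.inl i) (.inr j) = X (.inl i) (.inr j.rev) := by
  rw [flip_apply]; rfl

theorem flip_inr_inl (X : Mat K n) (i j : Fin n) :
    flip K n X (.inr i) (.inl j) = X (.inr i.rev) (.inl j) := by
  rw [flip_apply]; rfl

theorem flip_inr_inr (X : Mat K n) (i j : Fin n) :
    flip K n X (.inr i) (.inr j) = X (.inr i.rev) (.inr j.rev) := by
  rw [flip_apply]; rfl

/-- Reversing the last `n` coordinates turns the antidiagonal transpose into the ordinary one. -/
theorem mem_sp_iff {X : Mat K n} :
    X ∈ sp K n ↔ ∃ P Q S, Q.IsSymm ∧ S.IsSymm ∧ X = flip K n (blk P Q S) := by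
  constructor
  · rintro ⟨A, B, C, hB, hC, rfl⟩
    refine ⟨A, Matrix.of fun i j => B i j.rev, Matrix.of fun i j => C i.rev j, ?_, ?_, ?_⟩
    · ext i j
      have := congrFun (congrFun hB j) i.rev
      simpa [antiTranspose] using this
    · ext i j
      have := congrFun (congrFun hC j.rev) i
      simpa [antiTranspose] using this
    · rw [← flip_flip (Matrix.fromBlocks A B C (-antiTranspose A))]
      congr 1
      ext (i | i) (j | j)
      · rw [flip_inl_inl]; rfl
      · rw [flip_inl_inr]; rfl
      · rw [flip_inr_inl]; rfl
      · rw [flip_inr_inr]; simp [blk, antiTranspose]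
  · rintro ⟨P, Q, S, hQ, hS, rfl⟩
    refine ⟨P, Matrix.of fun i j => Q i j.rev, Matrix.of fun i j => S i.rev j, ?_, ?_, ?_⟩
    · ext i j
      simpa [antiTranspose] using (hQ.apply i j.rev).symm
    · ext i j
      simpa [antiTranspose] using (hS.apply i.rev j).symm
    · ext (i | i) (j | j)
      · rw [flip_inl_inl]; rfl
      · rw [flip_inl_inr]; rfl
      · rw [flip_inr_inl]; rfl
      · rw [flip_inr_inr]; simp [blk, antiTranspose]

theorem flip_blk_mem_sp {P Q S : Matrix (Fin n) (Fin n) K} (hQ : Q.IsSymm) (hS : S.IsSymm) :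
    flip K n (blk P Q S) ∈ sp K n :=
  mem_sp_iff.mpr ⟨P, Q, S, hQ, hS, rfl⟩

theorem mem_cartan_iff {H : Mat K n} :
    H ∈ cartan K n ↔ ∃ h : Fin n → K, H = flip K n (blk (Matrix.diagonal h) 0 0) := by
  constructor
  · rintro ⟨hH, hd⟩
    obtain ⟨P, Q, S, hQ, hS, rfl⟩ := mem_sp_iff.mp hH
    refine ⟨fun i => P i i, congrArg _ (blk_inj.mpr ⟨?_, ?_, ?_⟩)⟩
    · ext i j
      by_cases hij : i = j
      · subst hij; rw [Matrix.diagonal_apply_eq]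
      · rw [Matrix.diagonal_apply_ne _ hij]
        have : flip K n (blk P Q S) (.inl i) (.inl j) = 0 := hd (by simpa using hij)
        rwa [flip_inl_inl] at this
    · ext i j
      have : flip K n (blk P Q S) (.inl i) (.inr j.rev) = 0 := hd (by simp)
      rw [flip_inl_inr, Fin.rev_rev] at this
      exact this
    · ext i j
      have : flip K n (blk P Q S) (.inr i.rev) (.inl j) = 0 := hd (by simp)
      rw [flip_inr_inl, Fin.rev_rev] at this
      exact this
  · rintro ⟨h, rfl⟩
    refine ⟨flip_blk_mem_sp Matrix.isSymm_zero Matrix.isSymm_zero, ?_⟩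
    rintro (i | i) (j | j) hij
    · rw [flip_inl_inl]
      exact Matrix.diagonal_apply_ne _ (by simpa using hij)
    · rw [flip_inl_inr]; rfl
    · rw [flip_inr_inl]; rfl
    · rw [flip_inr_inr]
      simp only [blk, Matrix.fromBlocks_apply₂₂, Matrix.neg_apply, Matrix.transpose_apply]
      rw [Matrix.diagonal_apply_ne _ (by simpa [eq_comm] using hij), neg_zero]

/-- The simple root with index `i` as a function of the first half of the diagonal. -/
def rootValue (i : Fin n) (h : Fin n → K) : K :=
  if hi : (i : ℕ) + 1 < n then h i - h ⟨i + 1, hi⟩ else 2 * h i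

theorem simpleRoot_flip (i : Fin n) (h : Fin n → K) :
    simpleRoot i (flip K n (blk (Matrix.diagonal h) 0 0)) = rootValue i h := by
  simp only [simpleRoot, rootValue, flip_inl_inl, blk, Matrix.fromBlocks_apply₁₁,
    Matrix.diagonal_apply_eq]

/-- Root decomposition: the blocks `P`, `Q`, `S` carry the weights `εᵢ - εⱼ`, `εᵢ + εⱼ` and `-(εᵢ +
εⱼ)`. -/
theorem lie_diagonal {h : Fin n → K} {P Q S : Matrix (Fin n) (Fin n) K} (hQ : Q.IsSymm)
    (hS : S.IsSymm) : ⁅blk (Matrix.diagonal h) 0 0, blk P Q S⁆ =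
      blk (Matrix.of fun i j => (h i - h j) * P i j) (Matrix.of fun i j => (h i + h j) * Q i j)
        (Matrix.of fun i j => -(h i + h j) * S i j) := by
  rw [lie_blk Matrix.isSymm_zero Matrix.isSymm_zero hQ hS]
  refine blk_inj.mpr ⟨?_, ?_, ?_⟩
  · ext i j
    simp [Matrix.diagonal_mul, Matrix.mul_diagonal]
    ring
  · ext i j
    simp [Matrix.diagonal_mul, -Matrix.transpose_mul, hQ.apply]
    ring
  · ext i j
    simp [Matrix.mul_diagonal, -Matrix.transpose_mul, hS.apply]
    ring

theorem flip_blk_mem_rootSpace_iff {β : Mat K n → K} {P Q S : Matrix (Fin n) (Fin n) K}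
    (hQ : Q.IsSymm) (hS : S.IsSymm) :
    flip K n (blk P Q S) ∈ rootSpace β ↔ ∀ h : Fin n → K,
      (∀ i j, (h i - h j) * P i j = β (flip K n (blk (Matrix.diagonal h) 0 0)) * P i j) ∧
      (∀ i j, (h i + h j) * Q i j = β (flip K n (blk (Matrix.diagonal h) 0 0)) * Q i j) ∧
      ∀ i j, -(h i + h j) * S i j = β (flip K n (blk (Matrix.diagonal h) 0 0)) * S i j := by
  have key : ∀ h : Fin n → K, (⁅flip K n (blk (Matrix.diagonal h) 0 0), flip K n (blk P Q S)⁆ =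
      β (flip K n (blk (Matrix.diagonal h) 0 0)) • flip K n (blk P Q S)) ↔
      (∀ i j, (h i - h j) * P i j = β (flip K n (blk (Matrix.diagonal h) 0 0)) * P i j) ∧
      (∀ i j, (h i + h j) * Q i j = β (flip K n (blk (Matrix.diagonal h) 0 0)) * Q i j) ∧
      ∀ i j, -(h i + h j) * S i j = β (flip K n (blk (Matrix.diagonal h) 0 0)) * S i j := by
    intro h
    rw [← LieEquiv.map_lie, ← map_smul, flip_inj, lie_diagonal hQ hS, blk_smul,
      blk_inj]
    simp only [← Matrix.ext_iff, Matrix.of_apply, Matrix.smul_apply, smul_eq_mul]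
  constructor
  · rintro ⟨-, hX⟩ h
    exact (key h).mp (hX _ (mem_cartan_iff.mpr ⟨h, rfl⟩))
  · intro hX
    refine ⟨flip_blk_mem_sp hQ hS, fun H hH => ?_⟩
    obtain ⟨h, rfl⟩ := mem_cartan_iff.mp hH
    exact (key h).mpr (hX h)

/-- The partial sums of a string are the places where its blocks end. For the last root the
comparison involves the position `n`, just outside the matrix. -/
theorem mem_rootsOf_iff {a : List ℕ} {i : Fin n} :
    i ∈ rootsOf n a ↔ blockOf a i ≠ blockOf a (i + 1) := by
  have key : ∀ (a : List ℕ) (x : ℕ), (∃ k, 1 ≤ k ∧ k ≤ a.length ∧ x + 1 = (a.take k).sum) ↔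
      blockOf a x ≠ blockOf a (x + 1) := by
    intro a
    induction a with
    | nil =>
      intro x
      simp [blockOf]
    | cons c a ih =>
      intro x
      have hsplit : (∃ k, 1 ≤ k ∧ k ≤ (c :: a).length ∧ x + 1 = ((c :: a).take k).sum) ↔
          x + 1 = c ∨ ∃ k, 1 ≤ k ∧ k ≤ a.length ∧ x + 1 = c + (a.take k).sum := by
        constructor
        · rintro ⟨k, h1, h2, h3⟩
          obtain ⟨k, rfl⟩ : ∃ l, k = l + 1 := ⟨k - 1, by omega⟩
          rw [List.take_succ_cons, List.sum_cons] at h3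
          rw [List.length_cons] at h2
          rcases k with _ | k
          · left; simpa using h3
          · exact Or.inr ⟨k + 1, by omega, by omega, h3⟩
        · rintro (h | ⟨k, h1, h2, h3⟩)
          · exact ⟨1, le_rfl, by simp, by simpa using h⟩
          · refine ⟨k + 1, by omega, by rw [List.length_cons]; omega, ?_⟩
            rw [List.take_succ_cons, List.sum_cons, h3]
      rw [hsplit]
      simp only [blockOf]
      by_cases h1 : x + 1 < c
      · rw [if_pos h1, if_pos (by omega)]
        refine ⟨?_, fun h => (h rfl).elim⟩
        rintro (h | ⟨k, -, -, h⟩) <;> omega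
      · by_cases h2 : x < c
        · rw [if_neg h1, if_pos h2]
          exact ⟨fun _ => by omega, fun _ => Or.inl (by omega)⟩
        · rw [if_neg h1, if_neg h2, show x + 1 - c = x - c + 1 by omega, ne_eq,
            Nat.add_right_cancel_iff, ← ne_eq, ← ih]
          constructor
          · rintro (h | ⟨k, h3, h4, h5⟩)
            · omega
            · exact ⟨k, h3, h4, by omega⟩
          · rintro ⟨k, h3, h4, h5⟩
            exact Or.inr ⟨k, h3, h4, by omega⟩
  exact key a i

end

end

/-! ### Parabolic subalgebras and seaweeds as shapes -/

section

section

variable {K : Type*} [Field K] [CharZero K] {n : ℕ}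

theorem rootValue_single_self (i : Fin n) (hi : (i : ℕ) + 1 < n) :
    rootValue i (Pi.single i (1 : K)) = 1 := by
  have : (⟨i + 1, hi⟩ : Fin n) ≠ i := fun h => by
    have := congrArg Fin.val h
    simp at this
  simp [rootValue, hi, this]

theorem rootValue_single_succ (i : Fin n) (hi : (i : ℕ) + 1 < n) :
    rootValue i (Pi.single ⟨i + 1, hi⟩ (1 : K)) = -1 := by
  have : i ≠ (⟨i + 1, hi⟩ : Fin n) := fun h => by
    have := congrArg Fin.val h
    simp at this
  simp [rootValue, hi, this]

theorem rootValue_single_last (i : Fin n) (hi : ¬ (i : ℕ) + 1 < n) :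
    rootValue i (Pi.single i (1 : K)) = 2 := by
  simp [rootValue, hi]

theorem borelUpper_subset (a : List ℕ) {X : Mat K n} (hX : X ∈ borelUpper K n) :
    flip K n X ∈ (listShape n a []).alg K := by
  obtain ⟨hX, ht⟩ := hX
  obtain ⟨P, Q, S, hQ, hS, rfl⟩ := mem_sp_iff.mp hX
  rw [flip_flip]
  have hS0 : S = 0 := by
    ext i j
    have := ht (.inr i.rev) (.inl j) (by simp only [pos]; omega)
    rw [flip_inr_inl, Fin.rev_rev] at this
    exact this
  subst hS0
  refine Shape.blk_mem_alg.mpr ⟨hQ, hS, fun i j hij => ?_, fun i j hi => ?_, fun i j hi => rfl⟩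
  · have hlt : j < i := by
      by_contra hn
      exact hij (Or.inl ⟨not_lt.mp hn, rfl⟩)
    have := ht (.inl i) (.inl j) hlt
    rw [flip_inl_inl] at this
    exact this
  · exact (hi (Nat.zero_le _)).elim

theorem rootSpace_subset {a : List ℕ} (ha : a.sum ≤ n) {i : Fin n} (hi : i ∉ rootsOf n a)
    {X : Mat K n} (hX : X ∈ rootSpace fun H => -simpleRoot i H) :
    flip K n X ∈ (listShape n a []).alg K := by
  obtain ⟨P, Q, S, hQ, hS, rfl⟩ := mem_sp_iff.mp hX.1
  rw [flip_flip]
  rw [flip_blk_mem_rootSpace_iff hQ hS] at hX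
  simp only [simpleRoot_flip] at hX
  rw [mem_rootsOf_iff, not_not] at hi
  by_cases hin : (i : ℕ) + 1 < n
  -- Evaluating the weights at the coordinate vectors of `i` and `i + 1` excludes every entry of `P`
  -- but `(i + 1, i)`, which stays within a block of `a`, and all of `S`.
  · have h1 := hX (Pi.single i 1)
    have h2 := hX (Pi.single ⟨i + 1, hin⟩ 1)
    rw [rootValue_single_self i hin] at h1
    rw [rootValue_single_succ i hin] at h2
    refine Shape.blk_mem_alg.mpr ⟨hQ, hS, fun x y hxy => ?_, fun x y hx => ?_, fun x y hx => ?_⟩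
    · by_contra hP
      have h3 := mul_right_cancel₀ hP (h1.1 x y)
      have h4 := mul_right_cancel₀ hP (h2.1 x y)
      have hy : y = i := by
        by_contra hy
        rw [Pi.single_eq_of_ne hy, sub_zero] at h3
        by_cases hx : x = i
        · rw [hx, Pi.single_eq_same] at h3
          norm_num [eq_neg_iff_add_eq_zero] at h3
        · rw [Pi.single_eq_of_ne hx] at h3
          norm_num at h3
      have hx : x = ⟨i + 1, hin⟩ := by
        by_contra hx
        rw [Pi.single_eq_of_ne hx, zero_sub, neg_neg, neg_eq_iff_eq_neg] at h4
        by_cases hy' : y = ⟨i + 1, hin⟩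
        · rw [hy', Pi.single_eq_same] at h4
          norm_num [eq_neg_iff_add_eq_zero] at h4
        · rw [Pi.single_eq_of_ne hy'] at h4
          norm_num at h4
      subst hx hy
      exact hxy (Or.inr ⟨Nat.le_succ _, hi.symm⟩)
    · exact (hx (Nat.zero_le _)).elim
    · by_contra hP
      have h4 := mul_right_cancel₀ hP (h2.2.2 x y)
      rw [neg_neg, neg_eq_iff_eq_neg] at h4
      by_cases hx : x = ⟨i + 1, hin⟩ <;> by_cases hy : y = ⟨i + 1, hin⟩ <;>
        (simp [hx, hy, eq_neg_iff_add_eq_zero] at h4; try norm_num at h4)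
  · have h1 := hX (Pi.single i 1)
    rw [rootValue_single_last i hin] at h1
    refine Shape.blk_mem_alg.mpr ⟨hQ, hS, fun x y hxy => ?_, fun x y hx => ?_, fun x y hx => ?_⟩
    · by_contra hP
      have h4 := mul_right_cancel₀ hP (h1.1 x y)
      by_cases hx : x = i <;> by_cases hy : y = i <;>
        simp [hx, hy, eq_neg_iff_add_eq_zero] at h4 <;> norm_num at h4
    · exact (hx (Nat.zero_le _)).elim
    · by_contra hP
      have h4 := mul_right_cancel₀ hP (h1.2.2 x y)
      have hxi : x = i := by
        by_contra hx
        by_cases hy : y = i <;> simp [hx, hy] at h4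
      subst hxi
      apply hx
      -- The last root is not removed, so the positions `n - 1` and `n` are in the same block; with
      -- `a.sum ≤ n` this gives `a.sum ≤ n - 1`.
      change a.sum ≤ x
      exact sum_le_of_blockOf_eq hi.symm (by omega)

theorem parabolicUpper_le {a : List ℕ} (ha : a.sum ≤ n) {X : Mat K n}
    (hX : X ∈ parabolicUpper K n (rootsOf n a)) : flip K n X ∈ (listShape n a []).alg K := by
  have h : parabolicUpper K n (rootsOf n a) ≤
      ((listShape n a []).alg K).comap (flip K n : Mat K n →ₗ⁅K⁆ Mat K n) := by
    refine LieSubalgebra.lieSpan_le.mpr ?_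
    rintro X (hX | hX)
    · exact borelUpper_subset a hX
    · simp only [Set.mem_iUnion] at hX
      obtain ⟨i, hi, hX⟩ := hX
      exact rootSpace_subset ha hi hX
  exact h hX

/-- The elementary matrix in the upper left block. -/
def rootElt (K : Type*) [Field K] {n : ℕ} (i j : Fin n) : Mat K n := blk (Matrix.single i j 1) 0 0

/-- The symmetrized elementary matrix in the lower left block. -/
def lowElt (K : Type*) [Field K] {n : ℕ} (i j : Fin n) : Mat K n :=
  blk 0 0 (Matrix.single i j 1 + Matrix.single j i 1)

theorem lie_rootElt {x y z : Fin n} (h : x ≠ z) :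
    ⁅rootElt K x y, rootElt K y z⁆ = rootElt K x z := by
  rw [rootElt, rootElt, lie_blk Matrix.isSymm_zero Matrix.isSymm_zero Matrix.isSymm_zero
    Matrix.isSymm_zero, rootElt]
  simp [Matrix.single_mul_single_of_ne, h.symm]

theorem lie_lowElt_self {x y : Fin n} :
    ⁅lowElt K x x, rootElt K x y⁆ = (2 : K) • lowElt K x y := by
  rw [rootElt, lowElt, lie_blk Matrix.isSymm_zero (isSymm_single_add_single x x) Matrix.isSymm_zero
    Matrix.isSymm_zero, lowElt, blk_smul]
  refine blk_inj.mpr ⟨by simp, by simp, ?_⟩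
  simp [add_mul, two_smul]

theorem lie_lowElt {x y z : Fin n} (h : y ≠ x) :
    ⁅lowElt K x y, rootElt K x z⁆ = lowElt K z y := by
  rw [rootElt, lowElt, lie_blk Matrix.isSymm_zero (isSymm_single_add_single x y) Matrix.isSymm_zero
    Matrix.isSymm_zero, lowElt]
  refine blk_inj.mpr ⟨by simp, by simp, ?_⟩
  simp [add_mul, Matrix.single_mul_single_of_ne, h]
  abel

theorem flip_mem_borelUpper {P Q : Matrix (Fin n) (Fin n) K} (hQ : Q.IsSymm)
    (hP : ∀ i j, j < i → P i j = 0) : flip K n (blk P Q 0) ∈ borelUpper K n := by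
  refine ⟨flip_blk_mem_sp hQ Matrix.isSymm_zero, ?_⟩
  rintro (i | i) (j | j) hij
  · rw [flip_inl_inl]; exact hP i j hij
  · simp only [pos] at hij; omega
  · rw [flip_inr_inl]; rfl
  · rw [flip_inr_inr]
    simp only [pos] at hij
    simp only [blk, Matrix.fromBlocks_apply₂₂, Matrix.neg_apply, Matrix.transpose_apply]
    rw [hP, neg_zero]
    exact Fin.rev_lt_rev.mpr (by rw [Fin.lt_def]; omega)

theorem flip_rootElt_mem_rootSpace (i : Fin n) (hi : (i : ℕ) + 1 < n) :
    flip K n (rootElt K ⟨i + 1, hi⟩ i) ∈ rootSpace fun H => -simpleRoot i H := by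
  refine (flip_blk_mem_rootSpace_iff Matrix.isSymm_zero Matrix.isSymm_zero).mpr fun h => ⟨?_, ?_, ?_⟩
  · intro x y
    rw [simpleRoot_flip, rootValue, dif_pos hi, Matrix.single_apply]
    split_ifs with hxy
    · rw [← hxy.1, ← hxy.2]; ring
    · simp
  · simp
  · simp

theorem flip_lowElt_mem_rootSpace (i : Fin n) (hi : ¬ (i : ℕ) + 1 < n) :
    flip K n (lowElt K i i) ∈ rootSpace fun H => -simpleRoot i H := by
  refine (flip_blk_mem_rootSpace_iff Matrix.isSymm_zero (isSymm_single_add_single i i)).mpr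
    fun h => ⟨?_, ?_, ?_⟩
  · simp
  · simp
  · intro x y
    rw [simpleRoot_flip, rootValue, dif_neg hi, Matrix.add_apply, Matrix.single_apply]
    split_ifs with hxy
    · rw [← hxy.1, ← hxy.2]; ring
    · simp

/-- The parabolic subalgebra in the coordinates given by `flip`. -/
def flipParabolic (K : Type*) [Field K] (n : ℕ) (Ψ : Set (Fin n)) : LieSubalgebra K (Mat K n) :=
  (parabolicUpper K n Ψ).comap (flip K n : Mat K n →ₗ⁅K⁆ Mat K n)

/-- Below the diagonal, entries within a block are iterated brackets of root vectors of consecutive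
`-αᵢ`, none of them removed inside the block. -/
theorem rootElt_mem {a : List ℕ} {x y : Fin n} (h : listRel a [] x y) :
    rootElt K x y ∈ flipParabolic K n (rootsOf n a) := by
  rcases h with ⟨h, -⟩ | ⟨h, hb⟩
  · refine LieSubalgebra.subset_lieSpan (Or.inl (flip_mem_borelUpper Matrix.isSymm_zero ?_))
    intro i j hij
    rw [Matrix.single_apply_of_ne]
    rintro ⟨rfl, rfl⟩
    exact absurd h (not_le.mpr hij)
  · obtain ⟨l, hl⟩ : ∃ l, (x : ℕ) = y + l := ⟨x - y, by omega⟩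
    induction l generalizing x with
    | zero =>
      obtain rfl : x = y := Fin.ext hl
      refine LieSubalgebra.subset_lieSpan (Or.inl (flip_mem_borelUpper Matrix.isSymm_zero ?_))
      intro i j hij
      rw [Matrix.single_apply_of_ne]
      rintro ⟨rfl, rfl⟩
      exact lt_irrefl _ hij
    | succ l ih =>
      let z : Fin n := ⟨y + l, by omega⟩
      have hz : (z : ℕ) + 1 < n := by change (y : ℕ) + l + 1 < n; omega
      have hx : x = ⟨z + 1, hz⟩ := Fin.ext hl
      have hzx : (z : ℕ) ≤ x := by change (y : ℕ) + l ≤ x; omega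
      have hyz : (y : ℕ) ≤ z := Nat.le_add_right _ _
      have hbz := blockOf_eq_of_le hb.symm hyz hzx
      have h1 : rootElt K x z ∈ flipParabolic K n (rootsOf n a) := by
        refine LieSubalgebra.subset_lieSpan (Or.inr ?_)
        simp only [Set.mem_iUnion]
        refine ⟨z, ?_, ?_⟩
        · rw [Set.mem_compl_iff, mem_rootsOf_iff, not_not, hbz.2, hx]
        · rw [hx]; exact flip_rootElt_mem_rootSpace z hz
      have h2 := ih (x := z) hyz hbz.1.symm rfl
      rw [← lie_rootElt (y := z) (fun he : x = y => by rw [he] at hl; omega)]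
      exact LieSubalgebra.lie_mem _ h1 h2

/-- As `a.sum < n` here, the last root is not removed. Brackets with `rootElt` move its root vector,
at the last position, to any pair beyond `a.sum`, one index at a time. -/
theorem lowElt_mem {a : List ℕ} {x y : Fin n} (hx : a.sum ≤ x) (hy : a.sum ≤ y) :
    lowElt K x y ∈ flipParabolic K n (rootsOf n a) := by
  let z : Fin n := ⟨n - 1, by omega⟩
  have hzn : (z : ℕ) = n - 1 := rfl
  have hz : lowElt K z z ∈ flipParabolic K n (rootsOf n a) := by
    refine LieSubalgebra.subset_lieSpan (Or.inr ?_)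
    simp only [Set.mem_iUnion]
    refine ⟨z, ?_, flip_lowElt_mem_rootSpace z (by omega)⟩
    rw [Set.mem_compl_iff, mem_rootsOf_iff, not_not]
    exact blockOf_eq_of_sum_le (by omega) (by omega)
  have hroot : ∀ w : Fin n, a.sum ≤ w → rootElt K z w ∈ flipParabolic K n (rootsOf n a) :=
    fun w hw => rootElt_mem (Or.inr ⟨by omega, blockOf_eq_of_sum_le (by omega) hw⟩)
  have hzw : ∀ w : Fin n, a.sum ≤ w → lowElt K z w ∈ flipParabolic K n (rootsOf n a) :=
    fun w hw => by
      have h1 := LieSubalgebra.lie_mem _ hz (hroot w hw)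
      rw [lie_lowElt_self] at h1
      have h2 := (flipParabolic K n (rootsOf n a)).smul_mem (2⁻¹ : K) h1
      rwa [smul_smul, inv_mul_cancel₀ two_ne_zero, one_smul] at h2
  by_cases hyz : y = z
  · have : lowElt K x y = lowElt K y x := by rw [lowElt, lowElt, add_comm]
    rw [this, hyz]; exact hzw x hx
  · rw [← lie_lowElt hyz]
    exact LieSubalgebra.lie_mem _ (hzw y hy) (hroot x hx)

/-- One inclusion is checked on generators. For the other, `Q` lies in the Borel subalgebra, and the
rest is a combination of elementary elements obtained by brackets. -/
theorem mem_parabolicUpper_iff {a : List ℕ} (ha : a.sum ≤ n) {X : Mat K n} :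
    X ∈ parabolicUpper K n (rootsOf n a) ↔ flip K n X ∈ (listShape n a []).alg K := by
  refine ⟨parabolicUpper_le ha, fun hX => ?_⟩
  suffices h : flip K n X ∈ flipParabolic K n (rootsOf n a) by
    have h' : flip K n (flip K n X) ∈ parabolicUpper K n (rootsOf n a) := h
    rwa [flip_flip] at h'
  generalize flip K n X = Y at hX
  obtain ⟨P, Q, S, hm, rfl⟩ := hX
  have hsum : blk P Q S = blk 0 Q 0 + (∑ i, ∑ j, P i j • rootElt K i j) +
      ∑ i, ∑ j, (2⁻¹ * S i j) • lowElt K i j := by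
    have h1 : ∑ i, ∑ j, P i j • rootElt K i j = blk P 0 0 := by
      let f : Matrix (Fin n) (Fin n) K →ₗ[K] Mat K n :=
        { toFun := fun P => blk P 0 0
          map_add' := fun P P' => by rw [blk_add, add_zero]
          map_smul' := fun c P => by rw [RingHom.id_apply, blk_smul, smul_zero] }
      change _ = f P
      conv_rhs => rw [Matrix.matrix_eq_sum_single P]
      simp only [map_sum]
      refine Finset.sum_congr rfl fun i _ => Finset.sum_congr rfl fun j _ => ?_
      change P i j • f (Matrix.single i j 1) = _
      rw [← map_smul, Matrix.smul_single, smul_eq_mul, mul_one]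
    -- Off the diagonal each pair occurs twice in the sum, and on it `lowElt` is already doubled;
    -- hence the factor `2⁻¹`.
    have h2 : ∑ i, ∑ j, (2⁻¹ * S i j) • lowElt K i j = blk 0 0 S := by
      let f : Matrix (Fin n) (Fin n) K →ₗ[K] Mat K n :=
        { toFun := fun S => blk 0 0 S
          map_add' := fun P P' => by rw [blk_add, add_zero]
          map_smul' := fun c P => by rw [RingHom.id_apply, blk_smul, smul_zero] }
      have h3 : ∀ i j, (2⁻¹ * S i j) • lowElt K i j = (2⁻¹ : K) •
          (f (Matrix.single i j (S i j)) + f (Matrix.single j i (S j i))) := fun i j => by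
        change (2⁻¹ * S i j) • f (Matrix.single i j 1 + Matrix.single j i 1) = _
        rw [← map_add, ← map_smul, ← map_smul, hm.symmS.apply i j, smul_add, smul_add]
        simp only [Matrix.smul_single, smul_eq_mul, mul_one]
      have h4 : ∑ i, ∑ j, f (Matrix.single i j (S i j)) = f S := by
        conv_rhs => rw [Matrix.matrix_eq_sum_single S]
        simp only [map_sum]
      simp only [h3, ← Finset.smul_sum, Finset.sum_add_distrib]
      rw [Finset.sum_comm (f := fun i j => f (Matrix.single j i (S j i))), h4, ← two_smul K,
        smul_smul, inv_mul_cancel₀ two_ne_zero, one_smul]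
      rfl
    rw [h1, h2, blk_add, blk_add]
    simp
  rw [hsum]
  refine add_mem (add_mem ?_ (sum_mem fun i _ => sum_mem fun j _ => ?_))
    (sum_mem fun i _ => sum_mem fun j _ => ?_)
  · exact LieSubalgebra.subset_lieSpan
      (Or.inl (flip_mem_borelUpper hm.symmQ fun _ _ _ => rfl))
  · by_cases hij : listRel a [] i j
    · exact LieSubalgebra.smul_mem _ _ (rootElt_mem hij)
    · rw [hm.supp i j hij, zero_smul]; exact zero_mem _
  · by_cases hi : a.sum ≤ i
    · by_cases hj : a.sum ≤ j
      · exact LieSubalgebra.smul_mem _ _ (lowElt_mem hi hj)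
      · rw [hm.suppS' i j hj, mul_zero, zero_smul]; exact zero_mem _
    · rw [hm.suppS i j hi, mul_zero, zero_smul]; exact zero_mem _

/-- The automorphism `X ↦ -Xᵀ` of the Lie algebra of matrices. -/
def negTranspose (K : Type*) [Field K] (n : ℕ) : Mat K n →ₗ⁅K⁆ Mat K n where
  toFun X := -X.transpose
  map_add' X Y := by rw [Matrix.transpose_add, neg_add]
  map_smul' c X := by rw [Matrix.transpose_smul, smul_neg, RingHom.id_apply]
  map_lie' {X Y} := by
    simp only [Ring.lie_def, Matrix.transpose_sub, Matrix.transpose_mul]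
    noncomm_ring

theorem negTranspose_apply (X : Mat K n) : negTranspose K n X = -X.transpose := rfl

theorem negTranspose_negTranspose (X : Mat K n) : negTranspose K n (negTranspose K n X) = X := by
  simp [negTranspose_apply]

theorem flip_negTranspose (X : Mat K n) :
    flip K n (negTranspose K n X) = negTranspose K n (flip K n X) := by
  rw [flip_apply, flip_apply]; rfl

theorem negTranspose_mem_sp {X : Mat K n} (hX : X ∈ sp K n) : negTranspose K n X ∈ sp K n := by
  obtain ⟨P, Q, S, hQ, hS, rfl⟩ := mem_sp_iff.mp hX
  refine mem_sp_iff.mpr ⟨-P.transpose, -S, -Q, hS.neg, hQ.neg, ?_⟩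
  rw [← flip_negTranspose, flip_inj, negTranspose_apply, blk, Matrix.fromBlocks_transpose,
    Matrix.fromBlocks_neg, blk]
  simp [hQ.eq, hS.eq]

theorem negTranspose_mem_rootSpace {β : Mat K n → K} {X : Mat K n} (hX : X ∈ rootSpace β) :
    negTranspose K n X ∈ rootSpace fun H => -β H := by
  refine ⟨negTranspose_mem_sp hX.1, fun H hH => ?_⟩
  have hH' : negTranspose K n H = -H := by
    rw [negTranspose_apply, hH.2.isSymm.eq]
  have h1 := congrArg (negTranspose K n) (hX.2 H hH)
  rw [LieHom.map_lie, hH', neg_lie, map_smul] at h1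
  rw [neg_smul, ← h1, neg_neg]

/-- `X ↦ -Xᵀ` exchanges upper and lower triangular matrices and negates roots, so it matches the
generators. -/
theorem mem_parabolicLower_iff {Ψ : Set (Fin n)} {X : Mat K n} :
    X ∈ parabolicLower K n Ψ ↔ negTranspose K n X ∈ parabolicUpper K n Ψ := by
  have h₁ : parabolicLower K n Ψ ≤ (parabolicUpper K n Ψ).comap (negTranspose K n) := by
    refine LieSubalgebra.lieSpan_le.mpr ?_
    rintro X (hX | hX)
    · refine LieSubalgebra.subset_lieSpan (Or.inl ⟨negTranspose_mem_sp hX.1, fun p q hpq => ?_⟩)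
      change -X q p = 0
      rw [hX.2 q p hpq, neg_zero]
    · refine LieSubalgebra.subset_lieSpan (Or.inr ?_)
      simp only [Set.mem_iUnion] at hX ⊢
      obtain ⟨i, hi, hX⟩ := hX
      exact ⟨i, hi, negTranspose_mem_rootSpace hX⟩
  have h₂ : parabolicUpper K n Ψ ≤ (parabolicLower K n Ψ).comap (negTranspose K n) := by
    refine LieSubalgebra.lieSpan_le.mpr ?_
    rintro X (hX | hX)
    · refine LieSubalgebra.subset_lieSpan (Or.inl ⟨negTranspose_mem_sp hX.1, fun p q hpq => ?_⟩)
      change -X q p = 0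
      rw [hX.2 q p hpq, neg_zero]
    · refine LieSubalgebra.subset_lieSpan (Or.inr ?_)
      simp only [Set.mem_iUnion] at hX ⊢
      obtain ⟨i, hi, hX⟩ := hX
      have := negTranspose_mem_rootSpace hX
      simp only [neg_neg] at this
      exact ⟨i, hi, this⟩
  refine ⟨fun hX => h₁ hX, fun hX => ?_⟩
  have : negTranspose K n (negTranspose K n X) ∈ parabolicLower K n Ψ := h₂ hX
  rwa [negTranspose_negTranspose] at this

theorem mem_seaweed_iff {a b : List ℕ} (ha : a.sum ≤ n) (hb : b.sum ≤ n) {X : Mat K n} :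
    X ∈ seaweed K n a b ↔ flip K n X ∈ (listShape n a b).alg K := by
  have hneg : ∀ Y : Mat K n, negTranspose K n Y ∈ (listShape n b []).alg K ↔
      Y ∈ (listShape n [] b).alg K := fun Y => by
    rw [← listShape_op n b []]
    constructor
    · intro h
      have := Shape.neg_transpose_mem_op h
      simpa [negTranspose_apply] using this
    · intro h
      have := Shape.neg_transpose_mem_op h
      exact this
  rw [seaweed, LieSubalgebra.mem_inf, mem_parabolicLower_iff, mem_parabolicUpper_iff ha,
    mem_parabolicUpper_iff hb, flip_negTranspose, hneg]
  constructor
  · rintro ⟨⟨P, Q, S, hm, he⟩, h⟩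
    rw [he] at h ⊢
    have hm' := Shape.blk_mem_alg.mp h
    refine Shape.blk_mem_alg.mpr ⟨hm.symmQ, hm.symmS, fun i j hij => ?_, hm'.suppQ, hm.suppS⟩
    by_contra hne
    have h1 : listRel a [] i j := by
      by_contra hn; exact hne (hm.supp i j hn)
    have h2 : listRel [] b i j := by
      by_contra hn; exact hne (hm'.supp i j hn)
    refine hij ?_
    rcases h1 with h1 | h1
    · rcases h2 with h2 | h2
      · exact Or.inl h2
      -- The position is on or above the diagonal for one parabolic and on or below it for the
      -- other, so `i = j`.
      · exact Or.inl ⟨h1.1, by rw [le_antisymm h1.1 h2.1]⟩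
    · exact Or.inr h1
  · rintro ⟨P, Q, S, hm, he⟩
    rw [he]
    refine ⟨Shape.blk_mem_alg.mpr ⟨hm.symmQ, hm.symmS, fun i j hij => ?_, fun i _ hi => ?_,
      hm.suppS⟩, Shape.blk_mem_alg.mpr ⟨hm.symmQ, hm.symmS, fun i j hij => ?_, hm.suppQ,
      fun i _ hi => ?_⟩⟩
    · exact hm.supp i j fun h => hij (h.imp (fun h => ⟨h.1, rfl⟩) id)
    · exact (hi (Nat.zero_le _)).elim
    · exact hm.supp i j fun h => hij (h.imp id fun h => ⟨h.1, rfl⟩)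
    · exact (hi (Nat.zero_le _)).elim

theorem index_seaweed {a b : List ℕ} (ha : a.sum ≤ n) (hb : b.sum ≤ n) :
    index K (seaweed K n a b) = listIndex K n a b := by
  refine index_congr (LieEquiv.ofSubalgebras _ _ (flip K n) ?_)
  ext Y
  rw [LieSubalgebra.mem_map]
  constructor
  · rintro ⟨X, hX, rfl⟩
    exact (mem_seaweed_iff ha hb).mp hX
  · intro hY
    refine ⟨flip K n Y, (mem_seaweed_iff ha hb).mpr ?_, flip_flip Y⟩
    rwa [flip_flip]

end

end

section

/-! ### Products of two involutions -/

section involutions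

variable {α : Type*} [Finite α] {t b : Equiv.Perm α}

/-- The orbit of `x` under the group generated by the involutions `t` and `b`. -/
def dihedralOrbit (t b : Equiv.Perm α) (x : α) : Set α :=
  {y | (t * b).SameCycle x y ∨ (t * b).SameCycle (b x) y}

theorem apply_apply_of_mul_self (hb : b * b = 1) (x : α) : b (b x) = x := by
  rw [← Equiv.Perm.mul_apply, hb, Equiv.Perm.one_apply]

/-- Conjugation by `b` inverts `t * b`, and a permutation and its inverse have the same cycles. -/
theorem sameCycle_apply_apply (ht : t * t = 1) (hb : b * b = 1) {x y : α} :
    (t * b).SameCycle (b x) (b y) ↔ (t * b).SameCycle x y := by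
  have hb' : b⁻¹ = b := inv_eq_of_mul_eq_one_left hb
  have ht' : t⁻¹ = t := inv_eq_of_mul_eq_one_left ht
  have h : b * (t * b) * b⁻¹ = (t * b)⁻¹ := by
    rw [mul_inv_rev, hb', ht', mul_assoc, mul_assoc, hb, mul_one]
  have h1 := Equiv.Perm.sameCycle_conj (f := t * b) (g := b) (x := x) (y := y)
  rw [h, Equiv.Perm.sameCycle_inv, hb'] at h1
  exact h1.symm

theorem sameCycle_left_right (hb : b * b = 1) (x : α) : (t * b).SameCycle (b x) (t x) := by
  have : (t * b) (b x) = t x := by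
    rw [Equiv.Perm.mul_apply, apply_apply_of_mul_self hb]
  rw [← this]
  exact Equiv.Perm.sameCycle_apply_right.mpr (Equiv.Perm.SameCycle.refl _ _)

theorem self_mem_dihedralOrbit (x : α) : x ∈ dihedralOrbit t b x :=
  Or.inl (Equiv.Perm.SameCycle.refl _ _)

theorem mem_dihedralOrbit_of_sameCycle {x y z : α} (h : y ∈ dihedralOrbit t b x)
    (hyz : (t * b).SameCycle y z) : z ∈ dihedralOrbit t b x :=
  h.imp (fun h => h.trans hyz) fun h => h.trans hyz

theorem right_mem_dihedralOrbit (ht : t * t = 1) (hb : b * b = 1) {x y : α}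
    (h : y ∈ dihedralOrbit t b x) : b y ∈ dihedralOrbit t b x := by
  rcases h with h | h
  · exact Or.inr ((sameCycle_apply_apply ht hb).mpr h)
  · left
    rw [← sameCycle_apply_apply ht hb, apply_apply_of_mul_self hb]
    exact h

theorem left_mem_dihedralOrbit (ht : t * t = 1) (hb : b * b = 1) {x y : α}
    (h : y ∈ dihedralOrbit t b x) : t y ∈ dihedralOrbit t b x :=
  mem_dihedralOrbit_of_sameCycle (right_mem_dihedralOrbit ht hb h) (sameCycle_left_right hb y)

theorem mem_dihedralOrbit_symm (ht : t * t = 1) (hb : b * b = 1) {x y : α}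
    (h : y ∈ dihedralOrbit t b x) : x ∈ dihedralOrbit t b y := by
  rcases h with h | h
  · exact Or.inl h.symm
  · right
    rw [← sameCycle_apply_apply ht hb, apply_apply_of_mul_self hb]
    exact h.symm

theorem mem_dihedralOrbit_trans (ht : t * t = 1) (hb : b * b = 1) {x y z : α}
    (hxy : y ∈ dihedralOrbit t b x) (hyz : z ∈ dihedralOrbit t b y) : z ∈ dihedralOrbit t b x := by
  rcases hyz with h | h
  · exact mem_dihedralOrbit_of_sameCycle hxy h
  · exact mem_dihedralOrbit_of_sameCycle (right_mem_dihedralOrbit ht hb hxy) h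

theorem dihedralOrbit_eq (ht : t * t = 1) (hb : b * b = 1) {x y : α}
    (h : y ∈ dihedralOrbit t b x) : dihedralOrbit t b x = dihedralOrbit t b y := by
  ext z
  exact ⟨mem_dihedralOrbit_trans ht hb (mem_dihedralOrbit_symm ht hb h),
    mem_dihedralOrbit_trans ht hb h⟩

/-- The orbit of `x` consists of two cycles of `t * b`. -/
def IsSplit (t b : Equiv.Perm α) (x : α) : Prop := ¬ (t * b).SameCycle x (b x)

theorem isSplit_congr (ht : t * t = 1) (hb : b * b = 1) {x y : α} (h : y ∈ dihedralOrbit t b x) :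
    IsSplit t b x ↔ IsSplit t b y := by
  rw [IsSplit, IsSplit, not_iff_not]
  rcases h with h | h
  · have h' := (sameCycle_apply_apply ht hb).mpr h
    exact ⟨fun h1 => h.symm.trans (h1.trans h'), fun h1 => h.trans (h1.trans h'.symm)⟩
  · have h' := (sameCycle_apply_apply ht hb).mpr h
    rw [apply_apply_of_mul_self hb] at h'
    exact ⟨fun h1 => h.symm.trans (h1.symm.trans h'), fun h1 => h'.trans (h1.symm.trans h.symm)⟩

theorem dihedralOrbit_of_not_isSplit {x : α} (h : ¬ IsSplit t b x) :
    dihedralOrbit t b x = {y | (t * b).SameCycle x y} := by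
  ext y
  rw [IsSplit, not_not] at h
  exact ⟨fun hy => hy.elim id fun hy => h.trans hy, Or.inl⟩

/-- An orbit splits if and only if it contains no fixed point of either involution. -/
theorem isSplit_iff (ht : t * t = 1) (hb : b * b = 1) {x : α} :
    IsSplit t b x ↔ ∀ y ∈ dihedralOrbit t b x, t y ≠ y ∧ b y ≠ y := by
  constructor
  · intro h y hy
    rw [isSplit_congr ht hb hy] at h
    refine ⟨fun h1 => h ?_, fun h1 => h ?_⟩
    · have := sameCycle_left_right (t := t) hb y
      rw [h1] at this
      exact this.symm
    · rw [h1]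
  -- If `(t * b) ^ k` sends `x` to `b x`, the middle of this path is a fixed point: of `b` for even
  -- `k`, of `t` for odd `k`.
  · rintro h ⟨k, hk⟩
    have hb' : b⁻¹ = b := inv_eq_of_mul_eq_one_left hb
    have ht' : t⁻¹ = t := inv_eq_of_mul_eq_one_left ht
    have hconj : ∀ l : ℤ, b * (t * b) ^ l = (t * b) ^ (-l) * b := fun l => by
      have h1 : b * (t * b) * b⁻¹ = (t * b)⁻¹ := by
        rw [mul_inv_rev, hb', ht', mul_assoc, mul_assoc, hb, mul_one]
      rw [zpow_neg, ← inv_zpow, ← h1, conj_zpow]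
      simp
    have hmem : ∀ l : ℤ, ((t * b) ^ l) x ∈ dihedralOrbit t b x := fun l => Or.inl ⟨l, rfl⟩
    have hbl : ∀ l : ℤ, b (((t * b) ^ l) x) = ((t * b) ^ (-l + k)) x := fun l => by
      rw [← Equiv.Perm.mul_apply, hconj, Equiv.Perm.mul_apply, ← hk, zpow_add,
        Equiv.Perm.mul_apply]
    rcases Int.even_or_odd' k with ⟨l, rfl | rfl⟩
    · refine (h _ (hmem l)).2 ?_
      rw [hbl, show -l + 2 * l = l by ring]
    · refine (h _ (hmem (l + 1))).1 ?_
      have h1 := hbl (l + 1)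
      rw [show -(l + 1) + (2 * l + 1) = l by ring] at h1
      have h2 : t (b (((t * b) ^ l) x)) = ((t * b) ^ (l + 1)) x := by
        rw [add_comm, zpow_one_add]
        rfl
      rw [← h1] at h2
      rw [apply_apply_of_mul_self hb] at h2
      exact h2

/-- A split orbit misses `T`, so its two cycles both count: one for the orbit itself and one for the
first summand. A nonsplit orbit is a single cycle and counts on both sides under the same condition.
-/
theorem cycleCount_eq_add (ht : t * t = 1) (hb : b * b = 1) {T : Set α}
    (hT : ∀ y ∈ T, t y = y ∨ b y = y) :
    cycleCount (t * b) T = (dihedralOrbit t b '' {x | IsSplit t b x}).ncard +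
      {S ∈ Set.range (dihedralOrbit t b) | (S ∩ T).ncard = 0 ∨ (S ∩ T).ncard = 2}.ncard := by
  classical
  let cyc : α → Set α := fun x => {y | (t * b).SameCycle x y}
  have hcyc : ∀ {x y}, cyc x = cyc y ↔ (t * b).SameCycle x y := setOf_sameCycle_eq_iff
  have hself : ∀ x, x ∈ cyc x := fun x => Equiv.Perm.SameCycle.refl _ _
  let N : Set (Set α) := {S | ∃ x, ¬ IsSplit t b x ∧ S = cyc x ∧
    ((S ∩ T).ncard = 0 ∨ (S ∩ T).ncard = 2)}
  let P : Set (Set α) := cyc '' {x | IsSplit t b x}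
  let P' : Set (Set α) := dihedralOrbit t b '' {x | IsSplit t b x}
  have hempty : ∀ x, IsSplit t b x → dihedralOrbit t b x ∩ T = ∅ := fun x hx => by
    rw [Set.eq_empty_iff_forall_notMem]
    rintro y ⟨hy, hyT⟩
    have := (isSplit_iff ht hb).mp hx y hy
    exact (hT y hyT).elim this.1 this.2
  have hsub : ∀ x, cyc x ⊆ dihedralOrbit t b x := fun x y hy => Or.inl hy
  have h₁ : {S ∈ permCycles (t * b) | (S ∩ T).ncard = 0 ∨ (S ∩ T).ncard = 2} = N ∪ P := by
    ext S
    constructor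
    · rintro ⟨⟨x, rfl⟩, h⟩
      by_cases hx : IsSplit t b x
      · exact Or.inr ⟨x, hx, rfl⟩
      · exact Or.inl ⟨x, hx, rfl, h⟩
    · rintro (⟨x, hx, rfl, h⟩ | ⟨x, hx, rfl⟩)
      · exact ⟨⟨x, rfl⟩, h⟩
      · refine ⟨⟨x, rfl⟩, Or.inl ?_⟩
        rw [Set.subset_empty_iff.mp ((Set.inter_subset_inter_left T (hsub x)).trans
          (hempty x hx).subset), Set.ncard_empty]
  have h₂ : {S ∈ Set.range (dihedralOrbit t b) | (S ∩ T).ncard = 0 ∨ (S ∩ T).ncard = 2} =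
      N ∪ P' := by
    ext S
    constructor
    · rintro ⟨⟨x, rfl⟩, h⟩
      by_cases hx : IsSplit t b x
      · exact Or.inr ⟨x, hx, rfl⟩
      · exact Or.inl ⟨x, hx, dihedralOrbit_of_not_isSplit hx, h⟩
    · rintro (⟨x, hx, rfl, h⟩ | ⟨x, hx, rfl⟩)
      · exact ⟨⟨x, dihedralOrbit_of_not_isSplit hx⟩, h⟩
      · refine ⟨⟨x, rfl⟩, Or.inl ?_⟩
        rw [hempty x hx, Set.ncard_empty]
  have hd₁ : Disjoint N P := by
    rw [Set.disjoint_left]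
    rintro _ ⟨x, hx, rfl, -⟩ ⟨y, hy, he⟩
    exact hx ((isSplit_congr ht hb (Or.inl (hcyc.mp he))).mp hy)
  have hd₂ : Disjoint N P' := by
    rw [Set.disjoint_left]
    rintro _ ⟨x, hx, rfl, -⟩ ⟨y, hy, he⟩
    have : x ∈ dihedralOrbit t b y := by rw [he]; exact hself x
    exact hx ((isSplit_congr ht hb this).mp hy)
  -- A base point in each split orbit; the two cycles of the orbit are those of `m S` and `b (m S)`.
  choose m hm using fun S : P' => S.2
  have hmo : ∀ S : P', dihedralOrbit t b (m S) = S := fun S => (hm S).2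
  have hP : P = Set.range (fun S : P' => cyc (m S)) ∪ Set.range fun S : P' => cyc (b (m S)) := by
    ext S
    constructor
    · rintro ⟨x, hx, rfl⟩
      let S : P' := ⟨dihedralOrbit t b x, x, hx, rfl⟩
      have hxS : x ∈ dihedralOrbit t b (m S) := by
        rw [hmo]; exact self_mem_dihedralOrbit x
      rcases hxS with h | h
      · exact Or.inl ⟨S, hcyc.mpr h⟩
      · exact Or.inr ⟨S, hcyc.mpr h⟩
    · rintro (⟨S, rfl⟩ | ⟨S, rfl⟩)
      · exact ⟨m S, (hm S).1, rfl⟩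
      · exact ⟨b (m S), (isSplit_congr ht hb (right_mem_dihedralOrbit ht hb
          (self_mem_dihedralOrbit _))).mp (hm S).1, rfl⟩
  have hinj₁ : Function.Injective fun S : P' => cyc (m S) := fun S S' h => by
    have : m S' ∈ dihedralOrbit t b (m S) := Or.inl (hcyc.mp h)
    exact Subtype.ext (by rw [← hmo S, ← hmo S', dihedralOrbit_eq ht hb this])
  have hinj₂ : Function.Injective fun S : P' => cyc (b (m S)) := fun S S' h => by
    have : m S' ∈ dihedralOrbit t b (m S) :=
      Or.inl ((sameCycle_apply_apply ht hb).mp (hcyc.mp h))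
    exact Subtype.ext (by rw [← hmo S, ← hmo S', dihedralOrbit_eq ht hb this])
  have hdis : Disjoint (Set.range fun S : P' => cyc (m S))
      (Set.range fun S : P' => cyc (b (m S))) := by
    rw [Set.disjoint_left]
    rintro _ ⟨S, rfl⟩ ⟨S', h⟩
    have h1 : (t * b).SameCycle (b (m S')) (m S) := hcyc.mp h
    have h2 : m S ∈ dihedralOrbit t b (m S') := Or.inr h1
    obtain rfl : S = S' := Subtype.ext (by rw [← hmo S, ← hmo S', dihedralOrbit_eq ht hb h2])
    exact (hm S).1 h1.symm
  have hcard : P.ncard = P'.ncard + P'.ncard := by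
    rw [hP, Set.ncard_union_eq hdis, ← Set.image_univ, ← Set.image_univ,
      Set.ncard_image_of_injective _ hinj₁, Set.ncard_image_of_injective _ hinj₂, Set.ncard_univ,
      Nat.card_coe_set_eq]
  rw [cycleCount, h₁, h₂, Set.ncard_union_eq hd₁, Set.ncard_union_eq hd₂, hcard]
  change _ = P'.ncard + _
  omega

end involutions

end

section

/-! ### Components and cycles of a meander -/

theorem dihedralOrbit_subset {α : Type*} [Finite α] {t b : Equiv.Perm α} {S : Set α}
    (ht : ∀ y ∈ S, t y ∈ S) (hb : ∀ y ∈ S, b y ∈ S) {x : α} (hx : x ∈ S) :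
    dihedralOrbit t b x ⊆ S := by
  have key : ∀ z ∈ S, ∀ y, (t * b).SameCycle z y → y ∈ S := by
    intro z hz y hy
    obtain ⟨k, rfl⟩ := hy.exists_nat_pow_eq
    clear hy
    induction k with
    | zero => exact hz
    | succ k ih =>
      rw [pow_succ', Equiv.Perm.mul_apply, Equiv.Perm.mul_apply]
      exact ht _ (hb _ ih)
  rintro y (hy | hy)
  · exact key x hx y hy
  · exact key _ (hb x hx) y hy

variable {n : ℕ} {a b : List ℕ}

theorem arc_iff {j k : Fin n} : Arc a j k ↔ j ≠ k ∧ arcPerm n a j = k := by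
  refine ⟨fun h => ⟨h.1, partner_of_arc h⟩, ?_⟩
  rintro ⟨hne, rfl⟩
  change Arc a j (partner a j)
  change j ≠ partner a j at hne
  by_cases h : ∃ k, Arc a j k
  · rw [partner_of_arc h.choose_spec]
    exact h.choose_spec
  · exact absurd (by rw [partner, dif_neg h]) hne

/-- The involution that exchanges the ends of each edge of a given colour of a meander. -/
def colourPerm (n : ℕ) (a b : List ℕ) (c : Bool) : Equiv.Perm (Fin n) :=
  arcPerm n (if c then a else b)

theorem colourPerm_mem_dihedralOrbit {x y : Fin n}
    (h : y ∈ dihedralOrbit (arcPerm n a) (arcPerm n b) x) (c : Bool) :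
    colourPerm n a b c y ∈ dihedralOrbit (arcPerm n a) (arcPerm n b) x := by
  cases c
  · exact right_mem_dihedralOrbit (arcPerm_mul_self n a) (arcPerm_mul_self n b) h
  · exact left_mem_dihedralOrbit (arcPerm_mul_self n a) (arcPerm_mul_self n b) h

theorem meander_isLink_iff {e : Bool × Sym2 (Fin n)} {x y : Fin n} :
    (meander n a b).IsLink e x y ↔
      e = (e.1, s(x, y)) ∧ x ≠ y ∧ colourPerm n a b e.1 x = y := by
  rw [colourPerm, ← arc_iff]
  exact and_congr_left fun _ => ⟨fun h => Prod.ext rfl h, fun h => congrArg Prod.snd h⟩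

theorem meander_inc_iff {e : Bool × Sym2 (Fin n)} {x : Fin n} :
    (meander n a b).Inc e x ↔
      e = (e.1, s(x, colourPerm n a b e.1 x)) ∧ colourPerm n a b e.1 x ≠ x := by
  constructor
  · rintro ⟨y, hy⟩
    obtain ⟨h1, h2, rfl⟩ := meander_isLink_iff.mp hy
    exact ⟨h1, h2.symm⟩
  · rintro ⟨h1, h2⟩
    exact ⟨_, meander_isLink_iff.mpr ⟨h1, h2.symm, rfl⟩⟩

theorem meander_isLink_colourPerm {c : Bool} {x : Fin n} (h : colourPerm n a b c x ≠ x) :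
    (meander n a b).IsLink (c, s(x, colourPerm n a b c x)) x (colourPerm n a b c x) :=
  meander_isLink_iff.mpr ⟨rfl, h.symm, rfl⟩

theorem mem_dihedralOrbit_of_isLink {e : Bool × Sym2 (Fin n)} {x y z : Fin n}
    (hx : y ∈ dihedralOrbit (arcPerm n a) (arcPerm n b) x) (h : (meander n a b).IsLink e y z) :
    z ∈ dihedralOrbit (arcPerm n a) (arcPerm n b) x := by
  obtain ⟨-, -, rfl⟩ := meander_isLink_iff.mp h
  exact colourPerm_mem_dihedralOrbit hx _

/-- The vertices that can be reached from `x` along edges in a set that contains all the edges at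
the orbit of `x` are those of the orbit. -/
theorem reflTransGen_restrict_iff {C : Set (Bool × Sym2 (Fin n))} {x y : Fin n}
    (hC : ∀ z ∈ dihedralOrbit (arcPerm n a) (arcPerm n b) x, ∀ e, (meander n a b).Inc e z → e ∈ C) :
    Relation.ReflTransGen ((meander n a b).restrict C).Adj x y ↔
      y ∈ dihedralOrbit (arcPerm n a) (arcPerm n b) x := by
  constructor
  · intro h
    induction h with
    | refl => exact self_mem_dihedralOrbit x
    | tail _ h ih =>
      obtain ⟨e, -, he⟩ := h
      exact mem_dihedralOrbit_of_isLink ih he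
  · have key : ∀ c, ∀ z ∈ {z | z ∈ dihedralOrbit (arcPerm n a) (arcPerm n b) x ∧
        Relation.ReflTransGen ((meander n a b).restrict C).Adj x z},
        colourPerm n a b c z ∈ {z | z ∈ dihedralOrbit (arcPerm n a) (arcPerm n b) x ∧
          Relation.ReflTransGen ((meander n a b).restrict C).Adj x z} := by
      rintro c z ⟨hz, hz'⟩
      refine ⟨colourPerm_mem_dihedralOrbit hz c, ?_⟩
      by_cases h : colourPerm n a b c z = z
      · rwa [h]
      · have he := meander_isLink_colourPerm h
        exact hz'.tail ⟨_, hC z hz _ he.inc_left, he⟩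
    intro hy
    exact (dihedralOrbit_subset (key true) (key false)
      ⟨self_mem_dihedralOrbit x, Relation.ReflTransGen.refl⟩ hy).2

theorem components_meander :
    components (meander n a b) = Set.range (dihedralOrbit (arcPerm n a) (arcPerm n b)) := by
  have h : ∀ x : Fin n, {y | Relation.ReflTransGen (meander n a b).Adj x y} =
      dihedralOrbit (arcPerm n a) (arcPerm n b) x := by
    intro x
    ext y
    rw [Set.mem_ofPred_eq, ← reflTransGen_restrict_iff (C := (meander n a b).edgeSet)
      fun _ _ e he => he.edge_mem, Graph.restrict_self]
  ext S
  simp only [components, h, Set.mem_range, Set.mem_ofPred_eq]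
  exact ⟨fun ⟨x, _, hx⟩ => ⟨x, hx.symm⟩, fun ⟨x, hx⟩ => ⟨x, Set.mem_univ x, hx.symm⟩⟩

/-- The edges of a meander with an end in a given set. -/
def edgesAt (n : ℕ) (a b : List ℕ) (S : Set (Fin n)) : Set (Bool × Sym2 (Fin n)) :=
  {e | ∃ x ∈ S, (meander n a b).Inc e x}

theorem colourPerm_ne_of_isSplit {x : Fin n} (h : IsSplit (arcPerm n a) (arcPerm n b) x)
    {y : Fin n} (hy : y ∈ dihedralOrbit (arcPerm n a) (arcPerm n b) x) (c : Bool) :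
    colourPerm n a b c y ≠ y := by
  have := (isSplit_iff (arcPerm_mul_self n a) (arcPerm_mul_self n b)).mp h y hy
  cases c
  · exact this.2
  · exact this.1

theorem inc_mem_dihedralOrbit {e : Bool × Sym2 (Fin n)} {x y z : Fin n}
    (hx : y ∈ dihedralOrbit (arcPerm n a) (arcPerm n b) x) (h : (meander n a b).Inc e y)
    (h' : (meander n a b).Inc e z) : z ∈ dihedralOrbit (arcPerm n a) (arcPerm n b) x := by
  obtain ⟨w, hw⟩ := h
  rcases h'.eq_or_eq_of_isLink hw with rfl | rfl
  · exact hx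
  · exact mem_dihedralOrbit_of_isLink hx hw

/-- The top and the bottom edge at `x`, if `x` has both. -/
def edgePair (n : ℕ) (a b : List ℕ) (x : Fin n) : Set (Bool × Sym2 (Fin n)) :=
  Set.range fun c => (c, s(x, colourPerm n a b c x))

theorem ncard_edgePair (x : Fin n) : (edgePair n a b x).ncard = 2 := by
  rw [edgePair, ← Set.image_univ, Set.ncard_image_of_injective _ fun c d h => congrArg Prod.fst h,
    Set.ncard_univ, Nat.card_eq_fintype_card, Fintype.card_bool]

theorem mem_edgePair_of_inc {e : Bool × Sym2 (Fin n)} {x : Fin n} (h : (meander n a b).Inc e x) :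
    e ∈ edgePair n a b x :=
  ⟨e.1, (meander_inc_iff.mp h).1.symm⟩

/-- No vertex of a split orbit is fixed by either involution, so each has one top and one bottom
edge. -/
theorem edgesAt_mem_cycles {x : Fin n} (h : IsSplit (arcPerm n a) (arcPerm n b) x) :
    edgesAt n a b (dihedralOrbit (arcPerm n a) (arcPerm n b) x) ∈ cycles (meander n a b) := by
  have hmem : ∀ y, (∃ e ∈ edgesAt n a b (dihedralOrbit (arcPerm n a) (arcPerm n b) x),
      (meander n a b).Inc e y) → y ∈ dihedralOrbit (arcPerm n a) (arcPerm n b) x := by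
    rintro y ⟨e, ⟨z, hz, he⟩, he'⟩
    exact inc_mem_dihedralOrbit hz he he'
  refine ⟨fun e ⟨y, _, he⟩ => he.edge_mem, ?_, Set.toFinite _, fun y hy => ?_, fun y z hy hz => ?_⟩
  · exact ⟨_, x, self_mem_dihedralOrbit x, (meander_isLink_colourPerm
      (colourPerm_ne_of_isSplit h (self_mem_dihedralOrbit x) true)).inc_left⟩
  · have hy' := hmem y hy
    rw [← ncard_edgePair (a := a) (b := b) y]
    congr 1
    ext e
    refine ⟨fun he => mem_edgePair_of_inc he.2, ?_⟩
    rintro ⟨c, rfl⟩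
    have := (meander_isLink_colourPerm (colourPerm_ne_of_isSplit h hy' c)).inc_left
    exact ⟨⟨y, hy', this⟩, this⟩
  · have hy' := hmem y hy
    have hO := dihedralOrbit_eq (arcPerm_mul_self n a) (arcPerm_mul_self n b) hy'
    rw [reflTransGen_restrict_iff]
    · rw [← hO]
      exact hmem z hz
    · rw [← hO]
      exact fun w hw e he => ⟨w, hw, he⟩

/-- A vertex has at most one edge of each colour, so degree two forces both. The vertex set is thus
closed under both involutions without fixed points and, being connected, a single orbit. -/
theorem exists_edgesAt_eq_of_mem_cycles {C : Set (Bool × Sym2 (Fin n))}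
    (hC : C ∈ cycles (meander n a b)) : ∃ x, IsSplit (arcPerm n a) (arcPerm n b) x ∧
      edgesAt n a b (dihedralOrbit (arcPerm n a) (arcPerm n b) x) = C := by
  obtain ⟨hsub, ⟨e₀, he₀⟩, -, hdeg, hconn⟩ := hC
  have hpair : ∀ y ∈ {y | ∃ e ∈ C, (meander n a b).Inc e y},
      {e ∈ C | (meander n a b).Inc e y} = edgePair n a b y := fun y hy =>
    Set.eq_of_subset_of_ncard_le (fun e he => mem_edgePair_of_inc he.2)
      (by rw [ncard_edgePair, hdeg y hy]) (Set.toFinite _)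
  have hinc : ∀ c, ∀ y ∈ {y | ∃ e ∈ C, (meander n a b).Inc e y},
      (c, s(y, colourPerm n a b c y)) ∈ C ∧ colourPerm n a b c y ≠ y := fun c y hy => by
    have h : (c, s(y, colourPerm n a b c y)) ∈ {e ∈ C | (meander n a b).Inc e y} := by
      rw [hpair y hy]
      exact ⟨c, rfl⟩
    exact ⟨h.1, (meander_inc_iff.mp h.2).2⟩
  have hclosed : ∀ c, ∀ y ∈ {y | ∃ e ∈ C, (meander n a b).Inc e y},
      colourPerm n a b c y ∈ {y | ∃ e ∈ C, (meander n a b).Inc e y} := fun c y hy =>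
    ⟨_, (hinc c y hy).1, (meander_isLink_colourPerm (hinc c y hy).2).inc_right⟩
  obtain ⟨x, x', hx⟩ := (meander n a b).exists_isLink_of_mem_edgeSet (hsub he₀)
  have hxC : x ∈ {y | ∃ e ∈ C, (meander n a b).Inc e y} := ⟨e₀, he₀, hx.inc_left⟩
  have horbit := dihedralOrbit_subset (hclosed true) (hclosed false) hxC
  refine ⟨x, (isSplit_iff (arcPerm_mul_self n a) (arcPerm_mul_self n b)).mpr fun y hy =>
    ⟨(hinc true y (horbit hy)).2, (hinc false y (horbit hy)).2⟩, Set.Subset.antisymm ?_ ?_⟩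
  · rintro e ⟨y, hy, he⟩
    have h : e ∈ {e ∈ C | (meander n a b).Inc e y} := by
      rw [hpair y (horbit hy)]
      exact mem_edgePair_of_inc he
    exact h.1
  · intro e he
    obtain ⟨y, z, hyz⟩ := (meander n a b).exists_isLink_of_mem_edgeSet (hsub he)
    refine ⟨y, (reflTransGen_restrict_iff fun w hw f hf => ?_).mp
      (hconn x y hxC ⟨e, he, hyz.inc_left⟩), hyz.inc_left⟩
    have h : f ∈ {e ∈ C | (meander n a b).Inc e w} := by
      rw [hpair w (horbit hw)]
      exact mem_edgePair_of_inc hf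
    exact h.1

theorem ncard_cycles_meander : (cycles (meander n a b)).ncard =
    (dihedralOrbit (arcPerm n a) (arcPerm n b) ''
      {x | IsSplit (arcPerm n a) (arcPerm n b) x}).ncard := by
  have h : cycles (meander n a b) = edgesAt n a b '' (dihedralOrbit (arcPerm n a) (arcPerm n b) ''
      {x | IsSplit (arcPerm n a) (arcPerm n b) x}) := by
    ext C
    constructor
    · intro hC
      obtain ⟨x, hx, rfl⟩ := exists_edgesAt_eq_of_mem_cycles hC
      exact ⟨_, ⟨x, hx, rfl⟩, rfl⟩
    · rintro ⟨_, ⟨x, hx, rfl⟩, rfl⟩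
      exact edgesAt_mem_cycles hx
  rw [h, Set.InjOn.ncard_image]
  rintro _ ⟨x, hx, rfl⟩ _ ⟨x', hx', rfl⟩ hxx'
  have he := (meander_isLink_colourPerm
    (colourPerm_ne_of_isSplit hx (self_mem_dihedralOrbit x) true)).inc_left
  have hmem : (true, s(x, colourPerm n a b true x)) ∈
      edgesAt n a b (dihedralOrbit (arcPerm n a) (arcPerm n b) x') := by
    rw [← hxx']
    exact ⟨x, self_mem_dihedralOrbit x, he⟩
  obtain ⟨y, hy, hy'⟩ := hmem
  exact (dihedralOrbit_eq (arcPerm_mul_self n a) (arcPerm_mul_self n b)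
    (inc_mem_dihedralOrbit hy hy' he)).symm

theorem arcPerm_eq_of_sum_le (ha : a.sum ≤ n) {x : Fin n} (hx : a.sum ≤ x) :
    arcPerm n a x = x :=
  Fin.ext ((arcPerm_apply ha x).trans (reflect_of_sum_le hx))

/-- A tail vertex lies beyond all blocks of one of the strings, which therefore has no edge there.
-/
theorem arcPerm_eq_or_of_mem_tail (ha : a.sum ≤ n) (hb : b.sum ≤ n) {x : Fin n}
    (hx : x ∈ tail n a b) : arcPerm n a x = x ∨ arcPerm n b x = x :=
  (mem_tail.mp hx).imp (fun h => arcPerm_eq_of_sum_le ha h.1) fun h => arcPerm_eq_of_sum_le hb h.1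

theorem listCount_eq_cycles_add_components (ha : a.sum ≤ n) (hb : b.sum ≤ n) :
    listCount n a b = (cycles (meander n a b)).ncard +
      {S ∈ components (meander n a b) |
        (S ∩ tail n a b).ncard = 0 ∨ (S ∩ tail n a b).ncard = 2}.ncard := by
  rw [ncard_cycles_meander, components_meander]
  exact cycleCount_eq_add (arcPerm_mul_self n a) (arcPerm_mul_self n b)
    fun y hy => arcPerm_eq_or_of_mem_tail ha hb hy

end

end SymplecticSeaweed

end

/-! ### The two index formulas -/

theorem mainTheorem1 (K : Type*) [Field K] [IsAlgClosed K] [CharZero K] (n : ℕ) (a b : List ℕ)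
    (ha : SymplecticSeaweed.IsCompositionLE n a) (hb : SymplecticSeaweed.IsCompositionLE n b) :
    SymplecticSeaweed.index K (SymplecticSeaweed.seaweed K n a b) =
        (SymplecticSeaweed.cycles (SymplecticSeaweed.meander n a b)).ncard +
          {S ∈ SymplecticSeaweed.components (SymplecticSeaweed.meander n a b) |
            (S ∩ SymplecticSeaweed.tail n a b).ncard = 0 ∨
              (S ∩ SymplecticSeaweed.tail n a b).ncard = 2}.ncard ∧
      SymplecticSeaweed.index K (SymplecticSeaweed.seaweed K n a b) =
        {S ∈ SymplecticSeaweed.permCycles (SymplecticSeaweed.sigma n a b) |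
          (S ∩ SymplecticSeaweed.tail n a b).ncard = 0 ∨
            (S ∩ SymplecticSeaweed.tail n a b).ncard = 2}.ncard := by
  have h : SymplecticSeaweed.index K (SymplecticSeaweed.seaweed K n a b) =
      SymplecticSeaweed.listCount n a b :=
    (SymplecticSeaweed.index_seaweed ha.2 hb.2).trans
      (SymplecticSeaweed.listIndex_eq_listCount n a b ha.2 hb.2)
  exact ⟨h.trans (SymplecticSeaweed.listCount_eq_cycles_add_components ha.2 hb.2), h⟩
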